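/- Let $d\in\mathbb N$, $T>0$. Let $\mathcal P_1(X)$ be the space of Borel probability measures on $X$ with finite first moment, with the Wasserstein distance $d_1$. Let $L_0:\mathbb R^d\times\mathbb R^d\times\mathcal P_1(\mathbb R^d)\to\mathbb R$, $g:\mathbb R^d\times\mathcal P_1(\mathbb R^d)\to\mathbb R$, $\mu_0$ and a constant $M_0>0$ satisfy the following. * **(M1)** $L_0$ is continuous in all variables; for every $m$ the map $(x,v)\mapsto L_0(x,v,m)$ is of class $C^2$, and $D^2_{(x,v)}L_0$ is continuous in all variables $(x,v,m)$. * **(M2)** For all $(x,v,m)$: $D^2_vL_0(x,v,m)\ge \frac1{M_0}\mathrm{Id}$, $|D_xL_0(x,v,m)|\le M_0(1+|v|^2)$, $|D_vL_0(x,v,m)|\le M_0(1+|v|)$. * **(M3)** $|L_0(x,v,m_1)-L_0(x,v,m_2)|\le\theta(|x|)\,\omega_0(d_1(m_1,m_2))$ for all $x,v,m_1,m_2$, where $\theta,\omega_0:[0,\infty)\to[0,\infty)$ are nondecreasing and $\omega_0(r)\to0$ as $r\downarrow0$. * **(BC1)** $\mu_0$ is a probability measure on $\mathbb R^{2d}$,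 absolutely continuous with respect to Lebesgue measure, with compact support. Put $m_0:=\pi_1\sharp\mu_0$, where $\pi_1(x,v)=x$. * **(BC2)** For every $m$, $g(\cdot,m)$ is bounded and $C^1$ with bounded uniformly continuous gradient, $M_0\ge\max\{\frac12,\frac12\|Dg(\cdot,m)\|_\infty\}$; for every $x$, $g(x,\cdot)$ is uniformly continuous with respect to $d_1$. For every $\varepsilon>0$ let $(u^\varepsilon,\mu^\varepsilon)$ be a solution of the mean field game system with control of acceleration, in the following sense: $\mu^\varepsilon\in C([0,T];\mathcal P_1(\mathbb R^{2d}))$; with $m^\varepsilon_t:=\pi_1\sharp\mu^\varepsilon_t$, $$u^\varepsilon(t,x,v)=\inf\Big\{\int_t^T\Big(\frac\varepsilon2|\ddot\gamma(s)|^2+L_0(\gamma(s),\dot\gamma(s),m^\varepsilon_s)\Big)ds+g(\gamma(T),m^\varepsilon_T)\;:\;\gamma\in H^2(0,T;\mathbb R^d),\ \gamma(t)=x,\ \dot\gamma(t)=v\Big\};$$ and for all $t\in[0,T]$, $\mu^\varepsilon_t$ is the image of $\mu_0$ under a flow which, for $\mu_0$-a.e. initial point $(x,v)$, solves $\dot\gamma(t)=v(t)$,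 $\dot v(t)=-\frac1\varepsilon D_vu^\varepsilon(t,\gamma(t),v(t))$ for $t\in(0,T)$ ($u^\varepsilon$ being differentiable in $v$ along the curve), with $\gamma(0)=x$, $v(0)=v$. Let $\varepsilon_k>0$, $\varepsilon_k\to0$, and let $m^0\in C([0,T];\mathcal P_1(\mathbb R^d))$ be such that $m^{\varepsilon_k}\to m^0$ in $C([0,T];\mathcal P_1(\mathbb R^d))$. Put $$u^0(t,x)=\inf\Big\{\int_t^TL_0(\gamma(s),\dot\gamma(s),m^0_s)\,ds+g(\gamma(T),m^0_T)\;:\;\gamma\in C^1([0,T];\mathbb R^d),\ \gamma(t)=x\Big\},$$ $$H_0(x,p,m)=\sup_{v\in\mathbb R^d}\{-\langle p,v\rangle-L_0(x,v,m)\}.$$ Then, for $m_0$-a.e. $x$, there is exactly one minimizer $t\mapsto\gamma^0_t(x)$ for $u^0(0,x)$; it solves the Euler–Lagrange equation $\frac{d}{dt}D_vL_0(\gamma,\dot\gamma,m^0_t)=D_xL_0(\gamma,\dot\gamma,m^0_t)$ on $[0,T]$, and $$m^0_t=\gamma^0_t\sharp m_0\qquad\text{for all }t\in[0,T].$$ Moreover,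 for every $t\in(0,T)$, $u^0(t,\cdot)$ is differentiable $m^0_t$-almost everywhere, and $m^0$ solves $$\partial_tm^0_t-\mathrm{div}\big(m^0_t\,D_pH_0(x,D_xu^0(t,x),m^0_t)\big)=0\ \text{ in }(0,T)\times\mathbb R^d,\qquad m^0_0=m_0,$$ in the sense of distributions: the vector field $b(t,x)=D_pH_0(x,D_xu^0(t,x),m^0_t)$ satisfies $\int_0^T\!\int|b|\,dm^0_t\,dt<\infty$ and, for every $\psi\in C_c^\infty([0,T)\times\mathbb R^d)$, $$\int_0^T\!\!\int_{\mathbb R^d}\big(\partial_t\psi-\langle D_x\psi,b\rangle\big)\,dm^0_t\,dt+\int_{\mathbb R^d}\psi(0,x)\,dm_0=0 .$$ -/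

import Mathlib

open MeasureTheory Set Filter Topology
open scoped ContDiff

namespace MFG

/-- The Euclidean space `ℝ^d`. Points of `ℝ^{2d}` are pairs `(x, v) : Eu d × Eu d`. -/
abbrev Eu (d : ℕ) : Type := EuclideanSpace ℝ (Fin d)

section Wasserstein

/-- The Wasserstein space `𝒫₁(X)`: probability measures with finite first moment. -/
def P1 (X : Type*) [MetricSpace X] [MeasurableSpace X] : Type _ :=
  {μ : Measure X // IsProbabilityMeasure μ ∧ ∀ x₀ : X, Integrable (fun x => dist x x₀) μ}

/-- The transport plans between `μ` and `ν`. -/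
def Plans {X : Type*} [MeasurableSpace X] (μ ν : Measure X) : Set (Measure (X × X)) :=
  {π | π.map Prod.fst = μ ∧ π.map Prod.snd = ν}

/-- The Wasserstein distance of order one, as an infimum over transport plans. -/
noncomputable def d1 {X : Type*} [MetricSpace X] [MeasurableSpace X] (μ ν : P1 X) : ℝ :=
  sInf ((fun π : Measure (X × X) => ∫ z, dist z.1 z.2 ∂π) '' Plans μ.1 ν.1)

/-- `t ↦ μ_t` belongs to `C([0,T]; 𝒫₁(X))`. -/
def IsContinuousFlow {X : Type*} [MetricSpace X] [MeasurableSpace X] (T : ℝ) (μ : ℝ → P1 X) :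
    Prop :=
  ∀ t ∈ Icc 0 T, Tendsto (fun s => d1 (μ s) (μ t)) (𝓝[Icc 0 T] t) (𝓝 0)

/-- Convergence in `C([0,T]; 𝒫₁(X))`: the `d1`-distance tends to `0` uniformly on `[0,T]`. -/
def FlowTendsto {X : Type*} [MetricSpace X] [MeasurableSpace X] (T : ℝ) (μ : ℕ → ℝ → P1 X)
    (ν : ℝ → P1 X) : Prop :=
  ∀ η > 0, ∀ᶠ k in atTop, ∀ t ∈ Icc 0 T, d1 (μ k t) (ν t) < η

/-- The space marginal `π₁ ♯ μ` of a measure on `ℝ^d × ℝ^d`. -/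
noncomputable def P1.fst {d : ℕ} (μ : P1 (Eu d × Eu d)) : P1 (Eu d) :=
  ⟨μ.1.map Prod.fst, by
    obtain ⟨μ, hμ, hint⟩ := μ
    refine ⟨Measure.isProbabilityMeasure_map measurable_fst.aemeasurable, fun x₀ => ?_⟩
    have hm : Measurable (fun x : Eu d => dist x x₀) := measurable_id.dist measurable_const
    rw [integrable_map_measure hm.aestronglyMeasurable measurable_fst.aemeasurable]
    refine (hint (x₀, x₀)).mono' (hm.comp measurable_fst).aestronglyMeasurable
      (Eventually.of_forall fun z => ?_)
    simp only [Function.comp_apply, Real.norm_eq_abs, abs_of_nonneg dist_nonneg]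
    exact le_max_left _ _⟩

end Wasserstein

/-! Assumptions on the data -/

/-- The assumptions on the Lagrangian `L₀(x, v, m)`. -/
structure LagrangianAssumptions {d : ℕ} (L : Eu d → Eu d → P1 (Eu d) → ℝ) (M₀ : ℝ) : Prop where
  M₀_pos : 0 < M₀
  /-- `L₀` is continuous in all variables. -/
  cont : ∀ (x v : ℕ → Eu d) (m : ℕ → P1 (Eu d)) (x' v' : Eu d) (m' : P1 (Eu d)),
    Tendsto x atTop (𝓝 x') → Tendsto v atTop (𝓝 v') →
    Tendsto (fun n => d1 (m n) m') atTop (𝓝 0) →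
    Tendsto (fun n => L (x n) (v n) (m n)) atTop (𝓝 (L x' v' m'))
  /-- `L₀(·, ·, m)` is of class `C²`. -/
  smooth : ∀ m, ContDiff ℝ 2 (fun z : Eu d × Eu d => L z.1 z.2 m)
  /-- `D²_{(x,v)} L₀` is continuous in all variables. -/
  cont_hess : ∀ (z : ℕ → Eu d × Eu d) (m : ℕ → P1 (Eu d)) (z' : Eu d × Eu d) (m' : P1 (Eu d)),
    Tendsto z atTop (𝓝 z') → Tendsto (fun n => d1 (m n) m') atTop (𝓝 0) →
    Tendsto (fun n => fderiv ℝ (fderiv ℝ (fun y : Eu d × Eu d => L y.1 y.2 (m n))) (z n)) atTop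
      (𝓝 (fderiv ℝ (fderiv ℝ (fun y : Eu d × Eu d => L y.1 y.2 m')) z'))
  /-- `D²_v L₀ ≥ (1/M₀) Id`. -/
  convex : ∀ x v m w,
    1 / M₀ * ‖w‖ ^ 2 ≤ fderiv ℝ (fderiv ℝ (fun v' : Eu d => L x v' m)) v w w
  grad_x : ∀ x v m, ‖gradient (fun y => L y v m) x‖ ≤ M₀ * (1 + ‖v‖ ^ 2)
  grad_v : ∀ x v m, ‖gradient (fun w => L x w m) v‖ ≤ M₀ * (1 + ‖v‖)
  /-- Dependence on the measure: `|L₀(x,v,m₁) - L₀(x,v,m₂)| ≤ θ(|x|) ω₀(d₁(m₁,m₂))`. -/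
  modulus : ∃ θ ω₀ : ℝ → ℝ, (∀ r, 0 ≤ r → 0 ≤ θ r) ∧ MonotoneOn θ (Ici 0) ∧
    (∀ r, 0 ≤ r → 0 ≤ ω₀ r) ∧ MonotoneOn ω₀ (Ici 0) ∧ Tendsto ω₀ (𝓝[≥] 0) (𝓝 0) ∧
    ∀ x v m₁ m₂, |L x v m₁ - L x v m₂| ≤ θ ‖x‖ * ω₀ (d1 m₁ m₂)

/-- The assumption on the initial distribution: a probability measure on `ℝ^{2d}`, absolutely
continuous with respect to Lebesgue measure, with compact support. -/
structure InitialAssumptions {d : ℕ} (μ₀ : Measure (Eu d × Eu d)) : Prop where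
  prob : IsProbabilityMeasure μ₀
  abs_cont : μ₀ ≪ volume
  compact_supp : ∃ K, IsCompact K ∧ μ₀ Kᶜ = 0

/-- The assumptions on the terminal cost `g(x, m)`. -/
structure TerminalAssumptions {d : ℕ} (g : Eu d → P1 (Eu d) → ℝ) (M₀ : ℝ) : Prop where
  smooth : ∀ m, ContDiff ℝ 1 (fun x => g x m)
  bounded : ∀ m, ∃ C, ∀ x, |g x m| ≤ C
  grad_uc : ∀ m, UniformContinuous (gradient (fun x => g x m))
  half_le : 1 / 2 ≤ M₀
  grad_le : ∀ x m, 1 / 2 * ‖gradient (fun y => g y m) x‖ ≤ M₀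
  uc_measure : ∀ x, ∀ η > 0, ∃ δ > 0, ∀ m₁ m₂, d1 m₁ m₂ < δ → |g x m₁ - g x m₂| < η

/-! Curves and value functions -/

/-- The velocity of a curve on `[0,T]` (one-sided derivatives at the endpoints). -/
noncomputable def vel {d : ℕ} (T : ℝ) (γ : ℝ → Eu d) (s : ℝ) : Eu d := derivWithin γ (Icc 0 T) s

/-- `Γ_t(x)`: the `C¹` curves `γ : [0,T] → ℝ^d` with `γ(t) = x`. -/
def Curves {d : ℕ} (T t : ℝ) (x : Eu d) : Set (ℝ → Eu d) :=
  {γ | ContDiffOn ℝ 1 γ (Icc 0 T) ∧ γ t = x}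

/-- `a` is the second derivative of the `H²(0,T)` curve `γ`: `a ∈ L²(0,T)` and `γ'` is a
primitive of `a`. A `C¹` curve is in `H²(0,T)` if and only if such an `a` exists, which is then
unique up to a null set. -/
def IsSecondDeriv {d : ℕ} (T : ℝ) (γ a : ℝ → Eu d) : Prop :=
  MemLp a 2 (volume.restrict (Icc 0 T)) ∧
    ∀ s ∈ Icc 0 T, vel T γ s = vel T γ 0 + ∫ r in (0 : ℝ)..s, a r

/-- The finite values of the functional with acceleration cost,
`∫_t^T (ε/2 |γ''|² + L₀(γ, γ', m_s)) ds + g(γ(T), m_T)`, over the curves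
`γ ∈ H²(0,T)` with `γ(t) = x` and `γ'(t) = v`. -/
def epsCosts {d : ℕ} (L : Eu d → Eu d → P1 (Eu d) → ℝ) (g : Eu d → P1 (Eu d) → ℝ) (T ε : ℝ)
    (m : ℝ → P1 (Eu d)) (t : ℝ) (x v : Eu d) : Set ℝ :=
  {r | ∃ γ ∈ Curves T t x, ∃ a, vel T γ t = v ∧ IsSecondDeriv T γ a ∧
    r = (∫ s in t..T, (ε / 2 * ‖a s‖ ^ 2 + L (γ s) (vel T γ s) (m s))) + g (γ T) (m T)}

/-- A solution `(u^ε, μ^ε)` of the mean field game system with control of acceleration: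
`μ^ε ∈ C([0,T]; 𝒫₁(ℝ^{2d}))`, the function `u^ε` is the value function of the control problem in
which the population follows `m^ε_t = π₁ ♯ μ^ε_t`, and `μ^ε_t` is the image of `μ₀` under the flow
`γ' = v`, `v' = -(1/ε) D_v u^ε(t, γ, v)`. -/
structure IsEpsSolution {d : ℕ} (L : Eu d → Eu d → P1 (Eu d) → ℝ) (g : Eu d → P1 (Eu d) → ℝ)
    (T : ℝ) (μ₀ : Measure (Eu d × Eu d)) (ε : ℝ) (u : ℝ → Eu d → Eu d → ℝ)
    (μ : ℝ → P1 (Eu d × Eu d)) : Prop where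
  cont : IsContinuousFlow T μ
  value : ∀ t ∈ Icc 0 T, ∀ x v, u t x v = sInf (epsCosts L g T ε (fun s => (μ s).fst) t x v)
  flow : ∃ X V : ℝ → Eu d × Eu d → Eu d,
    (∀ᵐ z ∂μ₀,
      X 0 z = z.1 ∧ V 0 z = z.2 ∧
      ContinuousOn (fun t => X t z) (Icc 0 T) ∧ ContinuousOn (fun t => V t z) (Icc 0 T) ∧
      ∀ t ∈ Ioo 0 T,
        HasDerivAt (fun s => X s z) (V t z) t ∧
        DifferentiableAt ℝ (u t (X t z)) (V t z) ∧
        HasDerivAt (fun s => V s z) (-(1 / ε) • gradient (u t (X t z)) (V t z)) t) ∧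
    ∀ t ∈ Icc 0 T, AEMeasurable (fun z => (X t z, V t z)) μ₀ ∧
      (μ t).1 = μ₀.map (fun z => (X t z, V t z))

/-- The limit cost `∫_t^T L₀(γ, γ', m_s) ds + g(γ(T), m_T)`. -/
noncomputable def limitCost {d : ℕ} (L : Eu d → Eu d → P1 (Eu d) → ℝ) (g : Eu d → P1 (Eu d) → ℝ)
    (T : ℝ) (m : ℝ → P1 (Eu d)) (t : ℝ) (γ : ℝ → Eu d) : ℝ :=
  (∫ s in t..T, L (γ s) (vel T γ s) (m s)) + g (γ T) (m T)

/-- The limit value function `u⁰(t,x)`, the infimum of the limit cost over `Γ_t(x)`. -/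
noncomputable def limitValue {d : ℕ} (L : Eu d → Eu d → P1 (Eu d) → ℝ)
    (g : Eu d → P1 (Eu d) → ℝ) (T : ℝ) (m : ℝ → P1 (Eu d)) (t : ℝ) (x : Eu d) : ℝ :=
  sInf (limitCost L g T m t '' Curves T t x)

/-- `γ` is a minimizer for `u⁰(t,x)`. -/
def IsMinimizer {d : ℕ} (L : Eu d → Eu d → P1 (Eu d) → ℝ) (g : Eu d → P1 (Eu d) → ℝ)
    (T : ℝ) (m : ℝ → P1 (Eu d)) (t : ℝ) (x : Eu d) (γ : ℝ → Eu d) : Prop :=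
  γ ∈ Curves T t x ∧ IsMinOn (limitCost L g T m t) (Curves T t x) γ

/-- The Euler-Lagrange equation `d/ds D_v L₀(γ, γ', m_s) = D_x L₀(γ, γ', m_s)` on `[0,T]`. -/
def SolvesEulerLagrange {d : ℕ} (L : Eu d → Eu d → P1 (Eu d) → ℝ) (T : ℝ) (m : ℝ → P1 (Eu d))
    (γ : ℝ → Eu d) : Prop :=
  ContDiffOn ℝ 1 γ (Icc 0 T) ∧ ∀ s ∈ Icc 0 T,
    HasDerivWithinAt (fun r => gradient (fun w => L (γ r) w (m r)) (vel T γ r))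
      (gradient (fun y => L y (vel T γ s) (m s)) (γ s)) (Icc 0 T) s

/-! The limit system -/

/-- The Hamiltonian `H₀(x,p,m) = sup_v (-⟨p,v⟩ - L₀(x,v,m))`. -/
noncomputable def hamiltonian {d : ℕ} (L : Eu d → Eu d → P1 (Eu d) → ℝ) (x p : Eu d)
    (m : P1 (Eu d)) : ℝ :=
  ⨆ v : Eu d, (-inner ℝ p v - L x v m)

/-- `m` solves `∂_t m - div (m b) = 0` on `(0,T) × ℝ^d` with initial datum `m₀`, in the sense of
distributions: `b` is integrable for `m_t ⊗ dt`, and for each test function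
`ψ ∈ C_c^∞([0,T) × ℝ^d)`,
`∫_0^T ∫ (∂_t ψ - ⟨D_x ψ, b⟩) dm_t dt + ∫ ψ(0,x) dm₀ = 0`. -/
def SolvesContinuityEquation {d : ℕ} (T : ℝ) (b : ℝ → Eu d → Eu d) (m : ℝ → P1 (Eu d))
    (m₀ : Measure (Eu d)) : Prop :=
  (∀ᵐ t ∂(volume.restrict (Ioo 0 T)), Integrable (b t) (m t).1) ∧
  IntervalIntegrable (fun t => ∫ x, ‖b t x‖ ∂(m t).1) volume 0 T ∧
  ∀ ψ : ℝ × Eu d → ℝ, ContDiff ℝ ∞ ψ → HasCompactSupport ψ → tsupport ψ ⊆ Iio T ×ˢ univ →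
    IntervalIntegrable (fun t => ∫ x, (deriv (fun s => ψ (s, x)) t
      - inner ℝ (gradient (fun y => ψ (t, y)) x) (b t x)) ∂(m t).1) volume 0 T ∧
    (∫ t in (0 : ℝ)..T, ∫ x, (deriv (fun s => ψ (s, x)) t
      - inner ℝ (gradient (fun y => ψ (t, y)) x) (b t x)) ∂(m t).1)
      + ∫ x, ψ (0, x) ∂m₀ = 0

end MFG

open MFG

/-! Fix `ε` and a characteristic `(X, V)` of the system with control of acceleration. Its feedback
law `V' = -(1/ε) D_v u^ε` makes it at least as good as an optimal curve for the cost without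
acceleration: `∫ L₀(X, V, m^ε) + g(X(T)) ≤ u^ε(0, x, v)` (`cost_le_epsValue`). Conversely `limsup
u^ε(0, x, v) ≤ u⁰(0, x)` for every `v`: a velocity that nearly realizes `u⁰(0, x)` is approximated
in `L²` by a smooth one starting from `v`, whose acceleration cost is finite and disappears with the
factor `ε` (`eventually_epsValue_le_value_add`). Hence the characteristics starting from `(x, v)`
form a minimizing sequence for `u⁰(0, x)` (`tendsto_action_of_le`).

Uniform convexity in the velocity makes minimizing sequences precompact in a strong sense
(`exists_l2_minimizer`), and limits solve the Euler-Lagrange equation (`ae_eq_costate`). At a point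
where `u⁰(0, ·)` is differentiable, its gradient fixes the initial momentum, so there is only one
minimizer and the whole sequence converges to it. By Rademacher's theorem, and because `m₀` is
absolutely continuous, this happens for `m₀`-almost every `x`. The push-forward formula for `m^ε_t`
then passes to the limit (`eq_map_of_tendsto`) and gives `m⁰_t = γ⁰_t ♯ m₀`.

At an interior time `t` of a minimizer, `u⁰(t, ·)` is squeezed between two differentiable functions
touching it at `γ(t)`, so it is differentiable there with gradient `-D_v L₀` (`hasFDerivAt_value`).
By Legendre duality the field `D_p H₀` at this gradient is `-γ'`, and the continuity equation is the
chain rule for test functions along the flow.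

The delicate point is the verification inequality, since `u^ε` is only known to be differentiable in
`v` along the curve. Perturbing the velocity shows that a nearly optimal control on `[t, t + r]` has
mean close to `-(1/ε) D_v u^ε = V'(t)`. The nearly optimal curve and the characteristic therefore
agree at time `t + r` up to `o(r)`, and dynamic programming bounds a right Dini derivative of `u^ε`
along the characteristic. -/

namespace MFG

/-! ### Abstract Lagrangians: growth, uniform convexity, Legendre transform. -/

/-- A time-dependent Lagrangian `ℓ s x v` with partial gradients `Lx`, `Lv`: quadratic growth and
uniform convexity in the velocity, locally Lipschitz gradients. -/
structure IsLag {d : ℕ} (ℓ : ℝ → Eu d → Eu d → ℝ) (Lx Lv : ℝ → Eu d → Eu d → Eu d) (M C : ℝ) :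
    Prop where
  M_pos : 0 < M
  cont : Continuous fun p : ℝ × Eu d × Eu d => ℓ p.1 p.2.1 p.2.2
  cont_x : Continuous fun p : ℝ × Eu d × Eu d => Lx p.1 p.2.1 p.2.2
  cont_v : Continuous fun p : ℝ × Eu d × Eu d => Lv p.1 p.2.1 p.2.2
  hasFDerivAt : ∀ s x v, HasFDerivAt (fun z : Eu d × Eu d => ℓ s z.1 z.2)
    ((innerSL ℝ (Lx s x v)).comp (ContinuousLinearMap.fst ℝ (Eu d) (Eu d)) +
      (innerSL ℝ (Lv s x v)).comp (ContinuousLinearMap.snd ℝ (Eu d) (Eu d))) (x, v)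
  bound_x : ∀ s x v, ‖Lx s x v‖ ≤ M * (1 + ‖v‖ ^ 2)
  bound_v : ∀ s x v, ‖Lv s x v‖ ≤ M * (1 + ‖v‖)
  convex : ∀ s x v w, ℓ s x v + inner ℝ (Lv s x v) (w - v) + 1 / (2 * M) * ‖w - v‖ ^ 2 ≤ ℓ s x w
  lip : ∀ R, ∃ K, 0 ≤ K ∧ ∀ s x v x' v', ‖x‖ ≤ R → ‖v‖ ≤ R → ‖x'‖ ≤ R → ‖v'‖ ≤ R →
    ‖Lx s x v - Lx s x' v'‖ ≤ K * (‖x - x'‖ + ‖v - v'‖) ∧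
    ‖Lv s x v - Lv s x' v'‖ ≤ K * (‖x - x'‖ + ‖v - v'‖)
  zero : ∀ s, |ℓ s 0 0| ≤ C

/-- A `C¹` terminal cost with bounded gradient. -/
structure IsTerm {d : ℕ} (G : Eu d → ℝ) (Gx : Eu d → Eu d) (M C : ℝ) : Prop where
  hasFDerivAt : ∀ x, HasFDerivAt G (innerSL ℝ (Gx x)) x
  bound : ∀ x, ‖Gx x‖ ≤ 2 * M
  zero : |G 0| ≤ C

variable {d : ℕ} {ℓ : ℝ → Eu d → Eu d → ℝ} {Lx Lv : ℝ → Eu d → Eu d → Eu d} {M C : ℝ}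
  {G : Eu d → ℝ} {Gx : Eu d → Eu d}

namespace IsTerm

theorem lipschitz (hG : IsTerm G Gx M C) (x y : Eu d) : |G y - G x| ≤ 2 * M * ‖y - x‖ := by
  refine Convex.norm_image_sub_le_of_norm_hasFDerivWithin_le (𝕜 := ℝ) (s := univ)
    (fun z _ => (hG.hasFDerivAt z).hasFDerivWithinAt) (fun z _ => ?_) convex_univ
    (mem_univ _) (mem_univ _)
  rw [innerSL_apply_norm]
  exact hG.bound z

theorem abs_le (hG : IsTerm G Gx M C) (x : Eu d) : |G x| ≤ C + 2 * M * ‖x‖ := by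
  have h := hG.lipschitz 0 x
  have h0 := hG.zero
  rw [sub_zero] at h
  calc |G x| = |(G x - G 0) + G 0| := by ring_nf
    _ ≤ |G x - G 0| + |G 0| := abs_add_le _ _
    _ ≤ _ := by linarith

end IsTerm

namespace IsLag

theorem C_nonneg (h : IsLag ℓ Lx Lv M C) : 0 ≤ C := (abs_nonneg _).trans (h.zero 0)

theorem hasFDerivAt_left (h : IsLag ℓ Lx Lv M C) (s : ℝ) (x v : Eu d) :
    HasFDerivAt (fun y => ℓ s y v) (innerSL ℝ (Lx s x v)) x := by
  have := HasFDerivAt.comp (g := fun z : Eu d × Eu d => ℓ s z.1 z.2)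
    (f := fun y => (y, v)) x (h.hasFDerivAt s x v)
    ((hasFDerivAt_id x).prodMk (hasFDerivAt_const v x))
  refine this.congr_fderiv ?_
  ext w
  simp

theorem hasFDerivAt_right (h : IsLag ℓ Lx Lv M C) (s : ℝ) (x v : Eu d) :
    HasFDerivAt (fun w => ℓ s x w) (innerSL ℝ (Lv s x v)) v := by
  have := HasFDerivAt.comp (g := fun z : Eu d × Eu d => ℓ s z.1 z.2) v (h.hasFDerivAt s x v)
    ((hasFDerivAt_const x v).prodMk (hasFDerivAt_id v))
  refine this.congr_fderiv ?_
  ext w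
  simp

theorem continuous_comp (h : IsLag ℓ Lx Lv M C) {X : Type*} [TopologicalSpace X] {τ : X → ℝ}
    {y w : X → Eu d} (hτ : Continuous τ) (hy : Continuous y) (hw : Continuous w) :
    Continuous fun s => ℓ (τ s) (y s) (w s) :=
  h.cont.comp (hτ.prodMk (hy.prodMk hw))

theorem continuous_comp_x (h : IsLag ℓ Lx Lv M C) {X : Type*} [TopologicalSpace X] {τ : X → ℝ}
    {y w : X → Eu d} (hτ : Continuous τ) (hy : Continuous y) (hw : Continuous w) :
    Continuous fun s => Lx (τ s) (y s) (w s) :=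
  h.cont_x.comp (hτ.prodMk (hy.prodMk hw))

theorem continuous_comp_v (h : IsLag ℓ Lx Lv M C) {X : Type*} [TopologicalSpace X] {τ : X → ℝ}
    {y w : X → Eu d} (hτ : Continuous τ) (hy : Continuous y) (hw : Continuous w) :
    Continuous fun s => Lv (τ s) (y s) (w s) :=
  h.cont_v.comp (hτ.prodMk (hy.prodMk hw))

theorem abs_sub_left_le (h : IsLag ℓ Lx Lv M C) (s : ℝ) (x x' v : Eu d) :
    |ℓ s x' v - ℓ s x v| ≤ M * (1 + ‖v‖ ^ 2) * ‖x' - x‖ := by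
  refine Convex.norm_image_sub_le_of_norm_hasFDerivWithin_le (𝕜 := ℝ) (s := univ)
    (fun z _ => (h.hasFDerivAt_left s z v).hasFDerivWithinAt) (fun z _ => ?_) convex_univ
    (mem_univ _) (mem_univ _)
  rw [innerSL_apply_norm]
  exact h.bound_x s z v

theorem abs_sub_right_le (h : IsLag ℓ Lx Lv M C) (s : ℝ) (x v v' : Eu d) :
    |ℓ s x v' - ℓ s x v| ≤ M * (1 + ‖v‖ + ‖v'‖) * ‖v' - v‖ := by
  refine Convex.norm_image_sub_le_of_norm_hasFDerivWithin_le (𝕜 := ℝ)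
    (s := Metric.closedBall 0 (‖v‖ + ‖v'‖))
    (fun z _ => (h.hasFDerivAt_right s x z).hasFDerivWithinAt) (fun z hz => ?_)
    (convex_closedBall _ _) (by simp) (by simp)
  rw [innerSL_apply_norm]
  refine (h.bound_v s x z).trans ?_
  have := h.M_pos
  rw [mem_closedBall_zero_iff] at hz
  rw [add_assoc]
  gcongr

theorem abs_sub_le (h : IsLag ℓ Lx Lv M C) (s : ℝ) (x v x' v' : Eu d) :
    |ℓ s x' v' - ℓ s x v| ≤
      M * (1 + ‖v‖ ^ 2) * ‖x' - x‖ + M * (1 + ‖v‖ + ‖v'‖) * ‖v' - v‖ := by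
  have h1 := h.abs_sub_left_le s x x' v
  have h2 := h.abs_sub_right_le s x' v v'
  calc |ℓ s x' v' - ℓ s x v| = |(ℓ s x' v - ℓ s x v) + (ℓ s x' v' - ℓ s x' v)| := by ring_nf
    _ ≤ _ := (abs_add_le _ _).trans (add_le_add h1 h2)

theorem abs_le (h : IsLag ℓ Lx Lv M C) (s : ℝ) (x v : Eu d) :
    |ℓ s x v| ≤ C + M * ‖x‖ + M * (1 + ‖v‖) * ‖v‖ := by
  have h1 := h.abs_sub_le s 0 0 x v
  have h0 := h.zero s
  simp only [norm_zero, sub_zero, add_zero] at h1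
  calc |ℓ s x v| = |(ℓ s x v - ℓ s 0 0) + ℓ s 0 0| := by ring_nf
    _ ≤ |ℓ s x v - ℓ s 0 0| + |ℓ s 0 0| := abs_add_le _ _
    _ ≤ _ := by nlinarith

/-- Convexity is used from the base velocity `0`. Its linear term is at most `M * ‖v‖`, and Young's
inequality absorbs it into half of the quadratic term at the price `M ^ 3`. -/
theorem le_apply (h : IsLag ℓ Lx Lv M C) (s : ℝ) (x v : Eu d) :
    1 / (4 * M) * ‖v‖ ^ 2 - M * ‖x‖ - (C + M ^ 3) ≤ ℓ s x v := by
  have hM := h.M_pos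
  have h1 := h.convex s x 0 v
  have h2 := h.abs_sub_left_le s 0 x 0
  have h3 := h.zero s
  have h4 : |inner ℝ (Lv s x 0) v| ≤ M * ‖v‖ := by
    refine (abs_real_inner_le_norm _ _).trans ?_
    have := h.bound_v s x 0
    rw [norm_zero, add_zero, mul_one] at this
    gcongr
  simp only [sub_zero, norm_zero] at h1 h2
  rw [abs_le'] at h4
  have h5 := _root_.abs_le.1 h2
  have h6 := _root_.abs_le.1 h3
  have h7 : M * ‖v‖ ≤ 1 / (4 * M) * ‖v‖ ^ 2 + M ^ 3 := by
    have : 1 / (4 * M) * ‖v‖ ^ 2 + M ^ 3 - M * ‖v‖ = 1 / (4 * M) * (‖v‖ - 2 * M ^ 2) ^ 2 := by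
      field_simp
      ring
    have : 0 ≤ 1 / (4 * M) * (‖v‖ - 2 * M ^ 2) ^ 2 := by positivity
    linarith
  have h8 : 1 / (2 * M) * ‖v‖ ^ 2 = 1 / (4 * M) * ‖v‖ ^ 2 + 1 / (4 * M) * ‖v‖ ^ 2 := by
    field_simp
    ring
  nlinarith

/-- Uniform convexity at the midpoint of two phase points. -/
theorem midpoint_le (h : IsLag ℓ Lx Lv M C) (s : ℝ) (x₁ x₂ v₁ v₂ : Eu d) :
    ℓ s ((1 / 2 : ℝ) • (x₁ + x₂)) ((1 / 2 : ℝ) • (v₁ + v₂)) + 1 / (8 * M) * ‖v₁ - v₂‖ ^ 2 ≤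
      1 / 2 * ℓ s x₁ v₁ + 1 / 2 * ℓ s x₂ v₂
        + M * (1 + ‖v₁‖ ^ 2 + ‖v₂‖ ^ 2) * ‖x₁ - x₂‖ := by
  set x := (1 / 2 : ℝ) • (x₁ + x₂)
  set v := (1 / 2 : ℝ) • (v₁ + v₂)
  have hM := h.M_pos
  have e1 : v₁ - v = (1 / 2 : ℝ) • (v₁ - v₂) := by simp only [v]; module
  have e2 : v₂ - v = -((1 / 2 : ℝ) • (v₁ - v₂)) := by simp only [v]; module
  have e3 : x - x₁ = -((1 / 2 : ℝ) • (x₁ - x₂)) := by simp only [x]; module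
  have e4 : x - x₂ = (1 / 2 : ℝ) • (x₁ - x₂) := by simp only [x]; module
  -- Both tangent inequalities are based at the midpoint, so their linear terms are opposite and
  -- cancel in the mean. Only the change of position from `x₁`, `x₂` to the midpoint is left to
  -- estimate.
  have a1 := h.convex s x v v₁
  have a2 := h.convex s x v v₂
  have b1 := (_root_.abs_le.1 (h.abs_sub_left_le s x₁ x v₁)).2
  have b2 := (_root_.abs_le.1 (h.abs_sub_left_le s x₂ x v₂)).2
  have n : ‖(1 / 2 : ℝ)‖ = 1 / 2 := by norm_num
  rw [e1, norm_smul, n] at a1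
  rw [e2, norm_neg, inner_neg_right, norm_smul, n] at a2
  rw [e3, norm_neg, norm_smul, n] at b1
  rw [e4, norm_smul, n] at b2
  have e5 : 1 / (2 * M) * (1 / 2 * ‖v₁ - v₂‖) ^ 2 = 1 / (8 * M) * ‖v₁ - v₂‖ ^ 2 := by
    field_simp
    ring
  rw [e5] at a1 a2
  have p1 : 0 ≤ M * ‖x₁ - x₂‖ := by positivity
  nlinarith [mul_nonneg p1 (sq_nonneg ‖v₁‖), mul_nonneg p1 (sq_nonneg ‖v₂‖)]

/-- Adding the convexity inequalities from `v` to `w` and from `w` to `v` gives strong monotonicity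
of `Lv s x`. This is what makes the Legendre transform injective with an `M`-Lipschitz inverse. -/
theorem monotone_right (h : IsLag ℓ Lx Lv M C) (s : ℝ) (x v w : Eu d) :
    ‖w - v‖ ≤ M * ‖Lv s x w - Lv s x v‖ := by
  have hM := h.M_pos
  have a1 := h.convex s x v w
  have a2 := h.convex s x w v
  have e : v - w = -(w - v) := by abel
  rw [e, norm_neg, inner_neg_right] at a2
  have a3 : 1 / M * ‖w - v‖ ^ 2 ≤ inner ℝ (Lv s x w - Lv s x v) (w - v) := by
    rw [inner_sub_left]
    have : 1 / M = 1 / (2 * M) + 1 / (2 * M) := by field_simp; norm_num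
    rw [this]
    linarith
  have a4 := a3.trans (real_inner_le_norm _ _)
  rcases (norm_nonneg (w - v)).eq_or_lt with h0 | h0
  · rw [← h0]; positivity
  · have : 1 / M * ‖w - v‖ ≤ ‖Lv s x w - Lv s x v‖ := by
      refine le_of_mul_le_mul_right ?_ h0
      linarith [a4, pow_two ‖w - v‖, mul_assoc (1 / M) ‖w - v‖ ‖w - v‖]
    calc ‖w - v‖ = M * (1 / M * ‖w - v‖) := by field_simp
      _ ≤ _ := by gcongr

/-- The required velocity is a minimum point of the coercive function `v ↦ ℓ s x v - ⟨q, v⟩`. -/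
theorem surjective_right (h : IsLag ℓ Lx Lv M C) (s : ℝ) (x q : Eu d) : ∃ v, Lv s x v = q := by
  have hM := h.M_pos
  have hc : Continuous fun v => ℓ s x v - inner ℝ q v :=
    (h.continuous_comp continuous_const continuous_const continuous_id).sub
      (continuous_const.inner continuous_id)
  have hlim : Tendsto (fun v => ℓ s x v - inner ℝ q v) (cocompact (Eu d)) atTop := by
    have h1 : Tendsto (fun r : ℝ => r * (1 / (4 * M) * r - ‖q‖) - (M * ‖x‖ + (C + M ^ 3)))
        atTop atTop := by
      refine tendsto_atTop_add_const_right _ _ (tendsto_id.atTop_mul_atTop₀ ?_)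
      refine tendsto_atTop_add_const_right _ _ ?_
      exact tendsto_id.const_mul_atTop (by positivity)
    refine tendsto_atTop_mono (fun v => ?_) (h1.comp (tendsto_norm_cocompact_atTop (E := Eu d)))
    have a1 := h.le_apply s x v
    have a2 := real_inner_le_norm q v
    simp only [Function.comp_apply]
    nlinarith
  obtain ⟨v, hv⟩ := hc.exists_forall_le hlim
  refine ⟨v, ?_⟩
  have hd : HasFDerivAt (fun v => ℓ s x v - inner ℝ q v) (innerSL ℝ (Lv s x v) - innerSL ℝ q) v :=
    (h.hasFDerivAt_right s x v).sub (innerSL ℝ q).hasFDerivAt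
  have h0 : innerSL ℝ (Lv s x v) - innerSL ℝ q = 0 :=
    IsLocalMin.hasFDerivAt_eq_zero (Eventually.of_forall hv) hd
  rw [← map_sub] at h0
  have h1 : inner ℝ (Lv s x v - q) (Lv s x v - q) = (0 : ℝ) := by
    rw [← innerSL_apply_apply ℝ, h0]; rfl
  exact sub_eq_zero.1 (inner_self_eq_zero.1 h1)

end IsLag

/-- The inverse of the Legendre transform `v ↦ Lv s x v`. -/
noncomputable def legendreInv {d : ℕ} (Lv : ℝ → Eu d → Eu d → Eu d) (s : ℝ) (x q : Eu d) : Eu d :=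
  Function.invFun (Lv s x) q

namespace IsLag

theorem apply_legendreInv (h : IsLag ℓ Lx Lv M C) (s : ℝ) (x q : Eu d) :
    Lv s x (legendreInv Lv s x q) = q :=
  Function.invFun_eq (h.surjective_right s x q)

theorem norm_sub_legendreInv_le (h : IsLag ℓ Lx Lv M C) (s : ℝ) (x q v : Eu d) :
    ‖v - legendreInv Lv s x q‖ ≤ M * ‖Lv s x v - q‖ := by
  have := h.monotone_right s x (legendreInv Lv s x q) v
  rwa [h.apply_legendreInv] at this

theorem legendreInv_apply (h : IsLag ℓ Lx Lv M C) (s : ℝ) (x v : Eu d) :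
    legendreInv Lv s x (Lv s x v) = v := by
  have := h.norm_sub_legendreInv_le s x (Lv s x v) v
  rw [sub_self, norm_zero, mul_zero] at this
  exact (sub_eq_zero.1 (norm_le_zero_iff.1 this)).symm

/-- With `v₀` frozen, `norm_sub_legendreInv_le` bounds the variation of the inverse by a function of
the parameters which is continuous and vanishes at `p₀`. No second derivative of `ℓ` is involved. -/
theorem continuous_legendreInv (h : IsLag ℓ Lx Lv M C) :
    Continuous fun p : ℝ × Eu d × Eu d => legendreInv Lv p.1 p.2.1 p.2.2 := by
  refine continuous_iff_continuousAt.2 fun p₀ => ?_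
  rw [ContinuousAt, tendsto_iff_norm_sub_tendsto_zero]
  set v₀ := legendreInv Lv p₀.1 p₀.2.1 p₀.2.2 with hv₀
  have hc : Continuous fun p : ℝ × Eu d × Eu d => M * ‖Lv p.1 p.2.1 v₀ - p.2.2‖ :=
    continuous_const.mul ((h.continuous_comp_v continuous_fst (continuous_fst.comp continuous_snd)
      continuous_const).sub (continuous_snd.comp continuous_snd)).norm
  have h0 : M * ‖Lv p₀.1 p₀.2.1 v₀ - p₀.2.2‖ = 0 := by
    rw [hv₀, h.apply_legendreInv]; simp
  have ht := hc.tendsto p₀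
  rw [h0] at ht
  refine squeeze_zero (fun _ => norm_nonneg _) (fun p => ?_) ht
  rw [norm_sub_rev]
  exact h.norm_sub_legendreInv_le _ _ _ _

end IsLag
end MFG

/-! ### Square integrable velocities, their curves, and the action. -/

namespace MFG
variable {d : ℕ} {ℓ : ℝ → Eu d → Eu d → ℝ} {Lx Lv : ℝ → Eu d → Eu d → Eu d} {M C : ℝ}
  {G : Eu d → ℝ} {Gx : Eu d → Eu d}

/-- Locally square integrable functions of time. -/
def L2loc (w : ℝ → Eu d) : Prop :=
  AEStronglyMeasurable w volume ∧ LocallyIntegrable (fun s => ‖w s‖ ^ 2) volume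

namespace L2loc
variable {w w' : ℝ → Eu d}

theorem of_continuous (hw : Continuous w) : L2loc w :=
  ⟨hw.aestronglyMeasurable, (hw.norm.pow 2).locallyIntegrable⟩

theorem of_norm_sq_le (hw : AEStronglyMeasurable w volume) {f : ℝ → ℝ}
    (hf : LocallyIntegrable f volume) (h : ∀ s, ‖w s‖ ^ 2 ≤ f s) : L2loc w := by
  refine ⟨hw, hf.mono (hw.norm.pow 2) (Eventually.of_forall fun s => ?_)⟩
  rw [Real.norm_of_nonneg (by positivity)]
  exact (h s).trans (le_abs_self _)

theorem smul (hw : L2loc w) (c : ℝ) : L2loc fun s => c • w s := by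
  refine of_norm_sq_le (hw.1.const_smul c) (hw.2.smul (c ^ 2)) fun s => ?_
  simp [norm_smul, mul_pow]

theorem add (hw : L2loc w) (hw' : L2loc w') : L2loc fun s => w s + w' s := by
  refine of_norm_sq_le (hw.1.add hw'.1) ((hw.2.add hw'.2).smul (2 : ℝ)) fun s => ?_
  simp only [Pi.smul_apply, Pi.add_apply, smul_eq_mul]
  have := norm_add_le (w s) (w' s)
  nlinarith [norm_nonneg (w s + w' s), sq_nonneg (‖w s‖ - ‖w' s‖)]

theorem sub (hw : L2loc w) (hw' : L2loc w') : L2loc fun s => w s - w' s := by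
  simpa [sub_eq_add_neg] using hw.add (hw'.smul (-1))

theorem locallyIntegrable (hw : L2loc w) : LocallyIntegrable w volume := by
  refine ((locallyIntegrable_const (1 : ℝ)).add hw.2).mono hw.1 (Eventually.of_forall fun s => ?_)
  simp only [Pi.add_apply]
  rw [Real.norm_of_nonneg (by positivity)]
  nlinarith [sq_nonneg (‖w s‖ - 1)]

theorem intervalIntegrable (hw : L2loc w) (a b : ℝ) : IntervalIntegrable w volume a b :=
  (hw.locallyIntegrable.integrableOn_isCompact isCompact_uIcc).intervalIntegrable

theorem intervalIntegrable_sq (hw : L2loc w) (a b : ℝ) :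
    IntervalIntegrable (fun s => ‖w s‖ ^ 2) volume a b :=
  (hw.2.integrableOn_isCompact isCompact_uIcc).intervalIntegrable

theorem intervalIntegrable_norm (hw : L2loc w) (a b : ℝ) :
    IntervalIntegrable (fun s => ‖w s‖) volume a b :=
  (hw.intervalIntegrable a b).norm

theorem piecewise (hw : L2loc w) (hw' : L2loc w') {S : Set ℝ} (hS : MeasurableSet S)
    [DecidablePred (· ∈ S)] : L2loc (S.piecewise w w') := by
  refine of_norm_sq_le (AEStronglyMeasurable.piecewise hS hw.1.restrict hw'.1.restrict)
    (hw.2.add hw'.2) fun s => ?_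
  by_cases hs : s ∈ S
  · simp only [Set.piecewise_eq_of_mem _ _ _ hs, Pi.add_apply]
    nlinarith [sq_nonneg ‖w' s‖]
  · simp only [Set.piecewise_eq_of_notMem _ _ _ hs, Pi.add_apply]
    nlinarith [sq_nonneg ‖w s‖]

/-- Young's inequality in place of Cauchy-Schwarz. A small `β` lets the energy be absorbed, as in
`exists_coercive`; the choice `β = √(b - a)` gives Hölder estimates of exponent one half. -/
theorem integral_norm_le (hw : L2loc w) {a b β : ℝ} (hab : a ≤ b) (hβ : 0 < β) :
    ∫ s in a..b, ‖w s‖ ≤ β * (∫ s in a..b, ‖w s‖ ^ 2) + (b - a) / (4 * β) := by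
  have h1 : ∫ s in a..b, ‖w s‖ ≤ ∫ s in a..b, (β * ‖w s‖ ^ 2 + 1 / (4 * β)) := by
    refine intervalIntegral.integral_mono_on hab (hw.intervalIntegrable_norm a b)
      (((hw.intervalIntegrable_sq a b).const_mul β).add intervalIntegrable_const) fun s _ => ?_
    have : β * ‖w s‖ ^ 2 + 1 / (4 * β) - ‖w s‖ = β * (‖w s‖ - 1 / (2 * β)) ^ 2 := by
      field_simp
      ring
    nlinarith [mul_nonneg hβ.le (sq_nonneg (‖w s‖ - 1 / (2 * β)))]
  refine h1.trans_eq ?_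
  rw [intervalIntegral.integral_add ((hw.intervalIntegrable_sq a b).const_mul β)
    intervalIntegrable_const, intervalIntegral.integral_const_mul, intervalIntegral.integral_const]
  simp only [smul_eq_mul]
  ring

end L2loc

/-- The curve with velocity `w` which is at `x` at time `t`. -/
noncomputable def path {d : ℕ} (t : ℝ) (x : Eu d) (w : ℝ → Eu d) (s : ℝ) : Eu d :=
  x + ∫ r in t..s, w r

section path
variable {w w' : ℝ → Eu d} {t T : ℝ} {x : Eu d}

@[simp] theorem path_self : path t x w t = x := by simp [path]

theorem L2loc.continuous_path (hw : L2loc w) (t : ℝ) (x : Eu d) : Continuous (path t x w) :=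
  continuous_const.add (intervalIntegral.continuous_primitive hw.intervalIntegrable t)

theorem L2loc.path_sub (hw : L2loc w) (t : ℝ) (x : Eu d) (a b : ℝ) :
    path t x w b - path t x w a = ∫ r in a..b, w r := by
  simp only [path]
  rw [add_sub_add_left_eq_sub, intervalIntegral.integral_interval_sub_left
    (hw.intervalIntegrable _ _) (hw.intervalIntegrable _ _)]

theorem L2loc.norm_path_sub_le (hw : L2loc w) (t : ℝ) (x : Eu d) {a b : ℝ} (hab : a ≤ b) :
    ‖path t x w b - path t x w a‖ ≤ ∫ r in a..b, ‖w r‖ := by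
  rw [hw.path_sub]
  exact intervalIntegral.norm_integral_le_integral_norm hab

theorem integral_norm_mono (hw : L2loc w) {a b a' b' : ℝ} (h1 : a' ≤ a) (h2 : a ≤ b)
    (h3 : b ≤ b') : ∫ r in a..b, ‖w r‖ ≤ ∫ r in a'..b', ‖w r‖ :=
  intervalIntegral.integral_mono_interval h1 h2 h3 (Eventually.of_forall fun _ => norm_nonneg _)
    (hw.intervalIntegrable_norm _ _)

theorem integral_norm_sq_mono (hw : L2loc w) {a b a' b' : ℝ} (h1 : a' ≤ a) (h2 : a ≤ b)
    (h3 : b ≤ b') : ∫ r in a..b, ‖w r‖ ^ 2 ≤ ∫ r in a'..b', ‖w r‖ ^ 2 :=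
  intervalIntegral.integral_mono_interval h1 h2 h3 (Eventually.of_forall fun _ => sq_nonneg _)
    (hw.intervalIntegrable_sq _ _)

theorem L2loc.norm_path_le (hw : L2loc w) (x : Eu d) {s : ℝ} (hs : s ∈ Icc t T) :
    ‖path t x w s‖ ≤ ‖x‖ + ∫ r in t..T, ‖w r‖ := by
  have h1 := hw.norm_path_sub_le t x hs.1
  have h2 := integral_norm_mono hw le_rfl hs.1 hs.2
  rw [path_self] at h1
  have h3 := norm_sub_norm_le (path t x w s) x
  linarith

end path

/-- The cost of a curve `γ` with velocity `w` on `[t,T]`. -/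
noncomputable def action {d : ℕ} (ℓ : ℝ → Eu d → Eu d → ℝ) (G : Eu d → ℝ) (t T : ℝ)
    (γ w : ℝ → Eu d) : ℝ :=
  (∫ s in t..T, ℓ s (γ s) (w s)) + G (γ T)

namespace IsLag
variable {w w' γ γ' : ℝ → Eu d} {t T : ℝ} {x : Eu d}

theorem locallyIntegrable (h : IsLag ℓ Lx Lv M C) (hγ : Continuous γ) (hw : L2loc w) :
    LocallyIntegrable (fun s => ℓ s (γ s) (w s)) volume := by
  have hM := h.M_pos
  refine LocallyIntegrable.mono (f := fun s => (C + M * ‖γ s‖ + M) + (2 * M) * ‖w s‖ ^ 2) ?_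
    (h.cont.comp_aestronglyMeasurable (continuous_id.aestronglyMeasurable.prodMk
      (hγ.aestronglyMeasurable.prodMk hw.1))) (Eventually.of_forall fun s => ?_)
  · exact ((continuous_const.add (continuous_const.mul hγ.norm)).add
      continuous_const).locallyIntegrable.add (hw.2.smul (2 * M))
  · rw [Real.norm_eq_abs]
    refine (h.abs_le s (γ s) (w s)).trans ((?_ : _ ≤ _).trans (le_abs_self _))
    nlinarith [mul_nonneg hM.le (sq_nonneg (‖w s‖ - 1))]

theorem intervalIntegrable (h : IsLag ℓ Lx Lv M C) (hγ : Continuous γ) (hw : L2loc w) (a b : ℝ) :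
    IntervalIntegrable (fun s => ℓ s (γ s) (w s)) volume a b :=
  ((h.locallyIntegrable hγ hw).integrableOn_isCompact isCompact_uIcc).intervalIntegrable

theorem locallyIntegrable_x (h : IsLag ℓ Lx Lv M C) (hγ : Continuous γ) (hw : L2loc w) :
    LocallyIntegrable (fun s => Lx s (γ s) (w s)) volume := by
  have hM := h.M_pos
  refine LocallyIntegrable.mono (f := fun s => M * (1 + ‖w s‖ ^ 2)) ?_
    (h.cont_x.comp_aestronglyMeasurable (continuous_id.aestronglyMeasurable.prodMk
      (hγ.aestronglyMeasurable.prodMk hw.1))) (Eventually.of_forall fun s => ?_)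
  · exact ((locallyIntegrable_const (1 : ℝ)).add hw.2).smul M
  · exact (h.bound_x s (γ s) (w s)).trans (le_abs_self _)

theorem l2loc_v (h : IsLag ℓ Lx Lv M C) (hγ : Continuous γ) (hw : L2loc w) :
    L2loc (fun s => Lv s (γ s) (w s)) := by
  have hM := h.M_pos
  refine L2loc.of_norm_sq_le
    (f := fun s => (2 * M ^ 2) * (1 + ‖w s‖ ^ 2))
    (h.cont_v.comp_aestronglyMeasurable (continuous_id.aestronglyMeasurable.prodMk
      (hγ.aestronglyMeasurable.prodMk hw.1)))
    (((locallyIntegrable_const (1 : ℝ)).add hw.2).smul (2 * M ^ 2)) fun s => ?_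
  calc ‖Lv s (γ s) (w s)‖ ^ 2 ≤ (M * (1 + ‖w s‖)) ^ 2 := by
        have := h.bound_v s (γ s) (w s)
        gcongr
    _ ≤ _ := by nlinarith [mul_nonneg (sq_nonneg M) (sq_nonneg (‖w s‖ - 1))]

/-- Stability of the action under a perturbation of the curve and its velocity. -/
theorem abs_action_sub_le (h : IsLag ℓ Lx Lv M C) (hG : IsTerm G Gx M C) (htT : t ≤ T)
    (hγ : Continuous γ) (hγ' : Continuous γ') (hw : L2loc w) (hw' : L2loc w') {e : ℝ}
    (he : ∀ s ∈ Icc t T, ‖γ' s - γ s‖ ≤ e) {f : ℝ → ℝ} (hf : IntervalIntegrable f volume t T)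
    (hfw : ∀ s ∈ Icc t T, (1 + ‖w s‖ + ‖w' s‖) * ‖w' s - w s‖ ≤ f s) :
    |action ℓ G t T γ' w' - action ℓ G t T γ w| ≤
      M * (T - t + 2 + ∫ s in t..T, ‖w s‖ ^ 2) * e + M * ∫ s in t..T, f s := by
  have hM := h.M_pos
  have h1 : |∫ s in t..T, (ℓ s (γ' s) (w' s) - ℓ s (γ s) (w s))| ≤
      ∫ s in t..T, (M * e * (1 + ‖w s‖ ^ 2) + M * f s) := by
    refine (intervalIntegral.abs_integral_le_integral_abs htT).trans ?_
    refine intervalIntegral.integral_mono_on htT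
      ((h.intervalIntegrable hγ' hw' t T).sub (h.intervalIntegrable hγ hw t T)).norm
      (((intervalIntegrable_const.add (hw.intervalIntegrable_sq t T)).const_mul _).add
        (hf.const_mul M)) fun s hs => ?_
    have a1 := h.abs_sub_le s (γ s) (w s) (γ' s) (w' s)
    have a2 := mul_le_mul_of_nonneg_left (he s hs) (by positivity : 0 ≤ M * (1 + ‖w s‖ ^ 2))
    have a3 := mul_le_mul_of_nonneg_left (hfw s hs) hM.le
    linarith
  rw [intervalIntegral.integral_sub (h.intervalIntegrable hγ' hw' t T)
    (h.intervalIntegrable hγ hw t T), intervalIntegral.integral_add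
    ((intervalIntegrable_const.add (hw.intervalIntegrable_sq t T)).const_mul _) (hf.const_mul M),
    intervalIntegral.integral_const_mul, intervalIntegral.integral_const_mul,
    intervalIntegral.integral_add intervalIntegrable_const (hw.intervalIntegrable_sq t T),
    intervalIntegral.integral_const] at h1
  have h2 := hG.lipschitz (γ T) (γ' T)
  have h3 := he T ⟨htT, le_rfl⟩
  simp only [action]
  have h4 := abs_add_le ((∫ s in t..T, ℓ s (γ' s) (w' s)) - ∫ s in t..T, ℓ s (γ s) (w s))
    (G (γ' T) - G (γ T))
  have h5 : 2 * M * ‖γ' T - γ T‖ ≤ 2 * M * e := by gcongr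
  rw [add_sub_add_comm]
  simp only [smul_eq_mul] at h1
  nlinarith

theorem abs_action_shift_le (h : IsLag ℓ Lx Lv M C) (hG : IsTerm G Gx M C) (htT : t ≤ T)
    (hγ : Continuous γ) (hγ' : Continuous γ') (hw : L2loc w) {e : ℝ}
    (he : ∀ s ∈ Icc t T, ‖γ' s - γ s‖ ≤ e) :
    |action ℓ G t T γ' w - action ℓ G t T γ w| ≤
      M * (T - t + 2 + ∫ s in t..T, ‖w s‖ ^ 2) * e := by
  have := h.abs_action_sub_le hG htT hγ hγ' hw hw he
    (f := fun _ => 0) intervalIntegrable_const (fun s _ => by simp)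
  simpa using this

/-- The parameter `β` separates the bound into terms of order `β` and terms carrying the squared
`L²` distance of the velocities. Continuity of the action follows by fixing `β` small and then
letting the distance tend to zero. -/
theorem abs_action_path_sub_le (h : IsLag ℓ Lx Lv M C) (hG : IsTerm G Gx M C) (hT : 0 ≤ T)
    (hw : L2loc w) (hw' : L2loc w') (x : Eu d) {β : ℝ} (hβ : 0 < β) :
    |action ℓ G 0 T (path 0 x w') w' - action ℓ G 0 T (path 0 x w) w| ≤
      M * (T + 2 + ∫ s in (0 : ℝ)..T, ‖w s‖ ^ 2) *
        (β * T + (∫ s in (0 : ℝ)..T, ‖w' s - w s‖ ^ 2) / (4 * β)) +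
      M * (β * (2 * T + 8 * ∫ s in (0 : ℝ)..T, ‖w s‖ ^ 2) +
        (∫ s in (0 : ℝ)..T, ‖w' s - w s‖ ^ 2) * (1 / (4 * β) + 1)) := by
  have hu := hw'.sub hw
  have he : ∀ s ∈ Icc 0 T, ‖path 0 x w' s - path 0 x w s‖ ≤
      β * T + (∫ s in (0 : ℝ)..T, ‖w' s - w s‖ ^ 2) / (4 * β) := by
    intro s hs
    have e1 : path 0 x w' s - path 0 x w s = ∫ r in (0 : ℝ)..s, (w' r - w r) := by
      rw [intervalIntegral.integral_sub (hw'.intervalIntegrable _ _) (hw.intervalIntegrable _ _)]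
      simp [path]
    rw [e1]
    refine (intervalIntegral.norm_integral_le_integral_norm hs.1).trans
      ((integral_norm_mono hu le_rfl hs.1 hs.2).trans ?_)
    have := hu.integral_norm_le hT (β := 1 / (4 * β)) (by positivity)
    refine this.trans_eq ?_
    field_simp
    ring
  have hi1 : IntervalIntegrable (fun s => β * (2 + 8 * ‖w s‖ ^ 2)) volume 0 T :=
    (intervalIntegrable_const.add ((hw.intervalIntegrable_sq 0 T).const_mul 8)).const_mul β
  have hi2 : IntervalIntegrable (fun s => ‖w' s - w s‖ ^ 2 * (1 / (4 * β) + 1)) volume 0 T :=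
    (hu.intervalIntegrable_sq 0 T).mul_const _
  have := h.abs_action_sub_le hG hT (hw.continuous_path 0 x) (hw'.continuous_path 0 x) hw hw' he
    (f := fun s => β * (2 + 8 * ‖w s‖ ^ 2) + ‖w' s - w s‖ ^ 2 * (1 / (4 * β) + 1))
    (hi1.add hi2) fun s _ => by
      have a1 : ‖w' s‖ ≤ ‖w s‖ + ‖w' s - w s‖ := by
        have := norm_add_le (w s) (w' s - w s)
        rwa [add_sub_cancel] at this
      set u := ‖w' s - w s‖
      have hu0 : 0 ≤ u := norm_nonneg _
      have a2 : (1 + 2 * ‖w s‖) * u ≤ β * (1 + 2 * ‖w s‖) ^ 2 + u ^ 2 * (1 / (4 * β)) := by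
        have : β * (1 + 2 * ‖w s‖) ^ 2 + u ^ 2 * (1 / (4 * β)) - (1 + 2 * ‖w s‖) * u =
            β * ((1 + 2 * ‖w s‖) - u / (2 * β)) ^ 2 := by field_simp; ring
        nlinarith [mul_nonneg hβ.le (sq_nonneg ((1 + 2 * ‖w s‖) - u / (2 * β)))]
      nlinarith [mul_nonneg hβ.le (sq_nonneg (1 - 2 * ‖w s‖)), norm_nonneg (w s)]
  refine this.trans_eq ?_
  rw [intervalIntegral.integral_add hi1 hi2, intervalIntegral.integral_mul_const,
    intervalIntegral.integral_const_mul, intervalIntegral.integral_add intervalIntegrable_const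
    ((hw.intervalIntegrable_sq 0 T).const_mul 8), intervalIntegral.integral_const_mul,
    intervalIntegral.integral_const]
  simp only [smul_eq_mul, sub_zero]
  ring

/-- The action is continuous for the `L²` convergence of velocities. -/
theorem tendsto_action (h : IsLag ℓ Lx Lv M C) (hG : IsTerm G Gx M C) (hT : 0 ≤ T)
    (hw : L2loc w) {ι : Type*} {l : Filter ι} {v : ι → ℝ → Eu d} (hv : ∀ i, L2loc (v i))
    (hlim : Tendsto (fun i => ∫ s in (0 : ℝ)..T, ‖v i s - w s‖ ^ 2) l (𝓝 0)) (x : Eu d) :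
    Tendsto (fun i => action ℓ G 0 T (path 0 x (v i)) (v i)) l
      (𝓝 (action ℓ G 0 T (path 0 x w) w)) := by
  have hM := h.M_pos
  set Q := ∫ s in (0 : ℝ)..T, ‖w s‖ ^ 2
  have hQ : 0 ≤ Q := intervalIntegral.integral_nonneg hT fun _ _ => sq_nonneg _
  rw [Metric.tendsto_nhds]
  intro η hη
  obtain ⟨β, hβ, hβη⟩ : ∃ β > 0, M * (T + 2 + Q) * (β * T) + M * (β * (2 * T + 8 * Q)) < η := by
    refine ⟨η / (2 * (M * (T + 2 + Q) * T + M * (2 * T + 8 * Q) + 1)), by positivity, ?_⟩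
    set A := M * (T + 2 + Q) * T + M * (2 * T + 8 * Q) with hA
    have hA0 : 0 ≤ A := by positivity
    have : M * (T + 2 + Q) * (η / (2 * (A + 1)) * T) + M * (η / (2 * (A + 1)) * (2 * T + 8 * Q))
        = A / (A + 1) * (η / 2) := by
      rw [hA]; field_simp
    rw [this]
    have : A / (A + 1) ≤ 1 := by rw [div_le_one (by positivity)]; linarith
    nlinarith
  have hc : Continuous fun D : ℝ => M * (T + 2 + Q) * (β * T + D / (4 * β)) +
      M * (β * (2 * T + 8 * Q) + D * (1 / (4 * β) + 1)) := by fun_prop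
  have hc0 := (hc.tendsto 0).comp hlim
  filter_upwards [hc0.eventually (gt_mem_nhds (by simpa using hβη))] with i hi
  rw [Real.dist_eq]
  exact (h.abs_action_path_sub_le hG hT hw (hv i) x hβ).trans_lt hi

end IsLag

/-- Coercivity of the action, uniformly over Lagrangians with the same constants. -/
theorem exists_coercive {T : ℝ} (hM : 0 < M) (hC : 0 ≤ C) (hT : 0 ≤ T) (d : ℕ) :
    ∃ K, 0 ≤ K ∧ ∀ {ℓ : ℝ → Eu d → Eu d → ℝ} {Lx Lv : ℝ → Eu d → Eu d → Eu d}
      {G : Eu d → ℝ} {Gx : Eu d → Eu d}, IsLag ℓ Lx Lv M C → IsTerm G Gx M C →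
      ∀ t ∈ Icc 0 T, ∀ (x : Eu d) (w : ℝ → Eu d), L2loc w →
        1 / (8 * M) * (∫ s in t..T, ‖w s‖ ^ 2) ≤
          action ℓ G t T (path t x w) w + K * (1 + ‖x‖) := by
  -- This choice gives `M * (T + 2) * β = 1 / (8 * M)`. Half of the coercive term `1 / (4 * M) * Q`
  -- then pays for the displacement of the curve, which enters with factor `M * T` through the
  -- running cost and `2 * M` through the terminal cost.
  set β := 1 / (8 * M * (M * (T + 2))) with hβ
  have hβ0 : 0 < β := by positivity
  refine ⟨M * (T + 2) * (1 + T / (4 * β)) + T * (C + M ^ 3) + C, by positivity, ?_⟩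
  intro ℓ Lx Lv G Gx h hG t ht x w hw
  set Q := ∫ s in t..T, ‖w s‖ ^ 2
  set N := ∫ s in t..T, ‖w s‖
  have hN0 : 0 ≤ N := intervalIntegral.integral_nonneg ht.2 fun _ _ => norm_nonneg _
  have hN : N ≤ β * Q + T / (4 * β) := by
    refine (hw.integral_norm_le ht.2 hβ0).trans ?_
    have := ht.1
    gcongr
    linarith
  have h1 : ∫ s in t..T, (1 / (4 * M) * ‖w s‖ ^ 2 - (M * (‖x‖ + N) + (C + M ^ 3))) ≤
      ∫ s in t..T, ℓ s (path t x w s) (w s) := by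
    refine intervalIntegral.integral_mono_on ht.2
      (((hw.intervalIntegrable_sq t T).const_mul _).sub intervalIntegrable_const)
      (h.intervalIntegrable (hw.continuous_path t x) hw t T) fun s hs => ?_
    have a1 := h.le_apply s (path t x w s) (w s)
    have a2 := mul_le_mul_of_nonneg_left (hw.norm_path_le x hs) hM.le
    linarith
  rw [intervalIntegral.integral_sub ((hw.intervalIntegrable_sq t T).const_mul _)
    intervalIntegrable_const, intervalIntegral.integral_const_mul,
    intervalIntegral.integral_const, smul_eq_mul] at h1
  have h2 := (abs_le.1 (hG.abs_le (path t x w T))).1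
  have h3 := mul_le_mul_of_nonneg_left (hw.norm_path_le x (right_mem_Icc.2 ht.2))
    (by positivity : 0 ≤ 2 * M)
  have h4 : (T - t) * (M * (‖x‖ + N) + (C + M ^ 3)) ≤ T * (M * (‖x‖ + N) + (C + M ^ 3)) := by
    have := ht.1
    gcongr
    linarith
  have h5 : M * (T + 2) * N ≤ 1 / (8 * M) * Q + M * (T + 2) * (T / (4 * β)) := by
    have := mul_le_mul_of_nonneg_left hN (by positivity : 0 ≤ M * (T + 2))
    have e : M * (T + 2) * (β * Q) = 1 / (8 * M) * Q := by rw [hβ]; field_simp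
    linarith
  have h6 : 1 / (4 * M) * Q = 1 / (8 * M) * Q + 1 / (8 * M) * Q := by field_simp; ring
  have h7 : 0 ≤ (M * (T + 2) * (T / (4 * β)) + T * (C + M ^ 3) + C) * ‖x‖ := by positivity
  have h8 : 0 ≤ M * (T + 2) := by positivity
  simp only [action]
  change 1 / (8 * M) * Q ≤ _
  nlinarith

section Curves
variable {T t : ℝ} {x : Eu d} {γ w : ℝ → Eu d}

theorem vel_eq_of_hasDerivAt (hT : 0 < T) {s : ℝ} {v : Eu d} (hs : s ∈ Icc 0 T)
    (h : HasDerivWithinAt γ v (Icc 0 T) s) : vel T γ s = v :=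
  h.derivWithin (uniqueDiffOn_Icc hT s hs)

theorem hasDerivAt_path (hw : Continuous w) (t : ℝ) (x : Eu d) (s : ℝ) :
    HasDerivAt (path t x w) (w s) s :=
  (intervalIntegral.integral_hasDerivAt_right (hw.intervalIntegrable _ _)
    (hw.stronglyMeasurableAtFilter _ _) hw.continuousAt).const_add x

theorem vel_path (hT : 0 < T) (hw : Continuous w) {s : ℝ} (hs : s ∈ Icc 0 T) :
    vel T (path t x w) s = w s :=
  vel_eq_of_hasDerivAt hT hs (hasDerivAt_path hw t x s).hasDerivWithinAt

theorem path_mem_Curves (hw : Continuous w) : path t x w ∈ Curves T t x := by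
  refine ⟨ContDiff.contDiffOn (contDiff_one_iff_deriv.2
    ⟨fun s => (hasDerivAt_path hw t x s).differentiableAt, ?_⟩), path_self⟩
  have : deriv (path t x w) = w := funext fun s => (hasDerivAt_path hw t x s).deriv
  rwa [this]

/-- Extending the velocity beyond `[0,T]` by its endpoint values reduces `C¹` curves on `[0,T]` to
continuous velocities on the whole line. -/
theorem exists_velocity (hT : 0 < T) (ht : t ∈ Icc 0 T) (hγ : γ ∈ Curves T t x) :
    ∃ w, Continuous w ∧ (∀ s ∈ Icc 0 T, vel T γ s = w s) ∧
      ∀ s ∈ Icc 0 T, γ s = path t x w s := by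
  have hc : ContinuousOn (vel T γ) (Icc 0 T) :=
    hγ.1.continuousOn_derivWithin (uniqueDiffOn_Icc hT) le_rfl
  have hcr := continuousOn_iff_continuous_domRestrict.1 hc
  set w : ℝ → Eu d := IccExtend hT.le ((Icc 0 T).domRestrict (vel T γ)) with hw
  have hwc : Continuous w := hcr.Icc_extend'
  have hwv : ∀ s ∈ Icc 0 T, vel T γ s = w s := fun s hs => by
    rw [hw, IccExtend_of_mem _ _ hs]; rfl
  have hd : ∀ s ∈ Icc 0 T, HasDerivWithinAt γ (w s) (Icc 0 T) s := fun s hs => by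
    rw [← hwv s hs]
    exact ((hγ.1.differentiableOn one_ne_zero) s hs).hasDerivWithinAt
  refine ⟨w, hwc, hwv, fun s hs => ?_⟩
  have hz : ∀ r ∈ Icc 0 T, HasDerivWithinAt (fun r => γ r - path t x w r) 0 (Icc 0 T) r := by
    intro r hr
    have := (hd r hr).sub (hasDerivAt_path hwc t x r).hasDerivWithinAt
    rwa [sub_self] at this
  have h0 := (convex_Icc (0 : ℝ) T).norm_image_sub_le_of_norm_hasDerivWithin_le (C := 0) hz
    (fun r _ => by simp) ht hs
  rw [zero_mul, hγ.2, path_self, sub_self, sub_zero] at h0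
  exact sub_eq_zero.1 (norm_le_zero_iff.1 h0)

end Curves

end MFG

/-! ### The value function and compactness of minimizing sequences. -/

namespace MFG
variable {d : ℕ} {ℓ : ℝ → Eu d → Eu d → ℝ} {Lx Lv : ℝ → Eu d → Eu d → Eu d} {M C : ℝ}
  {G : Eu d → ℝ} {Gx : Eu d → Eu d} {T t : ℝ} {x : Eu d} {w w' : ℝ → Eu d}

/-- The value function: the infimum of the action over the curves with continuous velocity. -/
noncomputable def value {d : ℕ} (ℓ : ℝ → Eu d → Eu d → ℝ) (G : Eu d → ℝ) (t T : ℝ) (x : Eu d) :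
    ℝ :=
  sInf {r | ∃ w, Continuous w ∧ r = action ℓ G t T (path t x w) w}

theorem action_ge (h : IsLag ℓ Lx Lv M C) (hG : IsTerm G Gx M C) (ht : t ∈ Icc 0 T) (x : Eu d) :
    ∃ c, ∀ w, L2loc w → c ≤ action ℓ G t T (path t x w) w := by
  obtain ⟨K, _, hK⟩ := exists_coercive h.M_pos h.C_nonneg (ht.1.trans ht.2) d
  refine ⟨-(K * (1 + ‖x‖)), fun w hw => ?_⟩
  have h1 := hK h hG t ht x w hw
  have h2 : 0 ≤ 1 / (8 * M) * ∫ s in t..T, ‖w s‖ ^ 2 :=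
    mul_nonneg (by have := h.M_pos; positivity)
      (intervalIntegral.integral_nonneg ht.2 fun _ _ => sq_nonneg _)
  linarith

theorem bddBelow_action (h : IsLag ℓ Lx Lv M C) (hG : IsTerm G Gx M C) (ht : t ∈ Icc 0 T)
    (x : Eu d) : BddBelow {r | ∃ w, Continuous w ∧ r = action ℓ G t T (path t x w) w} := by
  obtain ⟨c, hc⟩ := action_ge h hG ht x
  exact ⟨c, by rintro r ⟨w, hw, rfl⟩; exact hc w (.of_continuous hw)⟩

theorem value_le_of_continuous (h : IsLag ℓ Lx Lv M C) (hG : IsTerm G Gx M C)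
    (ht : t ∈ Icc 0 T) (x : Eu d) (hw : Continuous w) :
    value ℓ G t T x ≤ action ℓ G t T (path t x w) w :=
  csInf_le (bddBelow_action h hG ht x) ⟨w, hw, rfl⟩

theorem nonempty_actions (ℓ : ℝ → Eu d → Eu d → ℝ) (G : Eu d → ℝ) (t T : ℝ) (x : Eu d) :
    {r | ∃ w, Continuous w ∧ r = action ℓ G t T (path t x w) w}.Nonempty :=
  ⟨_, fun _ => 0, continuous_const, rfl⟩

theorem exists_action_lt (ℓ : ℝ → Eu d → Eu d → ℝ) (G : Eu d → ℝ) (t T : ℝ) (x : Eu d)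
    {η : ℝ} (hη : 0 < η) :
    ∃ w, Continuous w ∧ action ℓ G t T (path t x w) w < value ℓ G t T x + η := by
  obtain ⟨r, ⟨w, hw, rfl⟩, hr⟩ := exists_lt_of_csInf_lt (nonempty_actions ℓ G t T x)
    (lt_add_of_pos_right (sInf _) hη)
  exact ⟨w, hw, hr⟩

theorem L2loc.memLp (hw : L2loc w) (a b : ℝ) : MemLp w 2 (volume.restrict (Ioc a b)) := by
  rw [memLp_two_iff_integrable_sq_norm hw.1.restrict]
  exact (hw.2.integrableOn_isCompact (isCompact_Icc (a := a) (b := b))).mono_set Ioc_subset_Icc_self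

theorem L2loc.exists_continuous_approx (hw : L2loc w) (hT : 0 ≤ T) {η : ℝ} (hη : 0 < η) :
    ∃ v, Continuous v ∧ ∫ s in (0 : ℝ)..T, ‖v s - w s‖ ^ 2 ≤ η := by
  have hm : MemLp w (ENNReal.ofReal 2) (volume.restrict (Ioc 0 T)) := by
    simpa using hw.memLp 0 T
  obtain ⟨g, hg, -⟩ := hm.exists_boundedContinuous_integral_rpow_sub_le two_pos hη
  refine ⟨g, g.continuous, ?_⟩
  rw [intervalIntegral.integral_of_le hT]
  simpa [norm_sub_rev] using hg

/-- Velocities which are only square integrable do not lower the infimum. -/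
theorem value_le (h : IsLag ℓ Lx Lv M C) (hG : IsTerm G Gx M C) (hT : 0 ≤ T) (x : Eu d)
    (hw : L2loc w) : value ℓ G 0 T x ≤ action ℓ G 0 T (path 0 x w) w := by
  choose v hvc hv using fun n : ℕ => hw.exists_continuous_approx hT
    (Nat.one_div_pos_of_nat (α := ℝ) (n := n))
  have hlim : Tendsto (fun n => ∫ s in (0 : ℝ)..T, ‖v n s - w s‖ ^ 2) atTop (𝓝 0) :=
    squeeze_zero (fun _ => intervalIntegral.integral_nonneg hT fun _ _ => sq_nonneg _) hv
      tendsto_one_div_add_atTop_nhds_zero_nat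
  exact ge_of_tendsto' (h.tendsto_action hG hT hw (fun n => .of_continuous (hvc n)) hlim x)
    fun n => value_le_of_continuous h hG ⟨le_rfl, hT⟩ x (hvc n)

theorem norm_toLp_sq {μ : Measure ℝ} {f : ℝ → Eu d} (hf : MemLp f 2 μ) :
    ‖hf.toLp f‖ ^ 2 = ∫ s, ‖f s‖ ^ 2 ∂μ := by
  rw [← real_inner_self_eq_norm_sq, L2.inner_def]
  refine integral_congr_ae ?_
  filter_upwards [hf.coeFn_toLp] with s hs
  rw [hs, real_inner_self_eq_norm_sq]

/-- Completeness of `L²(0,T)`. -/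
theorem exists_l2_limit (hT : 0 ≤ T) {v : ℕ → ℝ → Eu d} (hv : ∀ n, L2loc (v n))
    (hc : ∀ η > 0, ∃ N, ∀ i ≥ N, ∀ j ≥ N, ∫ s in (0 : ℝ)..T, ‖v i s - v j s‖ ^ 2 ≤ η) :
    ∃ w, L2loc w ∧ Tendsto (fun n => ∫ s in (0 : ℝ)..T, ‖v n s - w s‖ ^ 2) atTop (𝓝 0) := by
  set μ : Measure ℝ := volume.restrict (Ioc 0 T)
  have hm : ∀ n, MemLp (v n) 2 μ := fun n => (hv n).memLp 0 T
  have hcauchy : CauchySeq fun n => (hm n).toLp (v n) := by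
    refine Metric.cauchySeq_iff.2 fun η hη => ?_
    obtain ⟨N, hN⟩ := hc (η ^ 2 / 2) (by positivity)
    refine ⟨N, fun i hi j hj => ?_⟩
    rw [dist_eq_norm, ← MemLp.toLp_sub]
    refine lt_of_pow_lt_pow_left₀ 2 hη.le ?_
    rw [norm_toLp_sq, ← intervalIntegral.integral_of_le hT]
    have := hN i hi j hj
    simp only [Pi.sub_apply]
    have : 0 < η ^ 2 := by positivity
    linarith
  obtain ⟨F, hF⟩ := cauchySeq_tendsto_of_complete hcauchy
  -- The limit in `L²(0,T)` is cut off outside the interval so that it is locally square integrable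
  -- on the whole line.
  refine ⟨(Ioc 0 T).indicator F, ⟨((Lp.stronglyMeasurable F).indicator
    measurableSet_Ioc).aestronglyMeasurable, ?_⟩, ?_⟩
  · have h1 : Integrable (fun s => ‖F s‖ ^ 2) μ :=
      (memLp_two_iff_integrable_sq_norm (Lp.memLp F).1).1 (Lp.memLp F)
    have h2 : Integrable ((Ioc 0 T).indicator fun s => ‖F s‖ ^ 2) volume :=
      (integrable_indicator_iff measurableSet_Ioc).2 h1
    refine Integrable.locallyIntegrable (h2.congr (Eventually.of_forall fun s => ?_))
    by_cases hs : s ∈ Ioc 0 T <;> simp [hs]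
  · rw [tendsto_iff_norm_sub_tendsto_zero] at hF
    have h0 := hF.pow 2
    rw [zero_pow two_ne_zero] at h0
    refine h0.congr fun n => ?_
    have : ∀ K : Lp (Eu d) 2 μ, ‖K‖ ^ 2 = ∫ s, ‖K s‖ ^ 2 ∂μ := fun K => by
      have := norm_toLp_sq (Lp.memLp K)
      rwa [Lp.toLp_coeFn] at this
    rw [this, intervalIntegral.integral_of_le hT]
    refine integral_congr_ae ?_
    filter_upwards [Lp.coeFn_sub ((hm n).toLp (v n)) F, (hm n).coeFn_toLp,
      ae_restrict_mem measurableSet_Ioc] with s h1 h2 h3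
    rw [h1, Pi.sub_apply, h2, indicator_of_mem h3]

/-- Take `β = √|a - b|` in `L2loc.integral_norm_le`. This is the common modulus of continuity needed
for the Arzelà-Ascoli theorem. -/
theorem L2loc.norm_path_sub_le_sqrt (hw : L2loc w) (x : Eu d) {A : ℝ}
    (hA : ∫ r in (0 : ℝ)..T, ‖w r‖ ^ 2 ≤ A) {a b : ℝ} (ha : a ∈ Icc 0 T) (hb : b ∈ Icc 0 T) :
    ‖path 0 x w a - path 0 x w b‖ ≤ √|a - b| * (A + 1 / 4) := by
  wlog hab : b ≤ a generalizing a b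
  · rw [norm_sub_rev, abs_sub_comm]
    exact this hb ha (not_le.1 hab).le
  rcases hab.eq_or_lt with rfl | hlt
  · simp
  rw [abs_of_pos (sub_pos.2 hlt)]
  have hs : 0 < √(a - b) := Real.sqrt_pos.2 (sub_pos.2 hlt)
  refine (hw.norm_path_sub_le 0 x hab).trans ((hw.integral_norm_le hab hs).trans ?_)
  have h1 := (integral_norm_sq_mono hw hb.1 hab ha.2).trans hA
  have h2 : (a - b) / (4 * √(a - b)) = √(a - b) * (1 / 4) := by
    have := Real.mul_self_sqrt (sub_pos.2 hlt).le
    field_simp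
    nlinarith
  rw [h2, mul_add]
  gcongr

/-- Curves with bounded energy: a subsequence is uniformly Cauchy. -/
theorem exists_subseq_path (hT : 0 ≤ T) (x : Eu d) {v : ℕ → ℝ → Eu d} (hv : ∀ n, L2loc (v n))
    {A : ℝ} (hA : ∀ n, ∫ r in (0 : ℝ)..T, ‖v n r‖ ^ 2 ≤ A) :
    ∃ φ : ℕ → ℕ, StrictMono φ ∧ ∀ η > 0, ∃ N, ∀ i ≥ N, ∀ j ≥ N, ∀ s ∈ Icc 0 T,
      ‖path 0 x (v (φ i)) s - path 0 x (v (φ j)) s‖ ≤ η := by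
  set u : ℕ → BoundedContinuousFunction (Icc 0 T) (Eu d) := fun n =>
    BoundedContinuousFunction.mkOfCompact
      ⟨fun s => path 0 x (v n) s, ((hv n).continuous_path 0 x).comp continuous_subtype_val⟩ with hu
  have hcomp : IsCompact (closure (range u)) := by
    refine BoundedContinuousFunction.arzela_ascoli
      (Metric.closedBall 0 (‖x‖ + (1 * A + (T - 0) / (4 * 1)))) (isCompact_closedBall _ _) _ ?_ ?_
    · rintro _ s ⟨n, rfl⟩
      rw [mem_closedBall_zero_iff]
      refine ((hv n).norm_path_le x s.2).trans ?_
      have := (hv n).integral_norm_le hT one_pos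
      have := hA n
      linarith
    · refine (Metric.uniformEquicontinuous_of_continuity_modulus
        (fun r => √|r| * (A + 1 / 4)) ?_ _ ?_).equicontinuous
      · have : Continuous fun r : ℝ => √|r| * (A + 1 / 4) := by fun_prop
        simpa using this.tendsto 0
      · rintro s r ⟨_, n, rfl⟩
        have := (hv n).norm_path_sub_le_sqrt x (hA n) s.2 r.2
        simpa [hu, dist_eq_norm, Subtype.dist_eq] using this
  obtain ⟨f, -, φ, hφ, hlim⟩ := hcomp.tendsto_subseq fun n => subset_closure (mem_range_self n)
  refine ⟨φ, hφ, fun η hη => ?_⟩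
  obtain ⟨N, hN⟩ := Metric.cauchySeq_iff.1 hlim.cauchySeq η hη
  refine ⟨N, fun i hi j hj s hs => ?_⟩
  have := (BoundedContinuousFunction.dist_coe_le_dist (f := u (φ i)) (g := u (φ j))
    ⟨s, hs⟩).trans (hN i hi j hj).le
  rwa [dist_eq_norm] at this

/-- Strong convexity: the `L²` distance of two velocities is controlled by the excess of the
actions and the uniform distance of the curves. -/
theorem integral_norm_sub_sq_le (h : IsLag ℓ Lx Lv M C) (hG : IsTerm G Gx M C) (hT : 0 ≤ T)
    (x : Eu d) (hw : L2loc w) (hw' : L2loc w') {e : ℝ}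
    (he : ∀ s ∈ Icc 0 T, ‖path 0 x w s - path 0 x w' s‖ ≤ e) :
    1 / (8 * M) * (∫ s in (0 : ℝ)..T, ‖w s - w' s‖ ^ 2) ≤
      1 / 2 * action ℓ G 0 T (path 0 x w) w + 1 / 2 * action ℓ G 0 T (path 0 x w') w' -
        value ℓ G 0 T x +
      M * (T + (∫ s in (0 : ℝ)..T, ‖w s‖ ^ 2) + (∫ s in (0 : ℝ)..T, ‖w' s‖ ^ 2) + 1) * e := by
  have hM := h.M_pos
  -- The averaged velocity generates the averaged curve, which is a competitor for the value. The
  -- term gained in `midpoint_le` then controls the distance of the two velocities.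
  set m : ℝ → Eu d := fun s => (1 / 2 : ℝ) • (w s + w' s)
  have hm : L2loc m := (hw.add hw').smul (1 / 2)
  have hp : ∀ s, path 0 x m s = (1 / 2 : ℝ) • (path 0 x w s + path 0 x w' s) := fun s => by
    simp only [path, m]
    rw [intervalIntegral.integral_smul, intervalIntegral.integral_add (hw.intervalIntegrable _ _)
      (hw'.intervalIntegrable _ _)]
    module
  have hv := value_le h hG hT x hm
  have hi1 := h.intervalIntegrable (hw.continuous_path 0 x) hw 0 T
  have hi2 := h.intervalIntegrable (hw'.continuous_path 0 x) hw' 0 T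
  have hi3 := h.intervalIntegrable (hm.continuous_path 0 x) hm 0 T
  have hs1 := hw.intervalIntegrable_sq 0 T
  have hs2 := hw'.intervalIntegrable_sq 0 T
  have hs3 := (hw.sub hw').intervalIntegrable_sq 0 T
  have h1 : ∫ s in (0 : ℝ)..T, (ℓ s (path 0 x m s) (m s) + 1 / (8 * M) * ‖w s - w' s‖ ^ 2) ≤
      ∫ s in (0 : ℝ)..T, ((1 / 2 * ℓ s (path 0 x w s) (w s) + 1 / 2 * ℓ s (path 0 x w' s) (w' s))
        + (M * e) * ((1 + ‖w s‖ ^ 2) + ‖w' s‖ ^ 2)) := by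
    refine intervalIntegral.integral_mono_on hT (hi3.add (hs3.const_mul _))
      (((hi1.const_mul _).add (hi2.const_mul _)).add
        (((intervalIntegrable_const.add hs1).add hs2).const_mul _)) fun s hs => ?_
    have a1 := h.midpoint_le s (path 0 x w s) (path 0 x w' s) (w s) (w' s)
    rw [← hp] at a1
    have a2 := mul_le_mul_of_nonneg_left (he s hs)
      (by positivity : 0 ≤ M * (1 + ‖w s‖ ^ 2 + ‖w' s‖ ^ 2))
    change _ + _ ≤ _ at a1
    linarith
  rw [intervalIntegral.integral_add hi3 (hs3.const_mul _),
    intervalIntegral.integral_add ((hi1.const_mul _).add (hi2.const_mul _))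
        (((intervalIntegrable_const.add hs1).add hs2).const_mul _),
    intervalIntegral.integral_add (hi1.const_mul _) (hi2.const_mul _)] at h1
  simp only [intervalIntegral.integral_const_mul] at h1
  rw [intervalIntegral.integral_add (intervalIntegrable_const.add hs1) hs2,
    intervalIntegral.integral_add intervalIntegrable_const hs1,
    intervalIntegral.integral_const, smul_eq_mul, mul_one, sub_zero] at h1
  have h2 : G (path 0 x m T) ≤ 1 / 2 * G (path 0 x w T) + 1 / 2 * G (path 0 x w' T) + M * e := by
    have b1 := (abs_le.1 (hG.lipschitz (path 0 x w T) (path 0 x m T))).2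
    have b2 := (abs_le.1 (hG.lipschitz (path 0 x w' T) (path 0 x m T))).2
    have e1 : path 0 x m T - path 0 x w T = -((1 / 2 : ℝ) • (path 0 x w T - path 0 x w' T)) := by
      rw [hp]; module
    have e2 : path 0 x m T - path 0 x w' T = (1 / 2 : ℝ) • (path 0 x w T - path 0 x w' T) := by
      rw [hp]; module
    have n : ‖(1 / 2 : ℝ)‖ = 1 / 2 := by norm_num
    rw [e1, norm_neg, norm_smul, n] at b1
    rw [e2, norm_smul, n] at b2
    have := mul_le_mul_of_nonneg_left (he T ⟨hT, le_rfl⟩) hM.le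
    linarith
  simp only [action] at hv ⊢
  linarith

theorem exists_energy_bound (h : IsLag ℓ Lx Lv M C) (hG : IsTerm G Gx M C) (hT : 0 ≤ T)
    (a R : ℝ) : ∃ A, 0 ≤ A ∧ ∀ x w, ‖x‖ ≤ R → L2loc w → action ℓ G 0 T (path 0 x w) w ≤ a →
      ∫ s in (0 : ℝ)..T, ‖w s‖ ^ 2 ≤ A := by
  have hM := h.M_pos
  obtain ⟨K, hK0, hK⟩ := exists_coercive h.M_pos h.C_nonneg hT d
  refine ⟨max 0 (8 * M * (a + K * (1 + R))), le_max_left _ _, fun x w hx hw ha => ?_⟩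
  have h1 := hK h hG 0 ⟨le_rfl, hT⟩ x w hw
  have h2 : K * (1 + ‖x‖) ≤ K * (1 + R) := by gcongr
  have h3 : 1 / (8 * M) * (∫ s in (0 : ℝ)..T, ‖w s‖ ^ 2) ≤ a + K * (1 + R) := by linarith
  refine le_trans ?_ (le_max_right _ _)
  calc ∫ s in (0 : ℝ)..T, ‖w s‖ ^ 2
      = 8 * M * (1 / (8 * M) * (∫ s in (0 : ℝ)..T, ‖w s‖ ^ 2)) := by field_simp
    _ ≤ _ := by gcongr

/-- Minimizing sequences are precompact. -/
theorem exists_l2_minimizer (h : IsLag ℓ Lx Lv M C) (hG : IsTerm G Gx M C) (hT : 0 ≤ T) (x : Eu d)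
    {v : ℕ → ℝ → Eu d} (hv : ∀ n, L2loc (v n))
    (hlim : Tendsto (fun n => action ℓ G 0 T (path 0 x (v n)) (v n)) atTop
      (𝓝 (value ℓ G 0 T x))) :
    ∃ φ : ℕ → ℕ, StrictMono φ ∧ ∃ w, L2loc w ∧
      action ℓ G 0 T (path 0 x w) w = value ℓ G 0 T x ∧
      ∀ s ∈ Icc 0 T, Tendsto (fun n => path 0 x (v (φ n)) s) atTop (𝓝 (path 0 x w s)) := by
  have hM := h.M_pos
  obtain ⟨a, ha⟩ := hlim.bddAbove_range
  obtain ⟨A, hA0, hA⟩ := exists_energy_bound h hG hT a ‖x‖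
  have hAn : ∀ n, ∫ r in (0 : ℝ)..T, ‖v n r‖ ^ 2 ≤ A := fun n =>
    hA x (v n) le_rfl (hv n) (ha (mem_range_self n))
  obtain ⟨φ, hφ, hcau⟩ := exists_subseq_path hT x hv hAn
  have hlimφ := hlim.comp hφ.tendsto_atTop
  -- Uniform closeness of the curves and smallness of the excess of the actions make the velocities
  -- Cauchy in `L²` by strong convexity. Strong convergence replaces any lower semicontinuity
  -- argument. Below, one `η'` is allotted to the excess and one to the distance of the curves.
  obtain ⟨w, hw, hwlim⟩ := exists_l2_limit hT (fun n => hv (φ n)) fun η hη => by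
    set η' := 1 / (8 * M) * η / 2
    have hη' : 0 < η' := by positivity
    obtain ⟨N1, hN1⟩ := hcau (η' / (M * (T + A + A + 1))) (by positivity)
    obtain ⟨N2, hN2⟩ := eventually_atTop.1
      (hlimφ.eventually (gt_mem_nhds (lt_add_of_pos_right _ hη')))
    refine ⟨max N1 N2, fun i hi j hj => ?_⟩
    have h1 := integral_norm_sub_sq_le h hG hT x (hv (φ i)) (hv (φ j))
      (hN1 i (le_of_max_le_left hi) j (le_of_max_le_left hj))
    have h2 := hN2 i (le_of_max_le_right hi)
    have h3 := hN2 j (le_of_max_le_right hj)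
    simp only [Function.comp_apply] at h2 h3
    have h4 : M * (T + (∫ s in (0 : ℝ)..T, ‖v (φ i) s‖ ^ 2) +
        (∫ s in (0 : ℝ)..T, ‖v (φ j) s‖ ^ 2) + 1) * (η' / (M * (T + A + A + 1))) ≤ η' := by
      have := hAn (φ i)
      have := hAn (φ j)
      calc _ ≤ M * (T + A + A + 1) * (η' / (M * (T + A + A + 1))) := by gcongr
        _ = η' := by field_simp
    have h5 : 1 / (8 * M) * (∫ s in (0 : ℝ)..T, ‖v (φ i) s - v (φ j) s‖ ^ 2) ≤
        1 / (8 * M) * η := by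
      have : 1 / (8 * M) * η = η' + η' := by simp only [η']; ring
      linarith
    exact le_of_mul_le_mul_left h5 (by positivity)
  refine ⟨φ, hφ, w, hw, ?_, fun s hs => ?_⟩
  · exact tendsto_nhds_unique (h.tendsto_action hG hT hw (fun n => hv (φ n)) hwlim x) hlimφ
  · rw [Metric.tendsto_nhds]
    intro η hη
    have hη2 : 0 < η / 2 := by positivity
    have hT1 : 0 < T + 1 := by linarith
    -- Large enough for `T / (4 * β) ≤ η / 2`; the summand `1` keeps `β` positive when `T = 0`.
    set β := T / (2 * η) + 1 with hβ
    have hβ0 : 0 < β := by positivity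
    filter_upwards [hwlim.eventually (gt_mem_nhds (by positivity : 0 < η / 2 / β))] with n hn
    have hu := (hv (φ n)).sub hw
    have e1 : path 0 x (v (φ n)) s - path 0 x w s = ∫ r in (0 : ℝ)..s, (v (φ n) r - w r) := by
      rw [intervalIntegral.integral_sub ((hv (φ n)).intervalIntegrable _ _)
        (hw.intervalIntegrable _ _)]
      simp [path]
    rw [dist_eq_norm, e1]
    refine (intervalIntegral.norm_integral_le_integral_norm hs.1).trans_lt
      ((integral_norm_mono hu le_rfl hs.1 hs.2).trans_lt
        ((hu.integral_norm_le hT hβ0).trans_lt ?_))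
    have a1 : β * (∫ s in (0 : ℝ)..T, ‖v (φ n) s - w s‖ ^ 2) < η / 2 := by
      calc _ < β * (η / 2 / β) := by gcongr
        _ = η / 2 := by field_simp
    have a2 : (T - 0) / (4 * β) ≤ η / 2 := by
      rw [div_le_iff₀ (by positivity), hβ]
      have : η / 2 * (4 * (T / (2 * η) + 1)) = T + 2 * η := by field_simp; ring
      linarith
    linarith

end MFG

/-! ### First variation, Euler-Lagrange equation and regularity of minimizers. -/

namespace MFG
variable {d : ℕ} {ℓ : ℝ → Eu d → Eu d → ℝ} {Lx Lv : ℝ → Eu d → Eu d → Eu d} {M C : ℝ}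
  {G : Eu d → ℝ} {Gx : Eu d → Eu d} {T t : ℝ} {x : Eu d} {w w' : ℝ → Eu d}

theorem locallyIntegrable_intervalIntegrable {F : Type*} [NormedAddCommGroup F] {f : ℝ → F}
    (hf : LocallyIntegrable f volume) (a b : ℝ) : IntervalIntegrable f volume a b :=
  (hf.integrableOn_isCompact isCompact_uIcc).intervalIntegrable

/-- Integration by parts for functions which are merely integrable: primitives are absolutely
continuous, and the product rule holds almost everywhere. It moves the position part of the first
variation onto the velocity perturbation. -/
theorem integral_mul_primitive {f η : ℝ → ℝ} (hf : LocallyIntegrable f volume)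
    (hη : LocallyIntegrable η volume) (T : ℝ) :
    ∫ s in (0 : ℝ)..T, f s * ∫ r in (0 : ℝ)..s, η r =
      ∫ s in (0 : ℝ)..T, (∫ r in s..T, f r) * η s := by
  have If := locallyIntegrable_intervalIntegrable hf
  have Iη := locallyIntegrable_intervalIntegrable hη
  have h1 := AbsolutelyContinuousOnInterval.integral_deriv_mul_eq_sub
    ((If 0 T).absolutelyContinuousOnInterval_intervalIntegral (c := 0) (by simp))
    ((Iη 0 T).absolutelyContinuousOnInterval_intervalIntegral (c := 0) (by simp))
  have cf : Continuous fun s => ∫ r in (0 : ℝ)..s, f r :=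
    intervalIntegral.continuous_primitive If 0
  have cη : Continuous fun s => ∫ r in (0 : ℝ)..s, η r :=
    intervalIntegral.continuous_primitive Iη 0
  have h2 : ∫ s in (0 : ℝ)..T, ((f s * ∫ r in (0 : ℝ)..s, η r) + (∫ r in (0 : ℝ)..s, f r) * η s) =
      (∫ r in (0 : ℝ)..T, f r) * ∫ r in (0 : ℝ)..T, η r := by
    rw [intervalIntegral.integral_same, zero_mul, sub_zero] at h1
    rw [← h1]
    refine intervalIntegral.integral_congr_ae ?_
    filter_upwards [LocallyIntegrable.ae_hasDerivAt_integral hf,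
      LocallyIntegrable.ae_hasDerivAt_integral hη] with s h1 h2 _
    rw [(h1 0).deriv, (h2 0).deriv]
  have i1 : IntervalIntegrable (fun s => f s * ∫ r in (0 : ℝ)..s, η r) volume 0 T :=
    (If 0 T).mul_continuousOn cη.continuousOn
  have i2 : IntervalIntegrable (fun s => (∫ r in (0 : ℝ)..s, f r) * η s) volume 0 T :=
    (Iη 0 T).continuousOn_mul cf.continuousOn
  rw [intervalIntegral.integral_add i1 i2] at h2
  have h3 : ∀ s, (∫ r in s..T, f r) * η s =
      (∫ r in (0 : ℝ)..T, f r) * η s - (∫ r in (0 : ℝ)..s, f r) * η s := fun s => by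
    rw [← intervalIntegral.integral_interval_sub_left (If 0 T) (If 0 s)]
    ring
  simp_rw [h3]
  rw [intervalIntegral.integral_sub ((Iη 0 T).const_mul _) i2,
    intervalIntegral.integral_const_mul]
  linarith

theorem integral_coord {f : ℝ → Eu d} (hf : LocallyIntegrable f volume) (a b : ℝ) (i : Fin d) :
    (∫ s in a..b, f s) i = ∫ s in a..b, f s i :=
  ((EuclideanSpace.proj i : Eu d →L[ℝ] ℝ).intervalIntegral_comp_comm
    (locallyIntegrable_intervalIntegrable hf a b)).symm

theorem integral_inner_primitive {f η : ℝ → Eu d} (hf : LocallyIntegrable f volume)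
    (hη : LocallyIntegrable η volume) (T : ℝ) :
    ∫ s in (0 : ℝ)..T, inner ℝ (f s) (∫ r in (0 : ℝ)..s, η r) =
      ∫ s in (0 : ℝ)..T, inner ℝ (∫ r in s..T, f r) (η s) := by
  have key : ∀ a b : Eu d, inner ℝ a b = ∑ i, a i * b i := fun a b => by
    rw [PiLp.inner_apply]
    simp [mul_comm]
  have hfi : ∀ i, LocallyIntegrable (fun s => f s i) volume := fun i s =>
    let ⟨u, hu, h⟩ := hf s
    ⟨u, hu, (EuclideanSpace.proj i : Eu d →L[ℝ] ℝ).integrable_comp h⟩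
  have hηi : ∀ i, LocallyIntegrable (fun s => η s i) volume := fun i s =>
    let ⟨u, hu, h⟩ := hη s
    ⟨u, hu, (EuclideanSpace.proj i : Eu d →L[ℝ] ℝ).integrable_comp h⟩
  simp_rw [key, integral_coord hf, integral_coord hη]
  rw [intervalIntegral.integral_finsetSum, intervalIntegral.integral_finsetSum]
  · exact Finset.sum_congr rfl fun i _ => integral_mul_primitive (hfi i) (hηi i) T
  · intro i _
    refine (locallyIntegrable_intervalIntegrable (hηi i) 0 T).continuousOn_mul ?_
    have : (fun s => ∫ r in s..T, f r i) = fun s => -∫ r in T..s, f r i :=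
      funext fun s => intervalIntegral.integral_symm _ _
    rw [this]
    exact (intervalIntegral.continuous_primitive
      (locallyIntegrable_intervalIntegrable (hfi i)) T).neg.continuousOn
  · intro i _
    exact (locallyIntegrable_intervalIntegrable (hfi i) 0 T).mul_continuousOn
      (intervalIntegral.continuous_primitive
        (locallyIntegrable_intervalIntegrable (hηi i)) 0).continuousOn

theorem IsLag.hasDerivAt_line (h : IsLag ℓ Lx Lv M C) (s : ℝ) (x y v η : Eu d) (r : ℝ) :
    HasDerivAt (fun r : ℝ => ℓ s (x + r • y) (v + r • η))
      (inner ℝ (Lx s (x + r • y) (v + r • η)) y + inner ℝ (Lv s (x + r • y) (v + r • η)) η) r := by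
  have h1 : HasDerivAt (fun r : ℝ => (x + r • y, v + r • η)) (y, η) r := by
    have a1 : HasDerivAt (fun r : ℝ => x + r • y) y r := by
      simpa using ((hasDerivAt_id r).smul_const y).const_add x
    have a2 : HasDerivAt (fun r : ℝ => v + r • η) η r := by
      simpa using ((hasDerivAt_id r).smul_const η).const_add v
    exact a1.prodMk a2
  have h2 := HasFDerivAt.comp_hasDerivAt (l := fun z : Eu d × Eu d => ℓ s z.1 z.2) r
    (h.hasFDerivAt s (x + r • y) (v + r • η)) h1
  simpa [Function.comp_def] using h2

/-- The first variation of the action. -/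
theorem IsLag.hasDerivAt_integral (h : IsLag ℓ Lx Lv M C) {γ Y η : ℝ → Eu d} (hγ : Continuous γ)
    (hw : L2loc w) (hY : Continuous Y) (hη : L2loc η) (a b : ℝ) :
    IntervalIntegrable (fun s => inner ℝ (Lx s (γ s) (w s)) (Y s) +
      inner ℝ (Lv s (γ s) (w s)) (η s)) volume a b ∧
    HasDerivAt (fun r : ℝ => ∫ s in a..b, ℓ s (γ s + r • Y s) (w s + r • η s))
      (∫ s in a..b, (inner ℝ (Lx s (γ s) (w s)) (Y s) + inner ℝ (Lv s (γ s) (w s)) (η s))) 0 := by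
  have hM := h.M_pos
  have hγY : ∀ r : ℝ, Continuous fun s => γ s + r • Y s := fun r => hγ.add (hY.const_smul r)
  have key := intervalIntegral.hasDerivAt_integral_of_dominated_loc_of_deriv_le
    (μ := volume) (a := a) (b := b) (s := Metric.ball (0 : ℝ) 1) (x₀ := (0 : ℝ))
    (F := fun r s => ℓ s (γ s + r • Y s) (w s + r • η s))
    (F' := fun r s => inner ℝ (Lx s (γ s + r • Y s) (w s + r • η s)) (Y s) +
      inner ℝ (Lv s (γ s + r • Y s) (w s + r • η s)) (η s))
    (bound := fun s => M * (1 + (2 * ‖w s‖ ^ 2 + 2 * ‖η s‖ ^ 2)) * ‖Y s‖ +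
      M * (1 + (‖w s‖ ^ 2 + 2 * ‖η s‖ ^ 2)))
    (Metric.ball_mem_nhds 0 one_pos) ?_ ?_ ?_ ?_ ?_ ?_
  · simpa using key
  · refine Eventually.of_forall fun r => ?_
    exact (h.locallyIntegrable (hγY r) (hw.add (hη.smul r))).aestronglyMeasurable.restrict
  · exact h.intervalIntegrable (hγY 0) (hw.add (hη.smul 0)) a b
  · simp only [zero_smul, add_zero]
    exact (((h.locallyIntegrable_x hγ hw).aestronglyMeasurable.inner
      hY.aestronglyMeasurable).add ((h.l2loc_v hγ hw).1.inner hη.1)).restrict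
  · refine Eventually.of_forall fun s _ r hr => ?_
    rw [mem_ball_zero_iff, Real.norm_eq_abs] at hr
    have n1 : ‖w s + r • η s‖ ≤ ‖w s‖ + ‖η s‖ := by
      refine (norm_add_le _ _).trans ?_
      rw [norm_smul, Real.norm_eq_abs]
      have := mul_le_mul_of_nonneg_right hr.le (norm_nonneg (η s))
      linarith
    have n2 : ‖w s + r • η s‖ ^ 2 ≤ 2 * ‖w s‖ ^ 2 + 2 * ‖η s‖ ^ 2 := by
      nlinarith [sq_nonneg (‖w s‖ - ‖η s‖), norm_nonneg (w s + r • η s)]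
    refine (norm_add_le _ _).trans (add_le_add ?_ ?_)
    · refine (norm_inner_le_norm _ _).trans ?_
      refine mul_le_mul_of_nonneg_right ((h.bound_x _ _ _).trans ?_) (norm_nonneg _)
      gcongr
    · refine (norm_inner_le_norm _ _).trans ?_
      calc _ ≤ (M * (1 + ‖w s + r • η s‖)) * ‖η s‖ := by
            gcongr
            exact h.bound_v _ _ _
        _ ≤ (M * (1 + (‖w s‖ + ‖η s‖))) * ‖η s‖ := by gcongr
        _ = M * ((1 + (‖w s‖ + ‖η s‖)) * ‖η s‖) := by ring
        _ ≤ _ := by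
            gcongr
            nlinarith [sq_nonneg (‖η s‖ - 1), sq_nonneg (‖w s‖ - ‖η s‖)]
  · have i1 := hw.intervalIntegrable_sq a b
    have i2 := hη.intervalIntegrable_sq a b
    have i3 : IntervalIntegrable (fun s => M * (1 + (2 * ‖w s‖ ^ 2 + 2 * ‖η s‖ ^ 2)))
        volume a b :=
      (intervalIntegrable_const.add ((i1.const_mul 2).add (i2.const_mul 2))).const_mul M
    have i4 : IntervalIntegrable (fun s => M * (1 + (‖w s‖ ^ 2 + 2 * ‖η s‖ ^ 2))) volume a b :=
      (intervalIntegrable_const.add (i1.add (i2.const_mul 2))).const_mul M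
    exact (i3.mul_continuousOn hY.norm.continuousOn).add i4
  · exact Eventually.of_forall fun s _ r _ => h.hasDerivAt_line s _ _ _ _ r

/-- The costate along a curve: minus the derivative of the cost under translations. -/
noncomputable def costate {d : ℕ} (Lx : ℝ → Eu d → Eu d → Eu d) (Gx : Eu d → Eu d) (T : ℝ)
    (γ w : ℝ → Eu d) (s : ℝ) : Eu d :=
  -((∫ r in s..T, Lx r (γ r) (w r)) + Gx (γ T))

theorem IsLag.continuous_costate (h : IsLag ℓ Lx Lv M C) {γ : ℝ → Eu d} (hγ : Continuous γ)
    (hw : L2loc w) (Gx : Eu d → Eu d) (T : ℝ) : Continuous (costate Lx Gx T γ w) := by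
  have : (fun s => ∫ r in s..T, Lx r (γ r) (w r)) = fun s => -∫ r in T..s, Lx r (γ r) (w r) :=
    funext fun s => intervalIntegral.integral_symm _ _
  refine Continuous.neg (Continuous.add ?_ continuous_const)
  rw [this]
  exact (intervalIntegral.continuous_primitive
    (locallyIntegrable_intervalIntegrable (h.locallyIntegrable_x hγ hw)) T).neg

theorem IsLag.hasDerivAt_costate (h : IsLag ℓ Lx Lv M C) {γ : ℝ → Eu d} (hγ : Continuous γ)
    (hw : Continuous w) (Gx : Eu d → Eu d) (T s : ℝ) :
    HasDerivAt (costate Lx Gx T γ w) (Lx s (γ s) (w s)) s := by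
  have hc : Continuous fun r => Lx r (γ r) (w r) := h.continuous_comp_x continuous_id hγ hw
  have := ((intervalIntegral.integral_hasDerivAt_left (hc.intervalIntegrable s T)
    (hc.stronglyMeasurableAtFilter _ _) hc.continuousAt).add_const (Gx (γ T))).neg
  rwa [neg_neg] at this

theorem path_add_smul {η : ℝ → Eu d} (hw : L2loc w) (hη : L2loc η) (t : ℝ) (x : Eu d) (r s : ℝ) :
    path t x (fun s => w s + r • η s) s = path t x w s + r • ∫ u in t..s, η u := by
  have := intervalIntegral.integral_add (hw.intervalIntegrable t s)
    ((hη.smul r).intervalIntegrable t s)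
  simp only [path]
  rw [this, intervalIntegral.integral_smul, add_assoc]

/-- The Euler-Lagrange equation in integrated form, with the transversality condition. -/
theorem ae_eq_costate (h : IsLag ℓ Lx Lv M C) (hG : IsTerm G Gx M C) (hT : 0 ≤ T)
    (hw : L2loc w) (hmin : action ℓ G 0 T (path 0 x w) w = value ℓ G 0 T x) :
    ∀ᵐ s ∂volume.restrict (Ioc 0 T),
      Lv s (path 0 x w s) (w s) = costate Lx Gx T (path 0 x w) w s := by
  set γ := path 0 x w with hγdef
  have hγ : Continuous γ := hw.continuous_path 0 x
  set P := costate Lx Gx T γ w with hP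
  have hPc : Continuous P := h.continuous_costate hγ hw Gx T
  -- The residual of the equation serves as its own test direction: after integration by parts the
  -- first variation in this direction is `∫ ‖η‖ ^ 2`, which must vanish. The direction is only
  -- square integrable, and it is admissible because of `value_le`.
  set η : ℝ → Eu d := fun s => Lv s (γ s) (w s) - P s with hηdef
  have hη : L2loc η := (h.l2loc_v hγ hw).sub (.of_continuous hPc)
  set Y : ℝ → Eu d := fun s => ∫ u in (0 : ℝ)..s, η u with hYdef
  have hY : Continuous Y := intervalIntegral.continuous_primitive hη.intervalIntegrable 0
  obtain ⟨hint, hder⟩ := h.hasDerivAt_integral hγ hw hY hη 0 T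
  have hderG : HasDerivAt (fun r : ℝ => G (γ T + r • Y T)) (inner ℝ (Gx (γ T)) (Y T)) 0 := by
    have a1 : HasDerivAt (fun r : ℝ => γ T + r • Y T) (Y T) 0 := by
      simpa using ((hasDerivAt_id (0 : ℝ)).smul_const (Y T)).const_add (γ T)
    have a2 : HasFDerivAt G (innerSL ℝ (Gx (γ T))) (γ T + (0 : ℝ) • Y T) := by
      simpa using hG.hasFDerivAt (γ T)
    simpa [Function.comp_def] using a2.comp_hasDerivAt (0 : ℝ) a1
  have hloc : IsLocalMin (fun r : ℝ => (∫ s in (0 : ℝ)..T, ℓ s (γ s + r • Y s) (w s + r • η s)) +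
      G (γ T + r • Y T)) 0 := by
    refine Eventually.of_forall fun r => ?_
    have h1 := value_le h hG hT x (hw.add (hη.smul r))
    rw [← hmin] at h1
    simp only [action, path_add_smul hw hη] at h1
    simpa using h1
  have h0 := hloc.hasDerivAt_eq_zero (hder.add hderG)
  have hLx := h.locallyIntegrable_x hγ hw
  have i1 : IntervalIntegrable (fun s => inner ℝ (Lx s (γ s) (w s)) (Y s)) volume 0 T := by
    rw [intervalIntegrable_iff]
    refine Integrable.mono' (g := fun s => ‖Lx s (γ s) (w s)‖ * ‖Y s‖) ?_
      (hLx.aestronglyMeasurable.inner hY.aestronglyMeasurable).restrict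
      (Eventually.of_forall fun s => norm_inner_le_norm _ _)
    rw [← IntegrableOn, ← intervalIntegrable_iff]
    exact (locallyIntegrable_intervalIntegrable hLx 0 T).norm.mul_continuousOn hY.norm.continuousOn
  have i2 : ∀ {p : ℝ → Eu d}, L2loc p → IntervalIntegrable (fun s => inner ℝ (p s) (η s))
      volume 0 T := by
    intro p hp
    rw [intervalIntegrable_iff]
    refine Integrable.mono' (g := fun s => ‖p s‖ ^ 2 + ‖η s‖ ^ 2) ?_ (hp.1.inner hη.1).restrict
      (Eventually.of_forall fun s => (norm_inner_le_norm _ _).trans ?_)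
    · rw [← IntegrableOn, ← intervalIntegrable_iff]
      exact (hp.intervalIntegrable_sq 0 T).add (hη.intervalIntegrable_sq 0 T)
    · nlinarith [sq_nonneg (‖p s‖ - ‖η s‖), sq_nonneg ‖p s‖, sq_nonneg ‖η s‖]
  rw [intervalIntegral.integral_add i1 (i2 (h.l2loc_v hγ hw)),
    integral_inner_primitive hLx hη.locallyIntegrable] at h0
  have hYT : inner ℝ (Gx (γ T)) (Y T) = ∫ s in (0 : ℝ)..T, inner ℝ (Gx (γ T)) (η s) :=
    ((innerSL ℝ (Gx (γ T))).intervalIntegral_comp_comm (hη.intervalIntegrable 0 T)).symm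
  have iG : IntervalIntegrable (fun s => inner ℝ (Gx (γ T)) (η s)) volume 0 T :=
    i2 (.of_continuous continuous_const)
  have i3 : IntervalIntegrable (fun s => inner ℝ (∫ r in s..T, Lx r (γ r) (w r)) (η s))
      volume 0 T := by
    have e : (fun s => inner ℝ (∫ r in s..T, Lx r (γ r) (w r)) (η s)) =
        fun s => -inner ℝ (P s) (η s) - inner ℝ (Gx (γ T)) (η s) := by
      funext s
      simp only [hP, costate, inner_neg_left, inner_add_left]
      ring
    rw [e]
    exact (i2 (.of_continuous hPc)).neg.sub iG
  rw [hYT, add_right_comm, ← intervalIntegral.integral_add i3 iG,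
    ← intervalIntegral.integral_add (i3.add iG) (i2 (h.l2loc_v hγ hw))] at h0
  have e2 : (fun s => inner ℝ (∫ r in s..T, Lx r (γ r) (w r)) (η s) + inner ℝ (Gx (γ T)) (η s) +
      inner ℝ (Lv s (γ s) (w s)) (η s)) = fun s => ‖η s‖ ^ 2 := by
    funext s
    rw [← real_inner_self_eq_norm_sq]
    rw [← inner_add_left, ← inner_add_left]
    congr 1
    simp only [hηdef, hP, costate]
    abel
  rw [e2, intervalIntegral.integral_of_le hT, integral_eq_zero_iff_of_nonneg
    (fun s => sq_nonneg _)] at h0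
  · filter_upwards [h0] with s hs
    simp only [Pi.zero_apply, ne_eq, OfNat.ofNat_ne_zero, not_false_eq_true, pow_eq_zero_iff,
      norm_eq_zero] at hs
    exact sub_eq_zero.1 hs
  · exact (intervalIntegrable_iff_integrableOn_Ioc_of_le hT).1 (hη.intervalIntegrable_sq 0 T)

/-- A minimizing velocity has a continuous version. -/
theorem exists_continuous_minimizer (h : IsLag ℓ Lx Lv M C) (hG : IsTerm G Gx M C) (hT : 0 ≤ T)
    (hw : L2loc w) (hmin : action ℓ G 0 T (path 0 x w) w = value ℓ G 0 T x) :
    ∃ v, Continuous v ∧ action ℓ G 0 T (path 0 x v) v = value ℓ G 0 T x ∧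
      ∀ s ∈ Icc 0 T, path 0 x v s = path 0 x w s := by
  have hγ := hw.continuous_path 0 x
  -- The costate is an integral and hence continuous, so inverting the Legendre transform along the
  -- curve yields a continuous representative of `w`.
  set v : ℝ → Eu d := fun s => legendreInv Lv s (path 0 x w s)
    (costate Lx Gx T (path 0 x w) w s) with hv
  have hvc : Continuous v := h.continuous_legendreInv.comp
    (continuous_id.prodMk (hγ.prodMk (h.continuous_costate hγ hw Gx T)))
  have hae : ∀ᵐ s ∂volume.restrict (Ioc 0 T), v s = w s := by
    filter_upwards [ae_eq_costate h hG hT hw hmin] with s hs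
    rw [hv]
    simp only
    rw [← hs, h.legendreInv_apply]
  have hp : ∀ s ∈ Icc 0 T, path 0 x v s = path 0 x w s := by
    intro s hs
    simp only [path]
    congr 1
    rw [intervalIntegral.integral_of_le hs.1, intervalIntegral.integral_of_le hs.1]
    exact integral_congr_ae (ae_restrict_of_ae_restrict_of_subset (Ioc_subset_Ioc_right hs.2) hae)
  refine ⟨v, hvc, ?_, hp⟩
  rw [← hmin]
  simp only [action]
  rw [hp T ⟨hT, le_rfl⟩, intervalIntegral.integral_of_le hT, intervalIntegral.integral_of_le hT]
  congr 1
  refine integral_congr_ae ?_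
  filter_upwards [hae, ae_restrict_mem measurableSet_Ioc] with s h1 h2
  rw [h1, hp s (Ioc_subset_Icc_self h2)]

/-- For a continuous velocity both sides of the almost everywhere identity are continuous, so it
extends to the endpoints. In particular it identifies the initial momentum. -/
theorem eq_costate (h : IsLag ℓ Lx Lv M C) (hG : IsTerm G Gx M C) (hT : 0 < T)
    (hw : Continuous w) (hmin : action ℓ G 0 T (path 0 x w) w = value ℓ G 0 T x) :
    ∀ s ∈ Icc 0 T, Lv s (path 0 x w s) (w s) = costate Lx Gx T (path 0 x w) w s := by
  have hwl : L2loc w := .of_continuous hw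
  have hγ := hwl.continuous_path 0 x
  refine Measure.eqOn_Icc_of_ae_eq volume hT.ne ?_
    (h.continuous_comp_v continuous_id hγ hw).continuousOn
    (h.continuous_costate hγ hwl Gx T).continuousOn
  rw [Measure.restrict_congr_set Ioc_ae_eq_Icc.symm]
  exact ae_eq_costate h hG hT.le hwl hmin

end MFG

/-! ### Uniqueness for Euler-Lagrange and differentiability of the value function. -/

namespace MFG
variable {d : ℕ} {ℓ : ℝ → Eu d → Eu d → ℝ} {Lx Lv : ℝ → Eu d → Eu d → Eu d} {M C : ℝ}
  {G : Eu d → ℝ} {Gx : Eu d → Eu d} {T t : ℝ} {x : Eu d} {w w' : ℝ → Eu d}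

/-- Solutions of the Euler-Lagrange equation are determined by their initial position and
velocity. -/
theorem IsLag.eqOn_of_euler_lagrange (h : IsLag ℓ Lx Lv M C) {γ₁ γ₂ w₁ w₂ P₁ P₂ : ℝ → Eu d}
    (hw₁ : Continuous w₁) (hw₂ : Continuous w₂)
    (hγ₁ : ∀ s, HasDerivAt γ₁ (w₁ s) s) (hγ₂ : ∀ s, HasDerivAt γ₂ (w₂ s) s)
    (hP₁ : ∀ s, HasDerivAt P₁ (Lx s (γ₁ s) (w₁ s)) s)
    (hP₂ : ∀ s, HasDerivAt P₂ (Lx s (γ₂ s) (w₂ s)) s)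
    (h₁ : ∀ s ∈ Icc 0 T, Lv s (γ₁ s) (w₁ s) = P₁ s)
    (h₂ : ∀ s ∈ Icc 0 T, Lv s (γ₂ s) (w₂ s) = P₂ s)
    (hγ0 : γ₁ 0 = γ₂ 0) (hP0 : P₁ 0 = P₂ 0) : EqOn γ₁ γ₂ (Icc 0 T) := by
  have hM := h.M_pos
  have cγ₁ : Continuous γ₁ := continuous_iff_continuousAt.2 fun s => (hγ₁ s).continuousAt
  have cγ₂ : Continuous γ₂ := continuous_iff_continuousAt.2 fun s => (hγ₂ s).continuousAt
  obtain ⟨R, hR⟩ : ∃ R, ∀ s ∈ Icc 0 T, ‖γ₁ s‖ ≤ R ∧ ‖γ₂ s‖ ≤ R ∧ ‖w₁ s‖ ≤ R ∧ ‖w₂ s‖ ≤ R := by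
    have hc : Continuous fun s => ‖γ₁ s‖ + ‖γ₂ s‖ + ‖w₁ s‖ + ‖w₂ s‖ := by fun_prop
    obtain ⟨R, hR⟩ := isCompact_Icc.bddAbove_image (hc.continuousOn (s := Icc 0 T))
    refine ⟨R, fun s hs => ?_⟩
    have := hR (mem_image_of_mem _ hs)
    have := norm_nonneg (γ₁ s)
    have := norm_nonneg (γ₂ s)
    have := norm_nonneg (w₁ s)
    have := norm_nonneg (w₂ s)
    refine ⟨?_, ?_, ?_, ?_⟩ <;> linarith
  obtain ⟨K, hK0, hK⟩ := h.lip R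
  set B := M * (1 + K) with hB
  have hB0 : 0 ≤ B := by positivity
  -- Grönwall's lemma is applied to position and momentum, because the velocity need not be
  -- differentiable in time. The difference of the velocities is recovered from `monotone_right`,
  -- which is the origin of `B = M * (1 + K)`.
  have key := eq_zero_of_abs_deriv_le_mul_abs_self_of_eq_zero_right
    (f := fun s => (γ₁ s - γ₂ s, P₁ s - P₂ s))
    (f' := fun s => (w₁ s - w₂ s, Lx s (γ₁ s) (w₁ s) - Lx s (γ₂ s) (w₂ s)))
    (K := B + K * (1 + B)) (a := 0) (b := T) ?_ ?_ ?_ ?_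
  · intro s hs
    have := congrArg Prod.fst (key s hs)
    exact sub_eq_zero.1 this
  · exact fun s _ => ((((hγ₁ s).sub (hγ₂ s)).prodMk ((hP₁ s).sub (hP₂ s))).continuousAt
      ).continuousWithinAt
  · exact fun s _ => (((hγ₁ s).sub (hγ₂ s)).prodMk ((hP₁ s).sub (hP₂ s))).hasDerivWithinAt
  · simp [hγ0, hP0]
  · intro s hs
    have hs' : s ∈ Icc 0 T := Ico_subset_Icc_self hs
    obtain ⟨r1, r2, r3, r4⟩ := hR s hs'
    set f := ‖(γ₁ s - γ₂ s, P₁ s - P₂ s)‖ with hf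
    have f1 : ‖γ₁ s - γ₂ s‖ ≤ f := norm_fst_le (γ₁ s - γ₂ s, P₁ s - P₂ s)
    have f2 : ‖P₁ s - P₂ s‖ ≤ f := norm_snd_le (γ₁ s - γ₂ s, P₁ s - P₂ s)
    have a1 : ‖w₁ s - w₂ s‖ ≤ B * f := by
      refine (h.monotone_right s (γ₁ s) (w₂ s) (w₁ s)).trans ?_
      have e : Lv s (γ₁ s) (w₁ s) - Lv s (γ₁ s) (w₂ s) =
          (P₁ s - P₂ s) + (Lv s (γ₂ s) (w₂ s) - Lv s (γ₁ s) (w₂ s)) := by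
        rw [h₁ s hs', h₂ s hs']; abel
      have b1 := (hK s (γ₂ s) (w₂ s) (γ₁ s) (w₂ s) r2 r4 r1 r4).2
      rw [sub_self, norm_zero, add_zero, norm_sub_rev (γ₂ s)] at b1
      rw [e, hB, mul_assoc]
      have := norm_add_le (P₁ s - P₂ s) (Lv s (γ₂ s) (w₂ s) - Lv s (γ₁ s) (w₂ s))
      gcongr
      nlinarith
    have a2 : ‖Lx s (γ₁ s) (w₁ s) - Lx s (γ₂ s) (w₂ s)‖ ≤ K * (1 + B) * f := by
      refine (hK s (γ₁ s) (w₁ s) (γ₂ s) (w₂ s) r1 r3 r2 r4).1.trans ?_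
      rw [mul_assoc]
      gcongr
      linarith
    have hf0 : 0 ≤ f := norm_nonneg _
    have c1 : 0 ≤ B * f := by positivity
    have c2 : 0 ≤ K * (1 + B) * f := by positivity
    rw [Prod.norm_def, add_mul]
    exact max_le (by linarith) (by linarith)

/-- Differentiability of the running cost under finite-dimensional perturbations of a curve. -/
theorem IsLag.hasFDerivAt_integral (h : IsLag ℓ Lx Lv M C) {γ : ℝ → Eu d} (hγ : Continuous γ)
    (hw : Continuous w) {α β : ℝ → ℝ} (hα : Continuous α) (hβ : Continuous β) (a b : ℝ) :
    HasFDerivAt (fun δ : Eu d => ∫ s in a..b, ℓ s (γ s + α s • δ) (w s + β s • δ))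
      (innerSL ℝ (∫ s in a..b, (α s • Lx s (γ s) (w s) + β s • Lv s (γ s) (w s)))) 0 := by
  have hM := h.M_pos
  set F' : Eu d → ℝ → Eu d := fun δ s => α s • Lx s (γ s + α s • δ) (w s + β s • δ) +
    β s • Lv s (γ s + α s • δ) (w s + β s • δ) with hF'
  have hγδ : ∀ δ : Eu d, Continuous fun s => γ s + α s • δ := fun δ =>
    hγ.add (hα.smul continuous_const)
  have hwδ : ∀ δ : Eu d, Continuous fun s => w s + β s • δ := fun δ =>
    hw.add (hβ.smul continuous_const)
  have hF'c : ∀ δ, Continuous (F' δ) := fun δ =>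
    (hα.smul (h.continuous_comp_x continuous_id (hγδ δ) (hwδ δ))).add
      (hβ.smul (h.continuous_comp_v continuous_id (hγδ δ) (hwδ δ)))
  have key := intervalIntegral.hasFDerivAt_integral_of_dominated_of_fderiv_le
    (μ := volume) (a := a) (b := b) (s := Metric.ball (0 : Eu d) 1) (x₀ := (0 : Eu d)) (𝕜 := ℝ)
    (F := fun δ s => ℓ s (γ s + α s • δ) (w s + β s • δ))
    (F' := fun δ s => innerSL ℝ (F' δ s))
    (bound := fun s => |α s| * (M * (1 + (‖w s‖ + |β s|) ^ 2)) +
      |β s| * (M * (1 + (‖w s‖ + |β s|))))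
    (Metric.ball_mem_nhds 0 one_pos) ?_ ?_ ?_ ?_ ?_ ?_
  · have e : ∫ s in a..b, innerSL ℝ (F' 0 s) = innerSL ℝ (∫ s in a..b, F' 0 s) :=
      (innerSL ℝ).intervalIntegral_comp_comm ((hF'c 0).intervalIntegrable a b)
    rw [e] at key
    simpa [hF'] using key
  · exact Eventually.of_forall fun δ => (h.continuous_comp continuous_id (hγδ δ)
      (hwδ δ)).aestronglyMeasurable.restrict
  · exact (h.continuous_comp continuous_id (hγδ 0) (hwδ 0)).intervalIntegrable a b
  · exact ((innerSL ℝ).continuous.comp (hF'c 0)).aestronglyMeasurable.restrict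
  · refine Eventually.of_forall fun s _ δ hδ => ?_
    rw [mem_ball_zero_iff] at hδ
    have n1 : ‖w s + β s • δ‖ ≤ ‖w s‖ + |β s| := by
      refine (norm_add_le _ _).trans ?_
      rw [norm_smul, Real.norm_eq_abs]
      have := mul_le_mul_of_nonneg_left hδ.le (abs_nonneg (β s))
      linarith
    rw [innerSL_apply_norm]
    refine (norm_add_le _ _).trans (add_le_add ?_ ?_)
    · rw [norm_smul, Real.norm_eq_abs]
      gcongr
      refine (h.bound_x _ _ _).trans ?_
      gcongr
    · rw [norm_smul, Real.norm_eq_abs]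
      gcongr
      refine (h.bound_v _ _ _).trans ?_
      gcongr
  · refine Continuous.intervalIntegrable ?_ a b
    fun_prop
  · refine Eventually.of_forall fun s _ δ _ => ?_
    have h1 : HasFDerivAt (fun δ : Eu d => (γ s + α s • δ, w s + β s • δ))
        ((α s • ContinuousLinearMap.id ℝ (Eu d)).prod (β s • ContinuousLinearMap.id ℝ (Eu d))) δ :=
      (((hasFDerivAt_id δ).const_smul (α s)).const_add (γ s)).prodMk
        (((hasFDerivAt_id δ).const_smul (β s)).const_add (w s))
    have h2 := HasFDerivAt.comp (g := fun z : Eu d × Eu d => ℓ s z.1 z.2) δ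
      (h.hasFDerivAt s (γ s + α s • δ) (w s + β s • δ)) h1
    refine h2.congr_fderiv ?_
    ext z
    simp [hF']

/-- The factor `(1 : ℝ)` produces the shape `γ s + α s • δ` of `IsLag.hasFDerivAt_integral` with `α
= 1`. -/
theorem path_translate (hw : L2loc w) (t : ℝ) (x y : Eu d) (s : ℝ) (t₀ : ℝ) :
    path t y w s = path t₀ x w s + (1 : ℝ) • (y - path t₀ x w t) := by
  have := hw.path_sub t₀ x t s
  simp only [path] at this ⊢
  rw [← this]
  module

/-- The upper test function for the value function obtained by translating a curve. -/
theorem hasFDerivAt_translate (h : IsLag ℓ Lx Lv M C) (hG : IsTerm G Gx M C) (hw : Continuous w)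
    (t t₀ : ℝ) (x : Eu d) :
    HasFDerivAt (fun y => action ℓ G t T (path t y w) w)
      (innerSL ℝ (-costate Lx Gx T (path t₀ x w) w t)) (path t₀ x w t) := by
  have hwl : L2loc w := .of_continuous hw
  set γ := path t₀ x w
  have hγ : Continuous γ := hwl.continuous_path t₀ x
  have h1 := h.hasFDerivAt_integral hγ hw (α := fun _ => 1) (β := fun _ => 0)
    continuous_const continuous_const t T
  have h2 : HasFDerivAt (fun δ : Eu d => G (γ T + δ)) (innerSL ℝ (Gx (γ T))) 0 := by
    have a : HasFDerivAt G (innerSL ℝ (Gx (γ T))) (γ T + 0) := by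
      simpa using hG.hasFDerivAt (γ T)
    have := a.comp (0 : Eu d) ((hasFDerivAt_id (0 : Eu d)).const_add (γ T))
    simpa [Function.comp_def] using this
  have h3 := (h1.add h2)
  have h4 : HasFDerivAt (fun y : Eu d => y - γ t) (ContinuousLinearMap.id ℝ (Eu d)) (γ t) :=
    (hasFDerivAt_id _).sub_const _
  rw [← sub_self (γ t)] at h3
  have h5 := HasFDerivAt.comp (f := fun y => y - γ t) (γ t) h3 h4
  rw [ContinuousLinearMap.comp_id, ← map_add] at h5
  have e : (fun y => action ℓ G t T (path t y w) w) =
      (fun δ : Eu d => (∫ s in t..T, ℓ s (γ s + (1 : ℝ) • δ) (w s + (0 : ℝ) • δ)) + G (γ T + δ)) ∘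
        fun y => y - γ t := by
    funext y
    simp only [action, Function.comp_apply, path_translate hwl t x y _ t₀, γ, zero_smul, add_zero,
      one_smul]
  rw [e]
  refine h5.congr_fderiv ?_
  congr 1
  simp [costate, γ]

/-- The difference `ψ - φ` is minimal at `x₀`, so both derivatives agree there. The remainder of `f`
then lies between two remainders of order `o(‖y - x₀‖)`. -/
theorem hasFDerivAt_of_squeeze {E : Type*} [NormedAddCommGroup E] [NormedSpace ℝ E]
    {f φ ψ : E → ℝ} {A B : E →L[ℝ] ℝ} {x₀ : E} (h1 : ∀ y, φ y ≤ f y) (h2 : ∀ y, f y ≤ ψ y)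
    (h3 : ψ x₀ ≤ φ x₀) (hψ : HasFDerivAt ψ A x₀) (hφ : HasFDerivAt φ B x₀) :
    HasFDerivAt f A x₀ := by
  have e1 : φ x₀ = f x₀ := le_antisymm (h1 x₀) ((h2 x₀).trans h3)
  have e2 : ψ x₀ = f x₀ := le_antisymm (h3.trans (h1 x₀)) (h2 x₀)
  have hmin : IsLocalMin (fun y => ψ y - φ y) x₀ := Eventually.of_forall fun y => by
    have := h1 y
    have := h2 y
    simp only
    linarith
  have hAB : A = B := sub_eq_zero.1 (hmin.hasFDerivAt_eq_zero (hψ.sub hφ))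
  subst hAB
  rw [hasFDerivAt_iff_isLittleO] at hψ hφ ⊢
  refine Asymptotics.IsBigO.trans_isLittleO (Asymptotics.IsBigO.of_bound 1
    (Eventually.of_forall fun y => ?_)) (hψ.norm_left.add hφ.norm_left)
  rw [one_mul, Real.norm_eq_abs, Real.norm_eq_abs, Real.norm_eq_abs, Real.norm_eq_abs, e1, e2]
  refine le_trans ?_ (le_abs_self _)
  have := h1 y
  have := h2 y
  rw [abs_le]
  constructor
  · have := neg_abs_le (φ y - f x₀ - A (y - x₀))
    have := abs_nonneg (ψ y - f x₀ - A (y - x₀))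
    linarith
  · have := le_abs_self (ψ y - f x₀ - A (y - x₀))
    have := abs_nonneg (φ y - f x₀ - A (y - x₀))
    linarith

/-- Dynamic programming: a curve from `x` to `y` on `[0,t]` followed by a curve from `y`. -/
theorem value_le_concat (h : IsLag ℓ Lx Lv M C) (hG : IsTerm G Gx M C) (ht : t ∈ Icc 0 T)
    (hw : Continuous w) (x : Eu d) :
    value ℓ G 0 T x - ∫ s in (0 : ℝ)..t, ℓ s (path 0 x w s) (w s) ≤
      value ℓ G t T (path 0 x w t) := by
  classical
  refine le_csInf (nonempty_actions ℓ G t T _) ?_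
  rintro r ⟨w', hw', rfl⟩
  set y := path 0 x w t
  have hwl : L2loc w := .of_continuous hw
  have hwl' : L2loc w' := .of_continuous hw'
  -- The concatenated velocity may jump at `t`, so the comparison with the value at time `0` has to
  -- go through `value_le` for square integrable velocities.
  set v := (Iic t).piecewise w w'
  have hv : L2loc v := hwl.piecewise hwl' measurableSet_Iic
  have v1 : ∀ s ∈ Ioc 0 t, v s = w s := fun s hs => Set.piecewise_eq_of_mem _ _ _ hs.2
  have v2 : ∀ s ∈ Ioc t T, v s = w' s := fun s hs =>
    Set.piecewise_eq_of_notMem _ _ _ (not_le.2 hs.1)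
  have p1 : ∀ s ∈ Icc 0 t, path 0 x v s = path 0 x w s := by
    intro s hs
    simp only [path]
    congr 1
    rw [intervalIntegral.integral_of_le hs.1, intervalIntegral.integral_of_le hs.1]
    exact setIntegral_congr_fun measurableSet_Ioc fun r hr => v1 r ⟨hr.1, hr.2.trans hs.2⟩
  have p2 : ∀ s ∈ Icc t T, path 0 x v s = path t y w' s := by
    intro s hs
    have e1 := hv.path_sub 0 x t s
    rw [p1 t ⟨ht.1, le_rfl⟩] at e1
    have e2 : ∫ r in t..s, v r = ∫ r in t..s, w' r := by
      rw [intervalIntegral.integral_of_le hs.1, intervalIntegral.integral_of_le hs.1]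
      exact setIntegral_congr_fun measurableSet_Ioc fun r hr => v2 r ⟨hr.1, hr.2.trans hs.2⟩
    rw [e2] at e1
    rw [sub_eq_iff_eq_add'.1 e1]
    rfl
  have h1 := value_le h hG (ht.1.trans ht.2) x hv
  have hi := h.intervalIntegrable (hv.continuous_path 0 x) hv
  rw [action, ← intervalIntegral.integral_add_adjacent_intervals (hi 0 t) (hi t T),
    p2 T ⟨ht.2, le_rfl⟩] at h1
  have i1 : ∫ s in (0 : ℝ)..t, ℓ s (path 0 x v s) (v s) =
      ∫ s in (0 : ℝ)..t, ℓ s (path 0 x w s) (w s) := by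
    rw [intervalIntegral.integral_of_le ht.1, intervalIntegral.integral_of_le ht.1]
    exact setIntegral_congr_fun measurableSet_Ioc fun r hr => by
      simp only [v1 r hr, p1 r (Ioc_subset_Icc_self hr)]
  have i2 : ∫ s in t..T, ℓ s (path 0 x v s) (v s) = ∫ s in t..T, ℓ s (path t y w' s) (w' s) := by
    rw [intervalIntegral.integral_of_le ht.2, intervalIntegral.integral_of_le ht.2]
    exact setIntegral_congr_fun measurableSet_Ioc fun r hr => by
      simp only [v2 r hr, p2 r (Ioc_subset_Icc_self hr)]
  rw [i1, i2] at h1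
  simp only [action]
  linarith

/-- The value function is differentiable at the interior points of minimizers. -/
theorem hasFDerivAt_value (h : IsLag ℓ Lx Lv M C) (hG : IsTerm G Gx M C) (ht : t ∈ Ioo 0 T)
    (hw : Continuous w) (hmin : action ℓ G 0 T (path 0 x w) w = value ℓ G 0 T x) :
    HasFDerivAt (value ℓ G t T) (innerSL ℝ (-Lv t (path 0 x w t) (w t))) (path 0 x w t) := by
  have hwl : L2loc w := .of_continuous hw
  have hT : 0 < T := ht.1.trans ht.2
  rw [eq_costate h hG hT hw hmin t ⟨ht.1.le, ht.2.le⟩]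
  set γ := path 0 x w
  have hγ : Continuous γ := hwl.continuous_path 0 x
  -- Upper test function: the remaining part of the minimizer, translated to start from `y`.
  have hψ := hasFDerivAt_translate (T := T) h hG hw t 0 x
  -- Lower test function: the part before `t` is tilted by `(s / t) • (y - γ t)`, so that it still
  -- starts from `x` but ends at `y`, and dynamic programming applies. This needs `0 < t`.
  have h1 := h.hasFDerivAt_integral hγ hw (α := fun s => s / t) (β := fun _ => 1 / t)
    (by fun_prop) continuous_const 0 t
  have h4 : HasFDerivAt (fun y : Eu d => y - γ t) (ContinuousLinearMap.id ℝ (Eu d)) (γ t) :=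
    (hasFDerivAt_id _).sub_const _
  rw [← sub_self (γ t)] at h1
  have hφ := (HasFDerivAt.comp (f := fun y => y - γ t) (γ t) h1 h4).const_sub (value ℓ G 0 T x)
  refine hasFDerivAt_of_squeeze (fun y => ?_) (fun y => ?_) ?_ hψ hφ
  · set v : ℝ → Eu d := fun s => w s + (1 / t) • (y - γ t)
    have hv : Continuous v := hw.add continuous_const
    have hp : ∀ s, path 0 x v s = γ s + (s / t) • (y - γ t) := fun s => by
      simp only [path, v, γ]
      rw [intervalIntegral.integral_add (hw.intervalIntegrable _ _) intervalIntegrable_const,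
        intervalIntegral.integral_const, smul_smul]
      module
    have hc := value_le_concat h hG ⟨ht.1.le, ht.2.le⟩ hv x
    rw [hp t, div_self ht.1.ne', one_smul, add_sub_cancel] at hc
    simp only [hp] at hc
    exact hc
  · exact value_le_of_continuous h hG ⟨ht.1.le, ht.2.le⟩ y hw
  · have hi := h.intervalIntegrable hγ hwl
    have e : ∀ s, path t (γ t) w s = γ s := fun s => by
      rw [path_translate hwl t x (γ t) s 0]; simp [γ]
    simp only [action, Function.comp_apply, sub_self, smul_zero, add_zero, e, ← hmin]
    rw [← intervalIntegral.integral_add_adjacent_intervals (hi 0 t) (hi t T)]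
    simp only [γ]
    linarith

/-- At time `0` there is no earlier piece of curve to tilt, so only the upper test function is at
hand and differentiability has to be assumed. A differentiable function touched from above has the
derivative of its test function; all minimizers from `x` therefore share their initial momentum. -/
theorem fderiv_value_zero (h : IsLag ℓ Lx Lv M C) (hG : IsTerm G Gx M C) (hT : 0 < T)
    (hw : Continuous w) (hmin : action ℓ G 0 T (path 0 x w) w = value ℓ G 0 T x)
    (hd : DifferentiableAt ℝ (value ℓ G 0 T) x) :
    fderiv ℝ (value ℓ G 0 T) x = innerSL ℝ (-costate Lx Gx T (path 0 x w) w 0) := by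
  have hψ := hasFDerivAt_translate (T := T) h hG hw 0 0 x
  rw [path_self] at hψ
  have hloc : IsLocalMin (fun y => action ℓ G 0 T (path 0 y w) w - value ℓ G 0 T y) x :=
    Eventually.of_forall fun y => by
      have := value_le_of_continuous h hG ⟨le_rfl, hT.le⟩ y hw
      simp only [hmin]
      linarith
  exact (sub_eq_zero.1 (hloc.hasFDerivAt_eq_zero (hψ.sub hd.hasFDerivAt))).symm

/-- At the points of differentiability of the value function the minimizer is unique. -/
theorem minimizer_unique (h : IsLag ℓ Lx Lv M C) (hG : IsTerm G Gx M C) (hT : 0 < T)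
    (hd : DifferentiableAt ℝ (value ℓ G 0 T) x) (hw : Continuous w) (hw' : Continuous w')
    (hmin : action ℓ G 0 T (path 0 x w) w = value ℓ G 0 T x)
    (hmin' : action ℓ G 0 T (path 0 x w') w' = value ℓ G 0 T x) :
    EqOn (path 0 x w) (path 0 x w') (Icc 0 T) := by
  have hγ := (L2loc.of_continuous hw).continuous_path 0 x
  have hγ' := (L2loc.of_continuous hw').continuous_path 0 x
  refine h.eqOn_of_euler_lagrange hw hw' (hasDerivAt_path hw 0 x) (hasDerivAt_path hw' 0 x)
    (h.hasDerivAt_costate hγ hw Gx T) (h.hasDerivAt_costate hγ' hw' Gx T)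
    (eq_costate h hG hT hw hmin) (eq_costate h hG hT hw' hmin') (by simp) ?_
  have h1 := (fderiv_value_zero h hG hT hw hmin hd).symm.trans
    (fderiv_value_zero h hG hT hw' hmin' hd)
  have h2 : ∀ a b : Eu d, innerSL ℝ a = innerSL ℝ b → a = b := fun a b hab =>
    ext_inner_right ℝ fun v => by
      rw [← innerSL_apply_apply ℝ, hab, innerSL_apply_apply]
  exact neg_injective (h2 _ _ h1)

theorem exists_value_bound (h : IsLag ℓ Lx Lv M C) (hG : IsTerm G Gx M C) (hT : 0 ≤ T) (R : ℝ) :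
    ∃ a, ∀ x, ‖x‖ ≤ R → value ℓ G 0 T x ≤ a := by
  have hM := h.M_pos
  refine ⟨T * (C + M * R) + (C + 2 * M * R), fun x hx => ?_⟩
  refine (value_le_of_continuous h hG ⟨le_rfl, hT⟩ x (w := fun _ => 0) continuous_const).trans ?_
  have e : ∀ s, path 0 x (fun _ => (0 : Eu d)) s = x := fun s => by simp [path]
  simp only [action, e]
  refine add_le_add ?_ ((le_abs_self _).trans ((hG.abs_le x).trans ?_))
  · have h1 := intervalIntegral.norm_integral_le_of_norm_le_const (a := 0) (b := T)
      (f := fun s => ℓ s x 0) (C := C + M * R) fun s _ => by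
        have := h.abs_le s x 0
        simp only [norm_zero, mul_zero, add_zero] at this
        rw [Real.norm_eq_abs]
        nlinarith
    rw [sub_zero, abs_of_nonneg hT] at h1
    have := le_abs_self (∫ s in (0 : ℝ)..T, ℓ s x 0)
    rw [Real.norm_eq_abs] at h1
    linarith
  · have : 2 * M * ‖x‖ ≤ 2 * M * R := by gcongr
    linarith

/-- A nearly optimal curve from `x`, translated to start from `y`, is a competitor there. Its energy
is bounded on balls by coercivity, so the translation changes the action by a bounded multiple of
`‖x - y‖`. -/
theorem exists_lipschitz_value (h : IsLag ℓ Lx Lv M C) (hG : IsTerm G Gx M C) (hT : 0 ≤ T)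
    (R : ℝ) : ∃ K, 0 ≤ K ∧ ∀ x y, ‖x‖ ≤ R → ‖y‖ ≤ R →
      |value ℓ G 0 T x - value ℓ G 0 T y| ≤ K * ‖x - y‖ := by
  have hM := h.M_pos
  obtain ⟨a, ha⟩ := exists_value_bound h hG hT R
  obtain ⟨A, hA0, hA⟩ := exists_energy_bound h hG hT (a + 1) R
  have key : ∀ x y, ‖x‖ ≤ R → ‖y‖ ≤ R →
      value ℓ G 0 T y ≤ value ℓ G 0 T x + M * (T + 2 + A) * ‖x - y‖ := by
    intro x y hx hy
    refine le_of_forall_pos_le_add fun η hη => ?_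
    obtain ⟨w, hw, hlt⟩ := exists_action_lt ℓ G 0 T x (lt_min hη one_pos)
    have hwl : L2loc w := .of_continuous hw
    have h1 := hA x w hx hwl (by
      have := ha x hx
      have := min_le_right η 1
      linarith)
    have h2 := h.abs_action_shift_le hG hT (hwl.continuous_path 0 x) (hwl.continuous_path 0 y) hwl
      (e := ‖x - y‖) fun s _ => by
        simp only [path, add_sub_add_right_eq_sub]
        rw [norm_sub_rev]
    have h3 := value_le_of_continuous h hG ⟨le_rfl, hT⟩ y hw
    have h4 := (abs_le.1 h2).2
    have h5 : M * (T - 0 + 2 + ∫ s in (0 : ℝ)..T, ‖w s‖ ^ 2) * ‖x - y‖ ≤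
        M * (T + 2 + A) * ‖x - y‖ := by
      gcongr
      linarith
    have := min_le_left η 1
    linarith
  refine ⟨M * (T + 2 + A), by positivity, fun x y hx hy => abs_le.2 ⟨?_, ?_⟩⟩
  · have := key x y hx hy
    linarith
  · have := key y x hy hx
    rw [norm_sub_rev] at this
    linarith

/-- Rademacher's theorem on each of the balls of integer radius. -/
theorem ae_differentiableAt_value (h : IsLag ℓ Lx Lv M C) (hG : IsTerm G Gx M C) (hT : 0 ≤ T) :
    ∀ᵐ x : Eu d, DifferentiableAt ℝ (value ℓ G 0 T) x := by
  have key : ∀ n : ℕ, ∀ᵐ x : Eu d, x ∈ Metric.ball (0 : Eu d) n →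
      DifferentiableAt ℝ (value ℓ G 0 T) x := by
    intro n
    obtain ⟨K, hK0, hK⟩ := exists_lipschitz_value h hG hT n
    have hlip : LipschitzOnWith ⟨K, hK0⟩ (value ℓ G 0 T) (Metric.ball (0 : Eu d) n) := by
      refine LipschitzOnWith.of_dist_le_mul fun x hx y hy => ?_
      rw [Real.dist_eq, dist_eq_norm]
      exact hK x y (mem_ball_zero_iff.1 hx).le (mem_ball_zero_iff.1 hy).le
    filter_upwards [hlip.ae_differentiableWithinAt_of_mem (μ := volume)] with x hx hxn
    exact (hx hxn).differentiableAt (Metric.isOpen_ball.mem_nhds hxn)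
  filter_upwards [ae_all_iff.2 key] with x hx
  obtain ⟨n, hn⟩ := exists_nat_gt ‖x‖
  exact hx n (mem_ball_zero_iff.2 hn)

/-- Coercivity bounds the energy. Since `Lx` grows quadratically in the velocity, the energy bounds
the costate uniformly in time, and `monotone_right` turns a momentum bound into a velocity bound. -/
theorem exists_velocity_bound (h : IsLag ℓ Lx Lv M C) (hG : IsTerm G Gx M C) (hT : 0 < T)
    (R : ℝ) : ∃ B, ∀ x w, ‖x‖ ≤ R → Continuous w →
      action ℓ G 0 T (path 0 x w) w = value ℓ G 0 T x → ∀ s ∈ Icc 0 T, ‖w s‖ ≤ B := by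
  have hM := h.M_pos
  obtain ⟨a, ha⟩ := exists_value_bound h hG hT.le R
  obtain ⟨A, hA0, hA⟩ := exists_energy_bound h hG hT.le a R
  refine ⟨M * (M * (T + A) + 2 * M + M), fun x w hx hw hmin s hs => ?_⟩
  have hwl : L2loc w := .of_continuous hw
  have h1 := hA x w hx hwl (hmin.trans_le (ha x hx))
  have h2 := h.monotone_right s (path 0 x w s) 0 (w s)
  rw [sub_zero] at h2
  refine h2.trans ?_
  gcongr
  refine (norm_sub_le _ _).trans (add_le_add ?_ ?_)
  · rw [eq_costate h hG hT hw hmin s hs, costate, norm_neg]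
    refine (norm_add_le _ _).trans (add_le_add ?_ (hG.bound _))
    have i1 : IntervalIntegrable (fun r => M * (1 + ‖w r‖ ^ 2)) volume s T :=
      (intervalIntegrable_const.add (hwl.intervalIntegrable_sq s T)).const_mul M
    refine (intervalIntegral.norm_integral_le_of_norm_le hs.2
      (Eventually.of_forall fun r _ => h.bound_x r _ _) i1).trans ?_
    rw [intervalIntegral.integral_const_mul, intervalIntegral.integral_add
      intervalIntegrable_const (hwl.intervalIntegrable_sq s T), intervalIntegral.integral_const]
    have := integral_norm_sq_mono hwl hs.1 hs.2 le_rfl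
    have := hs.1
    simp only [smul_eq_mul, mul_one]
    gcongr <;> linarith
  · simpa using h.bound_v s (path 0 x w s) 0

end MFG

/-! ### The problem with control of acceleration: bounds and perturbations. -/

namespace MFG
variable {d : ℕ} {ℓ : ℝ → Eu d → Eu d → ℝ} {Lx Lv : ℝ → Eu d → Eu d → Eu d} {M C : ℝ}
  {G : Eu d → ℝ} {Gx : Eu d → Eu d} {T t ε : ℝ} {x v : Eu d} {a a' : ℝ → Eu d}

/-- The cost with control of acceleration. -/
noncomputable def epsAction {d : ℕ} (ℓ : ℝ → Eu d → Eu d → ℝ) (G : Eu d → ℝ) (ε t T : ℝ)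
    (x v : Eu d) (a : ℝ → Eu d) : ℝ :=
  ε / 2 * (∫ s in t..T, ‖a s‖ ^ 2) + action ℓ G t T (path t x (path t v a)) (path t v a)

/-- The value function of the problem with control of acceleration. -/
noncomputable def epsValue {d : ℕ} (ℓ : ℝ → Eu d → Eu d → ℝ) (G : Eu d → ℝ) (ε t T : ℝ)
    (x v : Eu d) : ℝ :=
  sInf {r | ∃ a, L2loc a ∧ r = epsAction ℓ G ε t T x v a}

theorem L2loc.path_path (ha : L2loc a) (t : ℝ) (v : Eu d) : L2loc (path t v a) :=
  .of_continuous (ha.continuous_path t v)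

theorem action_le_epsAction (hε : 0 ≤ ε) (htT : t ≤ T) :
    action ℓ G t T (path t x (path t v a)) (path t v a) ≤ epsAction ℓ G ε t T x v a := by
  have : 0 ≤ ε / 2 * ∫ s in t..T, ‖a s‖ ^ 2 := mul_nonneg (by linarith)
    (intervalIntegral.integral_nonneg htT fun _ _ => sq_nonneg _)
  simp only [epsAction]
  linarith

theorem epsValue_le (h : IsLag ℓ Lx Lv M C) (hG : IsTerm G Gx M C) (hε : 0 ≤ ε)
    (ht : t ∈ Icc 0 T) (x v : Eu d) (ha : L2loc a) :
    epsValue ℓ G ε t T x v ≤ epsAction ℓ G ε t T x v a := by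
  obtain ⟨c, hc⟩ := action_ge h hG ht x
  refine csInf_le ⟨c, ?_⟩ ⟨a, ha, rfl⟩
  rintro r ⟨b, hb, rfl⟩
  exact (hc _ (hb.path_path t v)).trans (action_le_epsAction hε ht.2)

theorem l2loc_zero : L2loc (fun _ : ℝ => (0 : Eu d)) := .of_continuous continuous_const

theorem exists_epsAction_lt (ℓ : ℝ → Eu d → Eu d → ℝ) (G : Eu d → ℝ) (ε t T : ℝ) (x v : Eu d)
    {η : ℝ} (hη : 0 < η) :
    ∃ a, L2loc a ∧ epsAction ℓ G ε t T x v a < epsValue ℓ G ε t T x v + η := by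
  obtain ⟨r, ⟨a, ha, rfl⟩, hr⟩ := exists_lt_of_csInf_lt
    (⟨_, fun _ => 0, l2loc_zero, rfl⟩ :
      {r | ∃ a, L2loc a ∧ r = epsAction ℓ G ε t T x v a}.Nonempty)
    (lt_add_of_pos_right (sInf _) hη)
  exact ⟨a, ha, hr⟩

/-- Bounds for nearly optimal controls. -/
theorem exists_control_bound (h : IsLag ℓ Lx Lv M C) (hG : IsTerm G Gx M C) (hε : 0 < ε)
    (hT : 0 ≤ T) (R : ℝ) (hR : 0 ≤ R) :
    ∃ A B, 0 ≤ A ∧ 0 ≤ B ∧ ∀ t ∈ Icc 0 T, ∀ x v a, ‖x‖ ≤ R → ‖v‖ ≤ R → L2loc a →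
      epsAction ℓ G ε t T x v a ≤ epsValue ℓ G ε t T x v + 1 →
      (∫ s in t..T, ‖a s‖ ^ 2) ≤ A ∧ (∀ s ∈ Icc t T, ‖path t v a s‖ ≤ B) ∧
        ∀ s ∈ Icc t T, ‖path t x (path t v a) s‖ ≤ B := by
  have hM := h.M_pos
  have hC := h.C_nonneg
  obtain ⟨K, hK0, hK⟩ := exists_coercive h.M_pos h.C_nonneg hT d
  -- `D` bounds the cost of the zero control, under which the velocity stays constant and the
  -- position stays in the ball of radius `R + T * R`. Comparison with it and coercivity give the
  -- energy bound `A` of the control.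
  set D := T * (C + M * (R + T * R) + M * (1 + R) * R) + (C + 2 * M * (R + T * R)) with hD
  set A := 2 / ε * (D + 1 + K * (1 + R)) with hA
  have hA0 : 0 ≤ A := by positivity
  set B₁ := R + (A + T / 4) with hB₁
  have hB₁0 : 0 ≤ B₁ := by positivity
  refine ⟨A, B₁ + (R + T * B₁), hA0, by positivity, fun t ht x v a hx hv ha hle => ?_⟩
  have htT : T - t ≤ T := by have := ht.1; linarith
  have htT0 : 0 ≤ T - t := by have := ht.2; linarith
  have hval : epsValue ℓ G ε t T x v ≤ D := by
    refine (epsValue_le h hG hε.le ht x v l2loc_zero).trans ?_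
    have e : ∀ s, path t v (fun _ => (0 : Eu d)) s = v := fun s => by simp [path]
    have e2 : ∀ s ∈ Icc t T, ‖path t x (path t v fun _ => (0 : Eu d)) s‖ ≤ R + T * R := by
      intro s hs
      have e3 : path t x (path t v fun _ => (0 : Eu d)) s = x + (s - t) • v := by
        simp only [path, intervalIntegral.integral_zero, add_zero,
          intervalIntegral.integral_const]
      rw [e3]
      refine (norm_add_le _ _).trans (add_le_add hx ?_)
      rw [norm_smul, Real.norm_eq_abs, abs_of_nonneg (sub_nonneg.2 hs.1)]
      have := ht.1
      gcongr
      linarith [hs.2]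
    have h0 : ∫ s in t..T, ‖(0 : Eu d)‖ ^ 2 = 0 := by simp
    simp only [epsAction, action, e, h0, mul_zero, zero_add]
    refine add_le_add ?_ ((le_abs_self _).trans ((hG.abs_le _).trans ?_))
    · have h1 := intervalIntegral.norm_integral_le_of_norm_le_const (a := t) (b := T)
        (f := fun s => ℓ s (path t x (path t v fun _ => (0 : Eu d)) s) v)
        (C := C + M * (R + T * R) + M * (1 + R) * R) fun s hs => by
          rw [uIoc_of_le ht.2] at hs
          have := e2 s (Ioc_subset_Icc_self hs)
          rw [Real.norm_eq_abs]
          refine (h.abs_le s _ v).trans ?_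
          gcongr
      rw [abs_of_nonneg htT0, Real.norm_eq_abs] at h1
      refine (le_abs_self _).trans (h1.trans ?_)
      rw [mul_comm]
      gcongr
    · have := e2 T (right_mem_Icc.2 ht.2)
      gcongr
  have h1 := hK h hG t ht x (path t v a) (ha.path_path t v)
  have h2 : 0 ≤ 1 / (8 * M) * ∫ s in t..T, ‖path t v a s‖ ^ 2 :=
    mul_nonneg (by positivity) (intervalIntegral.integral_nonneg ht.2 fun _ _ => sq_nonneg _)
  have h3 : K * (1 + ‖x‖) ≤ K * (1 + R) := by gcongr
  have h4 : ε / 2 * (∫ s in t..T, ‖a s‖ ^ 2) ≤ D + 1 + K * (1 + R) := by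
    simp only [epsAction] at hle
    linarith
  have h5 : (∫ s in t..T, ‖a s‖ ^ 2) ≤ A := by
    calc (∫ s in t..T, ‖a s‖ ^ 2) = 2 / ε * (ε / 2 * (∫ s in t..T, ‖a s‖ ^ 2)) := by field_simp
      _ ≤ _ := by rw [hA]; gcongr
  have h6 : ∀ s ∈ Icc t T, ‖path t v a s‖ ≤ B₁ := by
    intro s hs
    refine (ha.norm_path_le v hs).trans ?_
    have := ha.integral_norm_le ht.2 one_pos
    rw [hB₁]
    gcongr
    linarith
  refine ⟨h5, fun s hs => (h6 s hs).trans (by nlinarith [mul_nonneg hT hB₁0]), fun s hs => ?_⟩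
  refine ((ha.path_path t v).norm_path_le x hs).trans ?_
  have h7 : ∫ r in t..T, ‖path t v a r‖ ≤ ∫ r in t..T, B₁ :=
    intervalIntegral.integral_mono_on ht.2 ((ha.path_path t v).intervalIntegrable_norm t T)
      intervalIntegrable_const h6
  rw [intervalIntegral.integral_const, smul_eq_mul] at h7
  have h8 : (T - t) * B₁ ≤ T * B₁ := by gcongr
  linarith

theorem integral_sq_le_of_bound {w : ℝ → Eu d} (hw : L2loc w) (ht : t ∈ Icc 0 T)
    {B : ℝ} (hB : ∀ s ∈ Icc t T, ‖w s‖ ≤ B) : ∫ s in t..T, ‖w s‖ ^ 2 ≤ T * B ^ 2 := by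
  have h1 : ∫ s in t..T, ‖w s‖ ^ 2 ≤ ∫ s in t..T, B ^ 2 :=
    intervalIntegral.integral_mono_on ht.2 (hw.intervalIntegrable_sq t T)
      intervalIntegrable_const fun s hs => by have := hB s hs; gcongr
  rw [intervalIntegral.integral_const, smul_eq_mul] at h1
  have : (T - t) * B ^ 2 ≤ T * B ^ 2 := by
    have := ht.1
    gcongr
    linarith
  linarith

/-- The cost with a fixed control is Lipschitz in the initial condition. -/
theorem exists_epsAction_lipschitz (h : IsLag ℓ Lx Lv M C) (hG : IsTerm G Gx M C) (ε : ℝ)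
    (hT : 0 ≤ T) (B : ℝ) (hB : 0 ≤ B) :
    ∃ K, 0 ≤ K ∧ ∀ t ∈ Icc 0 T, ∀ x v x' v' a, L2loc a → (∀ s ∈ Icc t T, ‖path t v a s‖ ≤ B) →
      ‖v' - v‖ ≤ 1 →
      |epsAction ℓ G ε t T x' v' a - epsAction ℓ G ε t T x v a| ≤
        K * (‖x' - x‖ + ‖v' - v‖) := by
  have hM := h.M_pos
  refine ⟨M * (T + 2 + T * B ^ 2) * (1 + T) + M * (T * (2 + 2 * B)), by positivity,
    fun t ht x v x' v' a ha hWB hv => ?_⟩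
  have hW := ha.path_path t v
  have hW' := ha.path_path t v'
  have hd : ∀ s, path t v' a s - path t v a s = v' - v := fun s => by simp [path]
  have htT : T - t ≤ T := by have := ht.1; linarith
  have htT0 : 0 ≤ T - t := by have := ht.2; linarith
  have key := h.abs_action_sub_le hG ht.2 (hW.continuous_path t x) (hW'.continuous_path t x')
    hW hW' (e := ‖x' - x‖ + T * ‖v' - v‖) (fun s hs => ?_)
    (f := fun _ => (2 + 2 * B) * ‖v' - v‖) intervalIntegrable_const (fun s hs => ?_)
  · have e : epsAction ℓ G ε t T x' v' a - epsAction ℓ G ε t T x v a =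
      action ℓ G t T (path t x' (path t v' a)) (path t v' a) -
        action ℓ G t T (path t x (path t v a)) (path t v a) := by
      simp only [epsAction]; ring
    rw [e]
    refine key.trans ?_
    rw [intervalIntegral.integral_const, smul_eq_mul]
    have h1 := integral_sq_le_of_bound hW ht hWB
    have h2 : M * (T - t + 2 + ∫ s in t..T, ‖path t v a s‖ ^ 2) * (‖x' - x‖ + T * ‖v' - v‖) ≤
        M * (T + 2 + T * B ^ 2) * ((1 + T) * (‖x' - x‖ + ‖v' - v‖)) := by
      gcongr
      nlinarith [norm_nonneg (x' - x), norm_nonneg (v' - v),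
        mul_nonneg hT (norm_nonneg (x' - x))]
    have h3 : M * ((T - t) * ((2 + 2 * B) * ‖v' - v‖)) ≤
        M * (T * ((2 + 2 * B) * (‖x' - x‖ + ‖v' - v‖))) := by
      gcongr
      linarith [norm_nonneg (x' - x)]
    linarith
  · have e : path t x' (path t v' a) s - path t x (path t v a) s =
        (x' - x) + (s - t) • (v' - v) := by
      have := intervalIntegral.integral_sub (hW'.intervalIntegrable t s)
        (hW.intervalIntegrable t s)
      simp only [hd, intervalIntegral.integral_const] at this
      rw [this]
      simp only [path]
      abel
    rw [e]
    refine (norm_add_le _ _).trans ?_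
    rw [norm_smul, Real.norm_eq_abs, abs_of_nonneg (sub_nonneg.2 hs.1)]
    have := ht.1
    gcongr
    linarith [hs.2]
  · rw [hd]
    have h1 := hWB s hs
    have h2 : ‖path t v' a s‖ ≤ B + 1 := by
      have := norm_add_le (path t v a s) (path t v' a s - path t v a s)
      rw [add_sub_cancel, hd] at this
      linarith
    exact mul_le_mul_of_nonneg_right (by linarith) (norm_nonneg _)

/-- Restarting a controlled curve at an intermediate time. -/
theorem epsAction_restart_le (h : IsLag ℓ Lx Lv M C) (G : Eu d → ℝ) (hε : 0 ≤ ε) {t' : ℝ}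
    (htt' : t ≤ t') (x v : Eu d) (ha : L2loc a) :
    epsAction ℓ G ε t' T (path t x (path t v a) t') (path t v a t') a ≤
      epsAction ℓ G ε t T x v a -
        ∫ s in t..t', ℓ s (path t x (path t v a) s) (path t v a s) := by
  have hW := ha.path_path t v
  have e1 : path t' (path t v a t') a = path t v a := funext fun s => by
    have := ha.path_sub t v t' s
    simp only [path] at this ⊢
    rw [← this]
    abel
  have e2 : path t' (path t x (path t v a) t') (path t v a) = path t x (path t v a) :=
    funext fun s => by
      have := hW.path_sub t x t' s
      rw [path, ← this]
      abel
  have hi := h.intervalIntegrable (hW.continuous_path t x) hW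
  simp only [epsAction, e1, e2, action]
  rw [← intervalIntegral.integral_add_adjacent_intervals (hi t t') (hi t' T),
    ← intervalIntegral.integral_add_adjacent_intervals (ha.intervalIntegrable_sq t t')
      (ha.intervalIntegrable_sq t' T)]
  -- The acceleration cost spent on `[t, t']` is discarded, which is why the verification argument
  -- bounds the cost without acceleration only.
  have : 0 ≤ ε / 2 * ∫ s in t..t', ‖a s‖ ^ 2 := mul_nonneg (by linarith)
    (intervalIntegral.integral_nonneg htt' fun _ _ => sq_nonneg _)
  linarith

theorem L2loc.integral_norm_le_sqrt (ha : L2loc a) {A r s : ℝ} (hA : ∫ u in r..s, ‖a u‖ ^ 2 ≤ A)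
    (hrs : r ≤ s) : ∫ u in r..s, ‖a u‖ ≤ √(s - r) * (A + 1 / 4) := by
  rcases hrs.eq_or_lt with rfl | hlt
  · simp
  have hs : 0 < √(s - r) := Real.sqrt_pos.2 (sub_pos.2 hlt)
  refine (ha.integral_norm_le hrs hs).trans ?_
  have h2 : (s - r) / (4 * √(s - r)) = √(s - r) * (1 / 4) := by
    have := Real.mul_self_sqrt (sub_pos.2 hlt).le
    field_simp
    nlinarith
  rw [h2, mul_add]
  gcongr

/-- The cost of a velocity perturbation which is absorbed by the control during the time `r`. -/
theorem exists_epsAction_kick (h : IsLag ℓ Lx Lv M C) (hG : IsTerm G Gx M C) (ε : ℝ)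
    (hT : 0 ≤ T) (B : ℝ) (hB : 0 ≤ B) :
    ∃ K, 0 ≤ K ∧ ∀ t ∈ Icc 0 T, ∀ x v a, L2loc a → (∀ s ∈ Icc t T, ‖path t v a s‖ ≤ B) →
      ∀ r, 0 < r → r ≤ 1 → t + r ≤ T → ∀ q : Eu d, ‖q‖ ≤ 1 → ∃ a', L2loc a' ∧
        epsAction ℓ G ε t T x (v + r • q) a' ≤ epsAction ℓ G ε t T x v a -
          ε * inner ℝ (∫ s in t..t + r, a s) q + ε * r * ‖q‖ ^ 2 / 2 + K * r ^ 2 := by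
  have hM := h.M_pos
  refine ⟨M * (T + 2 + T * B ^ 2) + M * (2 + 2 * B), by positivity,
    fun t ht x v a ha hWB r hr hr1 hrT q hq => ?_⟩
  classical
  -- Subtracting `q` from the control during time `r` brings the perturbation `r • q` of the
  -- velocity linearly back to zero at `t + r`.
  set p : ℝ → Eu d := (Ioc t (t + r)).indicator fun _ => q with hp
  have hpl : L2loc p := by
    have := (L2loc.of_continuous (continuous_const (y := q))).piecewise
      (l2loc_zero (d := d)) (measurableSet_Ioc (a := t) (b := t + r))
    rw [hp, ← Set.piecewise_eq_indicator]
    exact this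
  set a' : ℝ → Eu d := fun s => a s - p s with ha'
  have ha'l : L2loc a' := ha.sub hpl
  have htr : t ≤ t + r := by linarith
  have ip1 : ∀ s ∈ Icc t (t + r), ∫ u in t..s, p u = (s - t) • q := by
    intro s hs
    rw [← intervalIntegral.integral_const, intervalIntegral.integral_of_le hs.1,
      intervalIntegral.integral_of_le hs.1]
    exact setIntegral_congr_fun measurableSet_Ioc fun u hu =>
      indicator_of_mem (show u ∈ Ioc t (t + r) from ⟨hu.1, hu.2.trans hs.2⟩) _
  have ip2 : ∀ s, t + r ≤ s → ∫ u in t + r..s, p u = 0 := by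
    intro s hs
    rw [intervalIntegral.integral_of_le hs]
    refine setIntegral_eq_zero_of_forall_eq_zero fun u hu => indicator_of_notMem ?_ _
    exact fun hu' => absurd hu'.2 (not_le.2 hu.1)
  set W := path t v a
  set W' := path t (v + r • q) a'
  have hW := ha.path_path t v
  have hW' := ha'l.path_path t (v + r • q)
  have hWW' : ∀ s, W' s - W s = r • q - ∫ u in t..s, p u := fun s => by
    simp only [W', W, path, ha']
    rw [intervalIntegral.integral_sub (ha.intervalIntegrable _ _) (hpl.intervalIntegrable _ _)]
    abel
  -- After time `t` this dominates the difference of the velocities, and its integral is `r ^ 2`.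
  -- Hence the action changes by `O(r ^ 2)`, and the terms of first order in `r` come from the
  -- acceleration cost alone.
  set f : ℝ → ℝ := (Ioc t (t + r)).indicator fun _ => r with hf
  have hfi : ∀ b c, IntervalIntegrable f volume b c := fun b c => by
    have : Integrable f volume := (integrable_indicator_iff measurableSet_Ioc).2
      (integrableOn_const (by simp))
    exact this.intervalIntegrable
  have hf0 : ∀ s, 0 ≤ f s := fun s => indicator_nonneg (fun _ _ => hr.le) _
  have hfint : ∫ s in t..T, f s = r ^ 2 := by
    rw [intervalIntegral.integral_of_le ht.2, hf, setIntegral_indicator measurableSet_Ioc,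
      Ioc_inter_Ioc, max_self, min_eq_right hrT, setIntegral_const]
    simp [measureReal_def, ENNReal.toReal_ofReal hr.le]
    ring
  have hWf : ∀ s ∈ Ioc t T, ‖W' s - W s‖ ≤ f s := by
    intro s hs
    rw [hWW']
    rcases le_or_gt s (t + r) with hsr | hsr
    · rw [ip1 s ⟨hs.1.le, hsr⟩, hf, indicator_of_mem (show s ∈ Ioc t (t + r) from ⟨hs.1, hsr⟩), ← sub_smul, norm_smul,
        Real.norm_eq_abs, abs_of_nonneg (by linarith)]
      have : (r - (s - t)) * ‖q‖ ≤ r * 1 :=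
        mul_le_mul (by linarith [hs.1]) hq (norm_nonneg _) hr.le
      linarith
    · rw [← intervalIntegral.integral_add_adjacent_intervals (hpl.intervalIntegrable t (t + r))
        (hpl.intervalIntegrable (t + r) s), ip2 s hsr.le, ip1 _ ⟨htr, le_rfl⟩]
      simp [hf0 s]
  refine ⟨a', ha'l, ?_⟩
  have hWW1 : ∀ s ∈ Icc t T, ‖W' s - W s‖ ≤ 1 := by
    intro s hs
    rcases hs.1.eq_or_lt with rfl | hlt
    · rw [hWW', intervalIntegral.integral_same, sub_zero, norm_smul, Real.norm_eq_abs,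
        abs_of_pos hr]
      nlinarith [norm_nonneg q]
    · refine (hWf s ⟨hlt, hs.2⟩).trans ?_
      exact indicator_le' (fun _ _ => hr1) (fun _ _ => zero_le_one) s
  have key : |action ℓ G t T (path t x W') W' - action ℓ G t T (path t x W) W| ≤
      M * (T - t + 2 + ∫ s in t..T, ‖W s‖ ^ 2) * r ^ 2 +
        M * ∫ s in t..T, (2 + 2 * B) * ‖W' s - W s‖ := by
    refine h.abs_action_sub_le hG ht.2 (hW.continuous_path t x) (hW'.continuous_path t x)
      hW hW' (fun s hs => ?_)
      ((((ha'l.continuous_path _ _).sub (ha.continuous_path _ _)).norm.const_mul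
        _).intervalIntegrable _ _) fun s hs => ?_
    · have e : path t x W' s - path t x W s = ∫ u in t..s, (W' u - W u) := by
        rw [intervalIntegral.integral_sub (hW'.intervalIntegrable _ _)
          (hW.intervalIntegrable _ _)]
        exact add_sub_add_left_eq_sub _ _ _
      rw [e, ← hfint]
      refine (intervalIntegral.norm_integral_le_of_norm_le hs.1 (g := f)
        (Eventually.of_forall fun u hu => hWf u ⟨hu.1, hu.2.trans hs.2⟩) (hfi t s)).trans ?_
      exact intervalIntegral.integral_mono_interval le_rfl hs.1 hs.2
        (Eventually.of_forall hf0) (hfi t T)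
    · have h1 := hWB s hs
      have h2 := hWW1 s hs
      have h3 : ‖W' s‖ ≤ B + 1 := by
        have := norm_add_le (W s) (W' s - W s)
        rw [add_sub_cancel] at this
        linarith
      exact mul_le_mul_of_nonneg_right (by linarith) (norm_nonneg _)
  have hle : ∫ s in t..T, (2 + 2 * B) * ‖W' s - W s‖ ≤ (2 + 2 * B) * r ^ 2 := by
    rw [intervalIntegral.integral_const_mul, ← hfint]
    refine mul_le_mul_of_nonneg_left ?_ (by positivity)
    exact intervalIntegral.integral_mono_on_of_le_Ioo ht.2
      ((hW'.sub hW).intervalIntegrable_norm t T) (hfi t T)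
      fun s hs => hWf s (Ioo_subset_Ioc_self hs)
  have hsq : ∫ s in t..T, ‖a' s‖ ^ 2 = (∫ s in t..T, ‖a s‖ ^ 2) -
      2 * inner ℝ (∫ s in t..t + r, a s) q + r * ‖q‖ ^ 2 := by
    have hsq1 : ∫ s in t + r..T, ‖a' s‖ ^ 2 = ∫ s in t + r..T, ‖a s‖ ^ 2 := by
      rw [intervalIntegral.integral_of_le hrT, intervalIntegral.integral_of_le hrT]
      refine setIntegral_congr_fun measurableSet_Ioc fun u hu => ?_
      have : p u = 0 := indicator_of_notMem (fun hu' => absurd hu'.2 (not_le.2 hu.1)) _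
      simp only [ha', this, sub_zero]
    have iq : IntervalIntegrable (fun s => inner ℝ q (a s)) volume t (t + r) := by
      rw [intervalIntegrable_iff]
      exact ((intervalIntegrable_iff.1 (ha.intervalIntegrable t (t + r))).const_inner q)
    have hsq2 : ∫ s in t..t + r, ‖a' s‖ ^ 2 = (∫ s in t..t + r, ‖a s‖ ^ 2) -
        2 * inner ℝ (∫ s in t..t + r, a s) q + r * ‖q‖ ^ 2 := by
      have e : ∫ s in t..t + r, ‖a' s‖ ^ 2 =
          ∫ s in t..t + r, (‖a s‖ ^ 2 - 2 * inner ℝ q (a s) + ‖q‖ ^ 2) := by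
        rw [intervalIntegral.integral_of_le htr, intervalIntegral.integral_of_le htr]
        refine setIntegral_congr_fun measurableSet_Ioc fun u hu => ?_
        have : p u = q := indicator_of_mem hu _
        simp only [ha', this, norm_sub_sq_real, real_inner_comm]
      rw [e, intervalIntegral.integral_add ((ha.intervalIntegrable_sq _ _).sub (iq.const_mul 2))
        intervalIntegrable_const, intervalIntegral.integral_sub (ha.intervalIntegrable_sq _ _)
        (iq.const_mul 2), intervalIntegral.integral_const_mul, intervalIntegral.integral_const]
      have : ∫ s in t..t + r, inner ℝ q (a s) = inner ℝ q (∫ s in t..t + r, a s) :=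
        (innerSL ℝ q).intervalIntegral_comp_comm (ha.intervalIntegrable _ _)
      rw [this, real_inner_comm]
      simp
    rw [← intervalIntegral.integral_add_adjacent_intervals (ha'l.intervalIntegrable_sq t (t + r))
        (ha'l.intervalIntegrable_sq (t + r) T), ← intervalIntegral.integral_add_adjacent_intervals
        (ha.intervalIntegrable_sq t (t + r)) (ha.intervalIntegrable_sq (t + r) T), hsq1, hsq2]
    ring
  have hQ := integral_sq_le_of_bound hW ht hWB
  have h1 : M * (T - t + 2 + ∫ s in t..T, ‖W s‖ ^ 2) * r ^ 2 ≤
      M * (T + 2 + T * B ^ 2) * r ^ 2 := by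
    have := ht.1
    gcongr
    linarith
  have h2 := mul_le_mul_of_nonneg_left hle hM.le
  have h3 := (abs_le.1 key).2
  simp only [epsAction]
  rw [hsq]
  linarith

end MFG

/-! ### Verification: the cost along feedback curves is bounded by the value. -/

namespace MFG
variable {d : ℕ} {ℓ : ℝ → Eu d → Eu d → ℝ} {Lx Lv : ℝ → Eu d → Eu d → Eu d} {M C : ℝ}
  {G : Eu d → ℝ} {Gx : Eu d → Eu d} {T t ε : ℝ} {x v : Eu d} {a a' : ℝ → Eu d}

theorem L2loc.norm_path_sub_le_energy (ha : L2loc a) (v : Eu d) {A s : ℝ}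
    (hA : ∫ u in t..T, ‖a u‖ ^ 2 ≤ A) (hs : s ∈ Icc t T) :
    ‖path t v a s - v‖ ≤ √(s - t) * (A + 1 / 4) := by
  have h1 := ha.norm_path_sub_le t v hs.1
  rw [path_self] at h1
  exact h1.trans (ha.integral_norm_le_sqrt
    ((integral_norm_sq_mono ha le_rfl hs.1 hs.2).trans hA) hs.1)

/-- Nearly optimal controls have the mean value prescribed by the derivative of the value
function in the velocity. -/
theorem eventually_mean_control (h : IsLag ℓ Lx Lv M C) (hG : IsTerm G Gx M C) (hε : 0 < ε)
    (ht : t ∈ Ioo 0 T) {q : Eu d}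
    (hd : HasFDerivAt (epsValue ℓ G ε t T x) (innerSL ℝ (-(ε • q))) v) {κ : ℝ} (hκ : 0 < κ) :
    ∀ᶠ r in 𝓝[>] (0 : ℝ), ∀ a, L2loc a →
      epsAction ℓ G ε t T x v a ≤ epsValue ℓ G ε t T x v + r ^ 2 →
      ‖(∫ s in t..t + r, a s) - r • q‖ ≤ κ * r := by
  have hT : 0 ≤ T := ht.1.le.trans ht.2.le
  have ht' : t ∈ Icc 0 T := Ioo_subset_Icc_self ht
  obtain ⟨A, B, hA0, hB0, hAB⟩ := exists_control_bound h hG hε hT (max ‖x‖ ‖v‖)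
    ((norm_nonneg x).trans (le_max_left _ _))
  obtain ⟨K, hK0, hK⟩ := exists_epsAction_kick h hG ε hT B hB0
  -- The bound by `1` is required by the perturbation lemma. The bound by `κ` keeps the quadratic
  -- term `ε * r * τ ^ 2 / 2` below half of the target `ε * τ * κ * r`.
  set τ := min 1 κ with hτ
  have hτ0 : 0 < τ := lt_min one_pos hκ
  have hτ1 : τ ≤ 1 := min_le_left _ _
  have hτκ : τ ≤ κ := min_le_right _ _
  obtain ⟨δ, hδ0, hδ⟩ := Metric.eventually_nhds_iff.1
    ((hasFDerivAt_iff_isLittleO.1 hd).def (by positivity : 0 < ε * κ / 8))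
  have hpos : 0 < min (min δ 1) (min (T - t) (ε * τ * κ / (8 * (1 + K)))) :=
    lt_min (lt_min hδ0 one_pos) (lt_min (sub_pos.2 ht.2) (by positivity))
  filter_upwards [Ioo_mem_nhdsGT hpos] with r hr a ha hle
  have hr0 := hr.1
  obtain ⟨hr12, hr34⟩ := lt_min_iff.1 hr.2
  obtain ⟨hr1, hr2⟩ := lt_min_iff.1 hr12
  obtain ⟨hr3, hr4⟩ := lt_min_iff.1 hr34
  set z := (∫ s in t..t + r, a s) - r • q with hz
  rcases eq_or_ne z 0 with h0 | h0
  · rw [h0, norm_zero]; positivity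
  have hz0 : 0 < ‖z‖ := norm_pos_iff.2 h0
  -- The velocity is perturbed in the direction of the discrepancy `z`. Differentiability bounds the
  -- value at `v + r • lam` from below and `exists_epsAction_kick` bounds it from above; comparing
  -- the two isolates `ε * inner ℝ z lam = ε * τ * ‖z‖`.
  set lam := (τ / ‖z‖) • z with hlam
  have hln : ‖lam‖ = τ := by
    rw [hlam, norm_smul, Real.norm_eq_abs, abs_of_pos (by positivity)]
    field_simp
  have hli : inner ℝ z lam = τ * ‖z‖ := by
    rw [hlam, inner_smul_right, real_inner_self_eq_norm_sq]
    field_simp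
  obtain ⟨-, hW, -⟩ := hAB t ht' x v a (le_max_left _ _) (le_max_right _ _) ha
    (by nlinarith)
  obtain ⟨a', ha', hle'⟩ := hK t ht' x v a ha hW r hr0 hr2.le (by linarith) lam
    (by rw [hln]; exact hτ1)
  have h1 := epsValue_le h hG hε.le ht' x (v + r • lam) ha'
  have h2 := hδ (y := v + r • lam) (by
    rw [dist_eq_norm, add_sub_cancel_left, norm_smul, Real.norm_eq_abs, abs_of_pos hr0, hln]
    nlinarith)
  rw [add_sub_cancel_left, norm_smul, Real.norm_eq_abs, Real.norm_eq_abs, abs_of_pos hr0, hln,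
    innerSL_apply_apply, inner_neg_left, inner_smul_left, inner_smul_right] at h2
  simp only [RCLike.conj_to_real] at h2
  have h3 := (abs_le.1 h2).1
  have h4 : inner ℝ z lam = inner ℝ (∫ s in t..t + r, a s) lam - r * inner ℝ q lam := by
    rw [hz, inner_sub_left, inner_smul_left]
    simp
  rw [hln] at hle'
  have h5 : ε * (τ * ‖z‖) ≤ ε * κ / 8 * (r * τ) + ε * r * τ ^ 2 / 2 + (1 + K) * r ^ 2 := by
    rw [← hli, h4]
    linarith
  have h6 : (1 + K) * r ^ 2 ≤ ε * τ * κ / 8 * r := by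
    have : (1 + K) * r ≤ ε * τ * κ / 8 := by
      calc (1 + K) * r ≤ (1 + K) * (ε * τ * κ / (8 * (1 + K))) := by gcongr
        _ = _ := by field_simp
    nlinarith
  have h7 : ε * r * τ ^ 2 / 2 ≤ ε * r * (τ * κ) / 2 := by
    rw [pow_two]
    gcongr
  have h8 : ε * τ * ‖z‖ ≤ ε * τ * (κ * r) := by
    have : 0 ≤ ε * τ * (κ * r) := by positivity
    linarith
  exact le_of_mul_le_mul_left h8 (by positivity)

/-- Bound of the value function along a curve by means of a control for another starting point. -/
theorem exists_epsValue_forward (h : IsLag ℓ Lx Lv M C) (hG : IsTerm G Gx M C) (hε : 0 < ε)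
    (hT : 0 ≤ T) (R : ℝ) (hR : 0 ≤ R) :
    ∃ A B K, 0 ≤ A ∧ 0 ≤ B ∧ 0 ≤ K ∧ ∀ t ∈ Icc 0 T, ∀ x v a, ‖x‖ ≤ R → ‖v‖ ≤ R → L2loc a →
      epsAction ℓ G ε t T x v a ≤ epsValue ℓ G ε t T x v + 1 →
      (∫ s in t..T, ‖a s‖ ^ 2) ≤ A ∧ (∀ s ∈ Icc t T, ‖path t v a s‖ ≤ B) ∧
        (∀ s ∈ Icc t T, ‖path t x (path t v a) s‖ ≤ B) ∧
        ∀ t' ∈ Icc t T, ∀ x' v', ‖v' - path t v a t'‖ ≤ 1 →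
          epsValue ℓ G ε t' T x' v' ≤ epsAction ℓ G ε t T x v a -
            (∫ s in t..t', ℓ s (path t x (path t v a) s) (path t v a s)) +
            K * (‖x' - path t x (path t v a) t'‖ + ‖v' - path t v a t'‖) := by
  obtain ⟨A, B, hA0, hB0, hAB⟩ := exists_control_bound h hG hε hT R hR
  obtain ⟨K, hK0, hK⟩ := exists_epsAction_lipschitz h hG ε hT B hB0
  refine ⟨A, B, K, hA0, hB0, hK0, fun t ht x v a hx hv ha hle => ?_⟩
  obtain ⟨h1, h2, h3⟩ := hAB t ht x v a hx hv ha hle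
  refine ⟨h1, h2, h3, fun t' ht' x' v' hv' => ?_⟩
  have ht'' : t' ∈ Icc 0 T := ⟨ht.1.trans ht'.1, ht'.2⟩
  have e1 := epsValue_le h hG hε.le ht'' x' v' ha
  have e2 := epsAction_restart_le (T := T) h G hε.le ht'.1 x v ha
  have e3 := hK t' ht'' (path t x (path t v a) t') (path t v a t') x' v' a ha (fun s hs => by
    have := ha.path_sub t v t' s
    have e : path t' (path t v a t') a s = path t v a s := by
      rw [path, ← this]; abel
    rw [e]
    exact h2 s ⟨ht'.1.trans hs.1, hs.2⟩) hv'
  have e4 := (abs_le.1 e3).2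
  linarith

/-- An `r ^ 2`-optimal control has mean close to `q = V'(t)` on `[t, t + r]`, so its curve and the
characteristic have the same position and velocity at `t + r` up to `o(r)`. Lipschitz dependence on
the initial data then transfers the dynamic programming inequality to the characteristic. No
differentiability of the value in `t` or `x` is needed. -/
theorem eventually_epsValue_le (h : IsLag ℓ Lx Lv M C) (hG : IsTerm G Gx M C) (hε : 0 < ε)
    (ht : t ∈ Ioo 0 T) {X V : ℝ → Eu d} {q : Eu d} (hX : HasDerivAt X (V t) t)
    (hV : HasDerivAt V q t)
    (hd : HasFDerivAt (epsValue ℓ G ε t T (X t)) (innerSL ℝ (-(ε • q))) (V t))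
    {η : ℝ} (hη : 0 < η) :
    ∀ᶠ r in 𝓝[>] (0 : ℝ), epsValue ℓ G ε (t + r) T (X (t + r)) (V (t + r)) ≤
      epsValue ℓ G ε t T (X t) (V t) - r * ℓ t (X t) (V t) + η * r := by
  have hT : 0 ≤ T := ht.1.le.trans ht.2.le
  set x := X t with hx
  set v := V t with hv
  obtain ⟨A, B, K, hA0, hB0, hK0, hABK⟩ := exists_epsValue_forward h hG hε hT (max ‖x‖ ‖v‖)
    ((norm_nonneg x).trans (le_max_left _ _))
  -- The error budget: `κ * r` for the non-optimality `r ^ 2`, `κ * r` for the running cost, and `K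
  -- * (4 * κ * r)` for the distance of the endpoints.
  set κ := η / (2 + 4 * K) with hκ
  have hκ0 : 0 < κ := by positivity
  have hκη : κ * (2 + 4 * K) = η := by rw [hκ]; field_simp
  obtain ⟨δ, hδ0, hδ⟩ := Metric.continuous_iff.1 h.cont (t, x, v) κ hκ0
  have hρ : ∀ᶠ r in 𝓝[>] (0 : ℝ), √r * (A + 1 / 4) < min δ κ := by
    have hc : Continuous fun r : ℝ => √r * (A + 1 / 4) := by fun_prop
    exact ((hc.tendsto' 0 0 (by simp)).mono_left nhdsWithin_le_nhds).eventually
      (gt_mem_nhds (lt_min hδ0 hκ0))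
  have hBr : ∀ᶠ r in 𝓝[>] (0 : ℝ), B * r < δ := by
    have hc : Continuous fun r : ℝ => B * r := by fun_prop
    exact ((hc.tendsto' 0 0 (by simp)).mono_left nhdsWithin_le_nhds).eventually
      (gt_mem_nhds hδ0)
  have hκr : ∀ᶠ r in 𝓝[>] (0 : ℝ), 2 * κ * r < 1 := by
    have hc : Continuous fun r : ℝ => 2 * κ * r := by fun_prop
    exact ((hc.tendsto' 0 0 (by simp)).mono_left nhdsWithin_le_nhds).eventually
      (gt_mem_nhds one_pos)
  have hXr := ((hasDerivAt_iff_isLittleO_nhds_zero.1 hX).def hκ0).filter_mono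
    (nhdsWithin_le_nhds (s := Ioi 0))
  have hVr := ((hasDerivAt_iff_isLittleO_nhds_zero.1 hV).def hκ0).filter_mono
    (nhdsWithin_le_nhds (s := Ioi 0))
  have hpos : 0 < min (min δ 1) (min (T - t) κ) :=
    lt_min (lt_min hδ0 one_pos) (lt_min (sub_pos.2 ht.2) hκ0)
  filter_upwards [Ioo_mem_nhdsGT hpos, hρ, hBr, hκr, hXr, hVr,
    eventually_mean_control h hG hε ht hd hκ0] with r hr hρr hBr hκr hXr hVr hmean
  have hr0 := hr.1
  obtain ⟨hr12, hr34⟩ := lt_min_iff.1 hr.2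
  obtain ⟨hr1, hr2⟩ := lt_min_iff.1 hr12
  obtain ⟨hr3, hr4⟩ := lt_min_iff.1 hr34
  obtain ⟨hρ1, hρ2⟩ := lt_min_iff.1 hρr
  rw [Real.norm_eq_abs, abs_of_pos hr0, ← hx] at hXr
  rw [Real.norm_eq_abs, abs_of_pos hr0, ← hv] at hVr
  obtain ⟨a, ha, hlt⟩ := exists_epsAction_lt ℓ G ε t T x v (pow_pos hr0 2)
  obtain ⟨h1, h2, h3, h4⟩ := hABK t (Ioo_subset_Icc_self ht) x v a (le_max_left _ _)
    (le_max_right _ _) ha (by nlinarith)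
  have hm := hmean a ha hlt.le
  set W := path t v a with hW
  have hWl : L2loc W := ha.path_path t v
  set Y := path t x W with hY
  have htr : t + r ∈ Icc t T := ⟨by linarith, by linarith⟩
  have hWv : ∀ s ∈ Icc t (t + r), ‖W s - v‖ ≤ √r * (A + 1 / 4) := fun s hs => by
    refine (ha.norm_path_sub_le_energy v h1 ⟨hs.1, hs.2.trans htr.2⟩).trans ?_
    gcongr
    linarith [hs.2]
  have hYx : ∀ s ∈ Icc t (t + r), ‖Y s - x‖ ≤ B * r := fun s hs => by
    have e := hWl.norm_path_sub_le t x hs.1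
    rw [path_self] at e
    refine e.trans ?_
    have e2 : ∫ u in t..s, ‖W u‖ ≤ ∫ u in t..s, B :=
      intervalIntegral.integral_mono_on hs.1 (hWl.intervalIntegrable_norm t s)
        intervalIntegrable_const fun u hu => h2 u ⟨hu.1, hu.2.trans (hs.2.trans htr.2)⟩
    rw [intervalIntegral.integral_const, smul_eq_mul] at e2
    have : (s - t) * B ≤ r * B := by
      gcongr
      linarith [hs.2]
    linarith
  have hV1 : ‖V (t + r) - W (t + r)‖ ≤ 2 * κ * r := by
    have e : V (t + r) - W (t + r) = (V (t + r) - v - r • q) -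
        ((∫ s in t..t + r, a s) - r • q) := by
      simp only [hW, path]; abel
    rw [e]
    refine (norm_sub_le _ _).trans ?_
    linarith
  have hX1 : ‖X (t + r) - Y (t + r)‖ ≤ 2 * κ * r := by
    have e0 : ∫ s in t..t + r, (W s - v) = (∫ s in t..t + r, W s) - r • v := by
      rw [intervalIntegral.integral_sub (hWl.intervalIntegrable _ _) intervalIntegrable_const,
        intervalIntegral.integral_const, add_sub_cancel_left]
    have e : X (t + r) - Y (t + r) = (X (t + r) - x - r • v) - ∫ s in t..t + r, (W s - v) := by
      rw [e0]; simp only [hY, path]; abel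
    rw [e]
    refine (norm_sub_le _ _).trans ?_
    have e2 := intervalIntegral.norm_integral_le_of_norm_le_const (a := t) (b := t + r)
      (f := fun s => W s - v) (C := κ) fun s hs => by
        rw [uIoc_of_le htr.1] at hs
        exact (hWv s (Ioc_subset_Icc_self hs)).trans hρ2.le
    rw [add_sub_cancel_left, abs_of_pos hr0] at e2
    linarith
  have h5 := h4 (t + r) htr (X (t + r)) (V (t + r)) (hV1.trans hκr.le)
  have h6 : r * (ℓ t x v - κ) ≤ ∫ s in t..t + r, ℓ s (Y s) (W s) := by
    have e : ∫ s in t..t + r, (ℓ t x v - κ) = r * (ℓ t x v - κ) := by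
      rw [intervalIntegral.integral_const, add_sub_cancel_left, smul_eq_mul]
    rw [← e]
    refine intervalIntegral.integral_mono_on htr.1 intervalIntegrable_const
      (h.intervalIntegrable (hWl.continuous_path t x) hWl _ _) fun s hs => ?_
    have e2 := hδ (s, Y s, W s) (by
      rw [Prod.dist_eq, Prod.dist_eq, max_lt_iff, max_lt_iff, Real.dist_eq, dist_eq_norm,
        dist_eq_norm]
      refine ⟨?_, (hYx s hs).trans_lt hBr, (hWv s hs).trans_lt hρ1⟩
      rw [abs_of_nonneg (sub_nonneg.2 hs.1)]
      linarith [hs.2])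
    rw [Real.dist_eq] at e2
    have := (abs_lt.1 e2).1
    simp only at this
    linarith
  have h7 : K * (‖X (t + r) - Y (t + r)‖ + ‖V (t + r) - W (t + r)‖) ≤ K * (4 * κ * r) := by
    gcongr
    linarith
  have h8 : r ^ 2 ≤ κ * r := by nlinarith
  have h9 : η * r = 2 * κ * r + 4 * K * κ * r := by rw [← hκη]; ring
  linarith

/-- This excludes upward jumps of the value along the curve, uniformly on the closed interval, so
that `le_of_dini` can reach the endpoints, where no differential equation is assumed. A nearly
optimal control from time `t` is restarted at `t'`. -/
theorem epsValue_forward_modulus (h : IsLag ℓ Lx Lv M C) (hG : IsTerm G Gx M C) (hε : 0 < ε)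
    (hT : 0 ≤ T) {X V : ℝ → Eu d} (hX : ContinuousOn X (Icc 0 T))
    (hV : ContinuousOn V (Icc 0 T)) {η : ℝ} (hη : 0 < η) :
    ∃ δ > 0, ∀ t ∈ Icc 0 T, ∀ t' ∈ Icc t T, t' - t < δ →
      epsValue ℓ G ε t' T (X t') (V t') ≤ epsValue ℓ G ε t T (X t) (V t) + η := by
  have hM := h.M_pos
  have hC := h.C_nonneg
  obtain ⟨R₁, hR₁⟩ := isCompact_Icc.exists_bound_of_continuousOn hX
  obtain ⟨R₂, hR₂⟩ := isCompact_Icc.exists_bound_of_continuousOn hV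
  have h0 : (0 : ℝ) ∈ Icc 0 T := ⟨le_rfl, hT⟩
  obtain ⟨A, B, K, hA0, hB0, hK0, hABK⟩ := exists_epsValue_forward h hG hε hT (max R₁ R₂)
    (((norm_nonneg _).trans (hR₁ 0 h0)).trans (le_max_left _ _))
  set κ := min (η / (4 * (K + 1))) (1 / 2) with hκ
  have hκ0 : 0 < κ := lt_min (by positivity) (by norm_num)
  have hKκ : K * κ ≤ η / 4 := by
    have : κ ≤ η / (4 * (K + 1)) := min_le_left _ _
    calc K * κ ≤ (K + 1) * (η / (4 * (K + 1))) := by gcongr; linarith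
      _ = η / 4 := by field_simp
  obtain ⟨δ₁, hδ₁, hX'⟩ := Metric.uniformContinuousOn_iff.1
    (isCompact_Icc.uniformContinuousOn_of_continuous hX) (κ / 2) (by positivity)
  obtain ⟨δ₂, hδ₂, hV'⟩ := Metric.uniformContinuousOn_iff.1
    (isCompact_Icc.uniformContinuousOn_of_continuous hV) (κ / 2) (by positivity)
  set D := C + M * B + M * (1 + B) * B with hD
  have hD0 : 0 ≤ D := by positivity
  obtain ⟨δ₃, hδ₃, hs⟩ : ∃ δ₃ > 0, ∀ r, 0 ≤ r → r < δ₃ →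
      √r * (A + 1 / 4) + B * r < κ / 2 ∧ D * r < η / 4 := by
    have hc : Continuous fun r : ℝ => √r * (A + 1 / 4) + B * r := by fun_prop
    have hc' : Continuous fun r : ℝ => D * r := by fun_prop
    have e1 := (hc.tendsto' 0 0 (by simp)).eventually (gt_mem_nhds (half_pos hκ0))
    have e2 := (hc'.tendsto' 0 0 (by simp)).eventually
      (gt_mem_nhds (by positivity : 0 < η / 4))
    obtain ⟨δ, hδ, hh⟩ := Metric.eventually_nhds_iff.1 (e1.and e2)
    exact ⟨δ, hδ, fun r hr hrδ => hh (by rwa [Real.dist_eq, sub_zero, abs_of_nonneg hr])⟩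
  refine ⟨min (min δ₁ δ₂) δ₃, lt_min (lt_min hδ₁ hδ₂) hδ₃, fun t ht t' ht' hlt => ?_⟩
  obtain ⟨hlt12, hlt3⟩ := lt_min_iff.1 hlt
  obtain ⟨hlt1, hlt2⟩ := lt_min_iff.1 hlt12
  have ht'' : t' ∈ Icc 0 T := ⟨ht.1.trans ht'.1, ht'.2⟩
  have hr0 : 0 ≤ t' - t := sub_nonneg.2 ht'.1
  obtain ⟨s1, s2⟩ := hs (t' - t) hr0 hlt3
  obtain ⟨a, ha, hle⟩ := exists_epsAction_lt ℓ G ε t T (X t) (V t)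
    (lt_min (by positivity : 0 < η / 4) one_pos)
  have m1 := min_le_left (η / 4) 1
  have m2 := min_le_right (η / 4) 1
  obtain ⟨h1, h2, h3, h4⟩ := hABK t ht (X t) (V t) a ((hR₁ t ht).trans (le_max_left _ _))
    ((hR₂ t ht).trans (le_max_right _ _)) ha (by linarith)
  set W := path t (V t) a with hW
  have hWl : L2loc W := ha.path_path t (V t)
  set Y := path t (X t) W with hY
  have hdist : dist t' t = t' - t := by rw [Real.dist_eq, abs_of_nonneg hr0]
  have dX : ‖X t' - X t‖ < κ / 2 := by
    rw [← dist_eq_norm]; exact hX' t' ht'' t ht (by rwa [hdist])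
  have dV : ‖V t' - V t‖ < κ / 2 := by
    rw [← dist_eq_norm]; exact hV' t' ht'' t ht (by rwa [hdist])
  have dW : ‖W t' - V t‖ ≤ √(t' - t) * (A + 1 / 4) := ha.norm_path_sub_le_energy _ h1 ht'
  have dY : ‖Y t' - X t‖ ≤ B * (t' - t) := by
    have e := hWl.norm_path_sub_le t (X t) ht'.1
    rw [path_self] at e
    refine e.trans ?_
    have e2 : ∫ u in t..t', ‖W u‖ ≤ ∫ u in t..t', B :=
      intervalIntegral.integral_mono_on ht'.1 (hWl.intervalIntegrable_norm t t')
        intervalIntegrable_const fun u hu => h2 u ⟨hu.1, hu.2.trans ht'.2⟩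
    rw [intervalIntegral.integral_const, smul_eq_mul] at e2
    linarith
  have hsum : ‖X t' - Y t'‖ + ‖V t' - W t'‖ ≤ 2 * κ ∧ ‖V t' - W t'‖ ≤ 1 := by
    have e1 := norm_sub_le_norm_sub_add_norm_sub (X t') (X t) (Y t')
    have e2 := norm_sub_le_norm_sub_add_norm_sub (V t') (V t) (W t')
    rw [norm_sub_rev (X t) (Y t')] at e1
    rw [norm_sub_rev (V t) (W t')] at e2
    have : κ ≤ 1 / 2 := min_le_right _ _
    have : 0 ≤ B * (t' - t) := by positivity
    have : 0 ≤ √(t' - t) * (A + 1 / 4) := by positivity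
    constructor <;> linarith
  have h5 := h4 t' ht' (X t') (V t') hsum.2
  have h6 : -(D * (t' - t)) ≤ ∫ s in t..t', ℓ s (Y s) (W s) := by
    have e2 := intervalIntegral.norm_integral_le_of_norm_le_const (a := t) (b := t')
      (f := fun s => ℓ s (Y s) (W s)) (C := D) fun s hs => by
        rw [uIoc_of_le ht'.1] at hs
        have hs' : s ∈ Icc t T := ⟨hs.1.le, hs.2.trans ht'.2⟩
        have b1 := h2 s hs'
        have b2 := h3 s hs'
        rw [Real.norm_eq_abs]
        refine (h.abs_le s _ _).trans ?_
        rw [hD]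
        gcongr
    rw [abs_of_nonneg hr0] at e2
    exact (abs_le.1 e2).1
  have h7 := mul_le_mul_of_nonneg_left hsum.1 hK0
  linarith

/-- A function without upward jumps whose right upper Dini derivative is nonpositive. -/
theorem le_of_dini {ψ : ℝ → ℝ} (hT : 0 < T)
    (hjump : ∀ η > 0, ∃ δ > 0, ∀ t ∈ Icc 0 T, ∀ t' ∈ Icc t T, t' - t < δ → ψ t' ≤ ψ t + η)
    (hdini : ∀ t ∈ Ioo 0 T, ∀ᶠ r in 𝓝[>] (0 : ℝ), ψ (t + r) ≤ ψ t) : ψ T ≤ ψ 0 := by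
  -- The Dini condition concerns interior times only. From an interior `t₀` the set where `ψ ≤ ψ t₀`
  -- contains its supremum because there are no upward jumps, and the Dini condition forbids a
  -- supremum below `T`. The start `t₀` is moved to `0` afterwards.
  have key : ∀ t₀ ∈ Ioo 0 T, ψ T ≤ ψ t₀ := by
    intro t₀ ht₀
    set S := {t | t ∈ Icc t₀ T ∧ ψ t ≤ ψ t₀} with hS
    have hne : S.Nonempty := ⟨t₀, ⟨le_rfl, ht₀.2.le⟩, le_rfl⟩
    have hbdd : BddAbove S := ⟨T, fun t ht => ht.1.2⟩
    set c := sSup S with hc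
    have hct : t₀ ≤ c := le_csSup hbdd ⟨⟨le_rfl, ht₀.2.le⟩, le_rfl⟩
    have hcT : c ≤ T := csSup_le hne fun t ht => ht.1.2
    have hcS : ψ c ≤ ψ t₀ := by
      refine le_of_forall_pos_le_add fun η hη => ?_
      obtain ⟨δ, hδ, hh⟩ := hjump η hη
      obtain ⟨t, htS, htc⟩ := exists_lt_of_lt_csSup hne (sub_lt_self c hδ)
      have := hh t ⟨ht₀.1.le.trans htS.1.1, htS.1.2⟩ c ⟨le_csSup hbdd htS, hcT⟩ (by linarith)
      exact this.trans (add_le_add_left htS.2 η)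
    rcases hcT.eq_or_lt with h | h
    · rwa [← h]
    · have hc' : c ∈ Ioo 0 T := ⟨ht₀.1.trans_le hct, h⟩
      obtain ⟨r, hr, hr'⟩ := ((hdini c hc').and (Ioo_mem_nhdsGT (sub_pos.2 h))).exists
      have : c + r ≤ c := le_csSup hbdd ⟨⟨by linarith [hr'.1], by linarith [hr'.2]⟩, hr.trans hcS⟩
      linarith [hr'.1]
  refine le_of_forall_pos_le_add fun η hη => ?_
  obtain ⟨δ, hδ, hh⟩ := hjump η hη
  have hm : 0 < min δ T := lt_min hδ hT
  have m1 := min_le_left δ T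
  have m2 := min_le_right δ T
  refine (key (min δ T / 2) ⟨by positivity, by linarith⟩).trans ?_
  exact hh 0 ⟨le_rfl, hT.le⟩ (min δ T / 2) ⟨by positivity, by linarith⟩ (by linarith)

/-- Verification: curves driven by the feedback of the value function are optimal. -/
theorem cost_le_epsValue (h : IsLag ℓ Lx Lv M C) (hG : IsTerm G Gx M C) (hε : 0 < ε)
    (hT : 0 < T) {X V : ℝ → Eu d} (hX : ContinuousOn X (Icc 0 T))
    (hV : ContinuousOn V (Icc 0 T))
    (hflow : ∀ t ∈ Ioo 0 T, HasDerivAt X (V t) t ∧ ∃ q, HasDerivAt V q t ∧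
      HasFDerivAt (epsValue ℓ G ε t T (X t)) (innerSL ℝ (-(ε • q))) (V t)) :
    (∫ s in (0 : ℝ)..T, ℓ s (X s) (V s)) + G (X T) ≤ epsValue ℓ G ε 0 T (X 0) (V 0) := by
  have hc : ContinuousOn (fun s => ℓ s (X s) (V s)) (Icc 0 T) :=
    h.cont.comp_continuousOn (continuousOn_id.prodMk (hX.prodMk hV))
  have hi : ∀ a ∈ Icc 0 T, ∀ b ∈ Icc 0 T,
      IntervalIntegrable (fun s => ℓ s (X s) (V s)) volume a b := fun a ha b hb =>
    (hc.mono (uIcc_subset_Icc ha hb)).intervalIntegrable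
  have h0 : (0 : ℝ) ∈ Icc 0 T := ⟨le_rfl, hT.le⟩
  obtain ⟨D, hD⟩ := isCompact_Icc.exists_bound_of_continuousOn hc
  have hD0 : 0 ≤ D := (norm_nonneg _).trans (hD 0 h0)
  have hend : G (X T) ≤ epsValue ℓ G ε T T (X T) (V T) := by
    refine le_csInf ⟨_, fun _ => 0, l2loc_zero, rfl⟩ ?_
    rintro r ⟨a, ha, rfl⟩
    simp [epsAction, action]
  -- The slope `η` makes room for the two errors `η / 2 * r`, one from the value and one from the
  -- running cost, in the Dini inequality.
  suffices hs : ∀ η > 0, epsValue ℓ G ε T T (X T) (V T) +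
      (∫ s in (0 : ℝ)..T, ℓ s (X s) (V s)) - η * T ≤ epsValue ℓ G ε 0 T (X 0) (V 0) by
    refine le_of_forall_pos_le_add fun η hη => ?_
    have := hs (η / T) (by positivity)
    rw [div_mul_cancel₀ _ hT.ne'] at this
    linarith
  intro η hη
  have key := le_of_dini (ψ := fun t => epsValue ℓ G ε t T (X t) (V t) +
      (∫ s in (0 : ℝ)..t, ℓ s (X s) (V s)) - η * t) hT (fun η' hη' => ?_) (fun t ht => ?_)
  · simpa using key
  · obtain ⟨δ, hδ, hh⟩ := epsValue_forward_modulus h hG hε hT.le hX hV (half_pos hη')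
    refine ⟨min δ (η' / (2 * (D + 1))), lt_min hδ (by positivity), fun t ht t' ht' hlt => ?_⟩
    obtain ⟨l1, l2⟩ := lt_min_iff.1 hlt
    have ht'' : t' ∈ Icc 0 T := ⟨ht.1.trans ht'.1, ht'.2⟩
    have e1 := hh t ht t' ht' l1
    have e2 := intervalIntegral.norm_integral_le_of_norm_le_const (a := t) (b := t')
      (f := fun s => ℓ s (X s) (V s)) (C := D) fun s hs => by
        rw [uIoc_of_le ht'.1] at hs
        exact hD s ⟨ht.1.trans hs.1.le, hs.2.trans ht'.2⟩
    have hr0 : 0 ≤ t' - t := sub_nonneg.2 ht'.1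
    rw [abs_of_nonneg hr0, Real.norm_eq_abs] at e2
    have e3 : D * (t' - t) ≤ η' / 2 := by
      calc D * (t' - t) ≤ (D + 1) * (η' / (2 * (D + 1))) := by gcongr; linarith
        _ = η' / 2 := by field_simp
    have e4 := le_abs_self (∫ s in t..t', ℓ s (X s) (V s))
    have e5 := intervalIntegral.integral_add_adjacent_intervals (hi 0 h0 t ht) (hi t ht t' ht'')
    have e6 : η * t ≤ η * t' := by have := ht'.1; gcongr
    linarith
  · obtain ⟨hXd, q, hVd, hd⟩ := hflow t ht
    have ht' : t ∈ Icc 0 T := Ioo_subset_Icc_self ht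
    have hcat : ContinuousAt (fun s => ℓ s (X s) (V s)) t :=
      hc.continuousAt (Icc_mem_nhds ht.1 ht.2)
    obtain ⟨δ, hδ, hh⟩ := Metric.continuousAt_iff.1 hcat (η / 2) (half_pos hη)
    filter_upwards [eventually_epsValue_le h hG hε ht hXd hVd hd (half_pos hη),
      Ioo_mem_nhdsGT (lt_min hδ (sub_pos.2 ht.2))] with r hr hr'
    obtain ⟨l1, l2⟩ := lt_min_iff.1 hr'.2
    have htr : t + r ∈ Icc 0 T := ⟨by linarith [ht.1, hr'.1], by linarith⟩
    have e5 := intervalIntegral.integral_add_adjacent_intervals (hi 0 h0 t ht')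
      (hi t ht' (t + r) htr)
    have e6 : ∫ s in t..t + r, ℓ s (X s) (V s) ≤ r * (ℓ t (X t) (V t) + η / 2) := by
      have e : ∫ s in t..t + r, (ℓ t (X t) (V t) + η / 2) = r * (ℓ t (X t) (V t) + η / 2) := by
        rw [intervalIntegral.integral_const, add_sub_cancel_left, smul_eq_mul]
      rw [← e]
      refine intervalIntegral.integral_mono_on (by linarith [hr'.1]) (hi t ht' (t + r) htr)
        intervalIntegrable_const fun s hs => ?_
      have := hh (x := s) (by
        rw [Real.dist_eq, abs_of_nonneg (sub_nonneg.2 hs.1)]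
        linarith [hs.2])
      rw [Real.dist_eq] at this
      linarith [(abs_lt.1 this).2]
    linarith

end MFG

/-! ### From the data of the problem to abstract Lagrangians. -/

namespace MFG

section Taylor
variable {Z : Type*} [NormedAddCommGroup Z] [NormedSpace ℝ Z]

/-- Taylor's formula of order two with integral remainder. -/
theorem taylor_two {F : Z → ℝ} (hF : ContDiff ℝ 2 F) (z h : Z) :
    F (z + h) - F z - fderiv ℝ F z h =
      ∫ r in (0 : ℝ)..1, (1 - r) * fderiv ℝ (fderiv ℝ F) (z + r • h) h h := by
  have hF1 : ContDiff ℝ 1 (fderiv ℝ F) := hF.fderiv_right (by norm_num)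
  have hline : ∀ r : ℝ, HasDerivAt (fun r : ℝ => z + r • h) h r := fun r => by
    simpa using ((hasDerivAt_id r).smul_const h).const_add z
  have h1 : ∀ r : ℝ, HasDerivAt (fun r : ℝ => F (z + r • h)) (fderiv ℝ F (z + r • h) h) r :=
    fun r => ((hF.differentiable (by norm_num)) _).hasFDerivAt.comp_hasDerivAt r (hline r)
  have h2 : ∀ r : ℝ, HasDerivAt (fun r : ℝ => fderiv ℝ F (z + r • h) h)
      (fderiv ℝ (fderiv ℝ F) (z + r • h) h h) r := fun r => by
    have := ((hF1.differentiable one_ne_zero) (z + r • h)).hasFDerivAt.comp_hasDerivAt r (hline r)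
    simpa using this.clm_apply (hasDerivAt_const r h)
  have hcl : Continuous fun r : ℝ => z + r • h := by fun_prop
  have c1 : Continuous fun r : ℝ => fderiv ℝ F (z + r • h) h :=
    ((hF.continuous_fderiv (by norm_num)).comp hcl).clm_apply continuous_const
  have c2 : Continuous fun r : ℝ => fderiv ℝ (fderiv ℝ F) (z + r • h) h h :=
    (((hF1.continuous_fderiv one_ne_zero).comp hcl).clm_apply continuous_const).clm_apply
      continuous_const
  have key := intervalIntegral.integral_mul_deriv_eq_deriv_mul (a := 0) (b := 1)
    (u := fun r : ℝ => 1 - r) (u' := fun _ => -1)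
    (v := fun r : ℝ => fderiv ℝ F (z + r • h) h)
    (v' := fun r : ℝ => fderiv ℝ (fderiv ℝ F) (z + r • h) h h)
    (fun r _ => by simpa using (hasDerivAt_id r).const_sub 1) (fun r _ => h2 r)
    intervalIntegrable_const (c2.intervalIntegrable _ _)
  have key2 := intervalIntegral.integral_eq_sub_of_hasDerivAt (a := 0) (b := 1)
    (fun r _ => h1 r) (c1.intervalIntegrable _ _)
  rw [key, intervalIntegral.integral_const_mul, key2]
  simp
  ring

/-- The derivative depends continuously on a parameter if the function and its second derivative
do. -/
theorem continuous_fderiv_param {X : Type*} [TopologicalSpace X] [FiniteDimensional ℝ Z]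
    {F : X → Z → ℝ} (hF : Continuous fun p : X × Z => F p.1 p.2) (hF2 : ∀ s, ContDiff ℝ 2 (F s))
    (hc : Continuous fun p : X × Z => fderiv ℝ (fderiv ℝ (F p.1)) p.2) :
    Continuous fun p : X × Z => fderiv ℝ (F p.1) p.2 := by
  rw [continuous_clm_apply]
  intro h
  -- Joint continuity is known for the function and its Hessian but not for the gradient; Taylor's
  -- formula expresses the gradient by those two.
  have e : (fun p : X × Z => fderiv ℝ (F p.1) p.2 h) = fun p => F p.1 (p.2 + h) - F p.1 p.2 -
      ∫ r in (0 : ℝ)..1, (1 - r) * fderiv ℝ (fderiv ℝ (F p.1)) (p.2 + r • h) h h := by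
    funext p
    rw [← taylor_two (hF2 p.1)]
    ring
  rw [e]
  refine ((hF.comp (continuous_fst.prodMk (continuous_snd.add continuous_const))).sub hF).sub ?_
  refine intervalIntegral.continuous_parametric_intervalIntegral_of_continuous' ?_ 0 1
  have hp : Continuous fun a : (X × Z) × ℝ => (a.1.1, a.1.2 + a.2 • h) :=
    (continuous_fst.comp continuous_fst).prodMk
      ((continuous_snd.comp continuous_fst).add (continuous_snd.smul continuous_const))
  have h2 : Continuous fun a : (X × Z) × ℝ => fderiv ℝ (fderiv ℝ (F a.1.1)) (a.1.2 + a.2 • h) :=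
    hc.comp hp
  exact (continuous_const.sub continuous_snd).mul
    ((h2.clm_apply continuous_const).clm_apply continuous_const)

theorem continuous_norm_bilin {X : Type*} [TopologicalSpace X] {B : X → Z →L[ℝ] Z →L[ℝ] ℝ}
    (hB : Continuous B) : Continuous fun p => ‖B p‖ :=
  (continuous_norm (E := Z →L[ℝ] Z →L[ℝ] ℝ)).comp hB

end Taylor

variable {d : ℕ} {T M₀ : ℝ} {L : Eu d → Eu d → P1 (Eu d) → ℝ} {g : Eu d → P1 (Eu d) → ℝ}

/-- The flow of measures, extended to all times by its values at the endpoints. -/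
noncomputable def extendFlow {X : Type*} [MetricSpace X] [MeasurableSpace X] (T : ℝ)
    (m : ℝ → P1 X) (s : ℝ) : P1 X :=
  m (max 0 (min T s))

theorem clamp_mem (hT : 0 ≤ T) (s : ℝ) : max 0 (min T s) ∈ Icc 0 T :=
  ⟨le_max_left _ _, max_le hT (min_le_left _ _)⟩

theorem clamp_eq {s : ℝ} (hs : s ∈ Icc 0 T) : max 0 (min T s) = s := by
  rw [min_eq_right hs.2, max_eq_right hs.1]

/-- The Lagrangian along a flow of measures. -/
noncomputable def lagAlong {d : ℕ} (L : Eu d → Eu d → P1 (Eu d) → ℝ) (T : ℝ) (m : ℝ → P1 (Eu d))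
    (s : ℝ) (x v : Eu d) : ℝ :=
  L x v (extendFlow T m s)

noncomputable def gradXAlong {d : ℕ} (L : Eu d → Eu d → P1 (Eu d) → ℝ) (T : ℝ)
    (m : ℝ → P1 (Eu d)) (s : ℝ) (x v : Eu d) : Eu d :=
  gradient (fun y => L y v (extendFlow T m s)) x

noncomputable def gradVAlong {d : ℕ} (L : Eu d → Eu d → P1 (Eu d) → ℝ) (T : ℝ)
    (m : ℝ → P1 (Eu d)) (s : ℝ) (x v : Eu d) : Eu d :=
  gradient (fun w => L x w (extendFlow T m s)) v

theorem extendFlow_eq {X : Type*} [MetricSpace X] [MeasurableSpace X] {m : ℝ → P1 X} {s : ℝ}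
    (hs : s ∈ Icc 0 T) : extendFlow T m s = m s := by
  rw [extendFlow, clamp_eq hs]

theorem tendsto_extendFlow {X : Type*} [MetricSpace X] [MeasurableSpace X] {m : ℝ → P1 X}
    (hT : 0 ≤ T) (hm : IsContinuousFlow T m) {s : ℕ → ℝ} {s' : ℝ}
    (hs : Tendsto s atTop (𝓝 s')) :
    Tendsto (fun n => d1 (extendFlow T m (s n)) (extendFlow T m s')) atTop (𝓝 0) := by
  have hc : Continuous fun r : ℝ => max 0 (min T r) := by fun_prop
  refine (hm _ (clamp_mem hT s')).comp (tendsto_nhdsWithin_iff.2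
    ⟨(hc.tendsto s').comp hs, Eventually.of_forall fun n => clamp_mem hT (s n)⟩)

theorem inner_gradient_eq {f : Eu d → ℝ} (x w : Eu d) :
    inner ℝ (gradient f x) w = fderiv ℝ f x w := by
  rw [gradient, InnerProductSpace.toDual_symm_apply]

namespace LagrangianAssumptions
variable {m : ℝ → P1 (Eu d)}

theorem continuous_lagAlong (hL : LagrangianAssumptions L M₀) (hT : 0 ≤ T)
    (hm : IsContinuousFlow T m) :
    Continuous fun p : ℝ × Eu d × Eu d => lagAlong L T m p.1 p.2.1 p.2.2 := by
  refine continuous_iff_seqContinuous.2 fun p p' hp => ?_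
  have h1 := (continuous_fst.tendsto p').comp hp
  have h2 := ((continuous_fst.comp continuous_snd).tendsto p').comp hp
  have h3 := ((continuous_snd.comp continuous_snd).tendsto p').comp hp
  exact hL.cont _ _ _ _ _ _ h2 h3 (tendsto_extendFlow hT hm h1)

theorem continuous_hess (hL : LagrangianAssumptions L M₀) (hT : 0 ≤ T)
    (hm : IsContinuousFlow T m) :
    Continuous fun p : ℝ × (Eu d × Eu d) =>
      fderiv ℝ (fderiv ℝ fun z : Eu d × Eu d => lagAlong L T m p.1 z.1 z.2) p.2 := by
  refine continuous_iff_seqContinuous.2 fun p p' hp => ?_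
  have h1 := (continuous_fst.tendsto p').comp hp
  have h2 := (continuous_snd.tendsto p').comp hp
  exact hL.cont_hess _ _ _ _ h2 (tendsto_extendFlow hT hm h1)

theorem continuous_fderiv (hL : LagrangianAssumptions L M₀) (hT : 0 ≤ T)
    (hm : IsContinuousFlow T m) :
    Continuous fun p : ℝ × (Eu d × Eu d) =>
      fderiv ℝ (fun z : Eu d × Eu d => lagAlong L T m p.1 z.1 z.2) p.2 :=
  continuous_fderiv_param (F := fun s (z : Eu d × Eu d) => lagAlong L T m s z.1 z.2)
    (hL.continuous_lagAlong hT hm) (fun _ => hL.smooth _) (hL.continuous_hess hT hm)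

theorem hasFDerivAt_lagAlong (hL : LagrangianAssumptions L M₀) (T : ℝ) (m : ℝ → P1 (Eu d))
    (s : ℝ) (z : Eu d × Eu d) :
    HasFDerivAt (fun z : Eu d × Eu d => lagAlong L T m s z.1 z.2)
      (fderiv ℝ (fun z : Eu d × Eu d => lagAlong L T m s z.1 z.2) z) z :=
  ((hL.smooth (extendFlow T m s)).differentiable (by norm_num) z).hasFDerivAt

theorem gradXAlong_eq (hL : LagrangianAssumptions L M₀) (T : ℝ) (m : ℝ → P1 (Eu d))
    (s : ℝ) (x v : Eu d) :
    gradXAlong L T m s x v = (InnerProductSpace.toDual ℝ (Eu d)).symm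
      ((fderiv ℝ (fun z : Eu d × Eu d => lagAlong L T m s z.1 z.2) (x, v)).comp
        (ContinuousLinearMap.inl ℝ (Eu d) (Eu d))) := by
  have h1 := HasFDerivAt.comp (g := fun z : Eu d × Eu d => lagAlong L T m s z.1 z.2)
    (f := fun y => (y, v)) x (hL.hasFDerivAt_lagAlong T m s (x, v))
    (hasFDerivAt_prodMk_left x v)
  rw [gradXAlong, gradient, ← h1.fderiv]
  rfl

theorem gradVAlong_eq (hL : LagrangianAssumptions L M₀) (T : ℝ) (m : ℝ → P1 (Eu d))
    (s : ℝ) (x v : Eu d) :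
    gradVAlong L T m s x v = (InnerProductSpace.toDual ℝ (Eu d)).symm
      ((fderiv ℝ (fun z : Eu d × Eu d => lagAlong L T m s z.1 z.2) (x, v)).comp
        (ContinuousLinearMap.inr ℝ (Eu d) (Eu d))) := by
  have h1 := HasFDerivAt.comp (g := fun z : Eu d × Eu d => lagAlong L T m s z.1 z.2)
    (f := fun w => (x, w)) v (hL.hasFDerivAt_lagAlong T m s (x, v))
    (hasFDerivAt_prodMk_right x v)
  rw [gradVAlong, gradient, ← h1.fderiv]
  rfl

/-- Taylor's formula with the lower bound of the Hessian. The factor `1/2` is the integral of the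
weight `1 - r`. -/
theorem convex_ineq (hL : LagrangianAssumptions L M₀) (x v w : Eu d) (ν : P1 (Eu d)) :
    L x v ν + inner ℝ (gradient (fun w => L x w ν) v) (w - v) + 1 / (2 * M₀) * ‖w - v‖ ^ 2 ≤
      L x w ν := by
  have hF : ContDiff ℝ 2 fun w => L x w ν :=
    (hL.smooth ν).comp (contDiff_const.prodMk contDiff_id)
  have h1 := taylor_two hF v (w - v)
  have hF1 : ContDiff ℝ 1 (fderiv ℝ fun w => L x w ν) := hF.fderiv_right (by norm_num)
  have c2 : Continuous fun r : ℝ =>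
      (1 - r) * fderiv ℝ (fderiv ℝ fun w => L x w ν) (v + r • (w - v)) (w - v) (w - v) :=
    (by fun_prop : Continuous fun r : ℝ => 1 - r).mul
      ((((hF1.continuous_fderiv one_ne_zero).comp (by fun_prop :
      Continuous fun r : ℝ => v + r • (w - v))).clm_apply continuous_const).clm_apply
      continuous_const)
  have h2 : ∫ r in (0 : ℝ)..1, (1 - r) * (1 / M₀ * ‖w - v‖ ^ 2) ≤ ∫ r in (0 : ℝ)..1,
      (1 - r) * fderiv ℝ (fderiv ℝ fun w => L x w ν) (v + r • (w - v)) (w - v) (w - v) := by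
    refine intervalIntegral.integral_mono_on zero_le_one
      (Continuous.intervalIntegrable (by fun_prop) _ _) (c2.intervalIntegrable _ _)
      fun r hr => ?_
    exact mul_le_mul_of_nonneg_left (hL.convex x _ ν _) (sub_nonneg.2 hr.2)
  have h3 : ∫ r in (0 : ℝ)..1, (1 - r) * (1 / M₀ * ‖w - v‖ ^ 2) = 1 / (2 * M₀) * ‖w - v‖ ^ 2 := by
    rw [intervalIntegral.integral_mul_const, intervalIntegral.integral_sub
      intervalIntegrable_const (continuous_id'.intervalIntegrable _ _), integral_id]
    have := hL.M₀_pos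
    simp
    field_simp
    norm_num
  rw [h3, ← h1, add_sub_cancel] at h2
  rw [inner_gradient_eq]
  linarith

/-- Along a continuous flow of measures the Lagrangian satisfies the abstract assumptions. -/
theorem isLag (hL : LagrangianAssumptions L M₀) (hT : 0 ≤ T) (hm : IsContinuousFlow T m) {C : ℝ}
    (hC : ∀ s ∈ Icc 0 T, |L 0 0 (m s)| ≤ C) :
    IsLag (lagAlong L T m) (gradXAlong L T m) (gradVAlong L T m) M₀ C where
  M_pos := hL.M₀_pos
  cont := hL.continuous_lagAlong hT hm
  cont_x := by
    simp_rw [hL.gradXAlong_eq]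
    exact (InnerProductSpace.toDual ℝ (Eu d)).symm.continuous.comp
      ((hL.continuous_fderiv hT hm).clm_comp continuous_const)
  cont_v := by
    simp_rw [hL.gradVAlong_eq]
    exact (InnerProductSpace.toDual ℝ (Eu d)).symm.continuous.comp
      ((hL.continuous_fderiv hT hm).clm_comp continuous_const)
  hasFDerivAt s x v := by
    refine (hL.hasFDerivAt_lagAlong T m s (x, v)).congr_fderiv ?_
    refine ContinuousLinearMap.ext fun z => ?_
    rw [hL.gradXAlong_eq, hL.gradVAlong_eq]
    simp only [add_apply, ContinuousLinearMap.comp_apply,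
      innerSL_apply_apply, InnerProductSpace.toDual_symm_apply, ContinuousLinearMap.inl_apply,
      ContinuousLinearMap.inr_apply, ContinuousLinearMap.coe_fst', ContinuousLinearMap.coe_snd']
    rw [← map_add]
    simp
  bound_x s x v := hL.grad_x x v _
  bound_v s x v := hL.grad_v x v _
  convex s x v w := hL.convex_ineq x v w _
  lip R := by
    have hn : Continuous fun p : ℝ × (Eu d × Eu d) =>
        ‖fderiv ℝ (fderiv ℝ fun z : Eu d × Eu d => lagAlong L T m p.1 z.1 z.2) p.2‖ :=
      continuous_norm_bilin (hL.continuous_hess hT hm)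
    obtain ⟨K, hK⟩ := (isCompact_Icc.prod
      (isCompact_closedBall (0 : Eu d × Eu d) R)).exists_bound_of_continuousOn
        (hn.continuousOn (s := Icc 0 T ×ˢ Metric.closedBall 0 R))
    -- The clamped time ranges over the compact interval `[0,T]`, so the bound of the Hessian there
    -- holds for all real times.
    have hK' : ∀ s, ∀ z ∈ Metric.closedBall (0 : Eu d × Eu d) R,
        ‖fderiv ℝ (fderiv ℝ fun z : Eu d × Eu d => lagAlong L T m s z.1 z.2) z‖ ≤ max K 0 := by
      intro s z hz
      have := (le_abs_self _).trans (hK (max 0 (min T s), z) ⟨clamp_mem hT s, hz⟩)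
      simp only [lagAlong, extendFlow, clamp_eq (clamp_mem hT s)] at this
      exact this.trans (le_max_left _ _)
    have key : ∀ s x v x' v', ‖x‖ ≤ R → ‖v‖ ≤ R → ‖x'‖ ≤ R → ‖v'‖ ≤ R →
        ‖fderiv ℝ (fun z : Eu d × Eu d => lagAlong L T m s z.1 z.2) (x, v) -
          fderiv ℝ (fun z : Eu d × Eu d => lagAlong L T m s z.1 z.2) (x', v')‖ ≤
          max K 0 * (‖x - x'‖ + ‖v - v'‖) := by
      intro s x v x' v' hx hv hx' hv'
      have hd : ContDiff ℝ 1 (fderiv ℝ fun z : Eu d × Eu d => lagAlong L T m s z.1 z.2) :=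
        (hL.smooth (extendFlow T m s)).fderiv_right (by norm_num)
      refine (Convex.norm_image_sub_le_of_norm_fderiv_le (𝕜 := ℝ)
        (fun z _ => hd.differentiable one_ne_zero z) (hK' s) (convex_closedBall _ _)
        (mem_closedBall_zero_iff.2 (by simp [Prod.norm_def, hx', hv']))
        (mem_closedBall_zero_iff.2 (by simp [Prod.norm_def, hx, hv]))).trans ?_
      refine mul_le_mul_of_nonneg_left ?_ (le_max_right _ _)
      rw [Prod.mk_sub_mk, Prod.norm_mk]
      exact max_le (le_add_of_nonneg_right (norm_nonneg _))
        (le_add_of_nonneg_left (norm_nonneg _))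
    refine ⟨max K 0, le_max_right _ _, fun s x v x' v' hx hv hx' hv' => ⟨?_, ?_⟩⟩
    · rw [hL.gradXAlong_eq, hL.gradXAlong_eq, ← map_sub, LinearIsometryEquiv.norm_map,
        ← ContinuousLinearMap.sub_comp]
      refine (ContinuousLinearMap.opNorm_comp_le _ _).trans ?_
      refine (mul_le_of_le_one_right (norm_nonneg _)
        (ContinuousLinearMap.norm_inl_le_one ℝ (Eu d) (Eu d))).trans
        (key s x v x' v' hx hv hx' hv')
    · rw [hL.gradVAlong_eq, hL.gradVAlong_eq, ← map_sub, LinearIsometryEquiv.norm_map,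
        ← ContinuousLinearMap.sub_comp]
      refine (ContinuousLinearMap.opNorm_comp_le _ _).trans ?_
      refine (mul_le_of_le_one_right (norm_nonneg _)
        (ContinuousLinearMap.norm_inr_le_one ℝ (Eu d) (Eu d))).trans
        (key s x v x' v' hx hv hx' hv')
  zero s := hC _ (clamp_mem hT s)

end LagrangianAssumptions

theorem TerminalAssumptions.isTerm (hg : TerminalAssumptions g M₀) (ν : P1 (Eu d)) {C : ℝ}
    (hC : |g 0 ν| ≤ C) :
    IsTerm (fun x => g x ν) (fun x => gradient (fun y => g y ν) x) M₀ C where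
  hasFDerivAt x := by
    have h1 := ((hg.smooth ν).differentiable one_ne_zero x).hasFDerivAt
    refine h1.congr_fderiv ?_
    ext w
    rw [innerSL_apply_apply, inner_gradient_eq]
  bound x := by
    have := hg.grad_le x ν
    linarith
  zero := hC

/-! ### The Wasserstein distance: transport plans and test functions. -/

section Wasserstein
variable {X : Type*} [MetricSpace X] [MeasurableSpace X]

theorem d1_nonneg (μ ν : P1 X) : 0 ≤ d1 μ ν := by
  refine Real.sInf_nonneg ?_
  rintro _ ⟨π, -, rfl⟩
  exact integral_nonneg fun _ => dist_nonneg

theorem plans_nonempty (μ ν : P1 X) : (Plans μ.1 ν.1).Nonempty := by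
  have := μ.2.1
  have := ν.2.1
  exact ⟨μ.1.prod ν.1, by simp, by simp⟩

theorem exists_plan_lt (μ ν : P1 X) {η : ℝ} (hη : 0 < η) :
    ∃ π ∈ Plans μ.1 ν.1, ∫ z, dist z.1 z.2 ∂π < d1 μ ν + η := by
  obtain ⟨_, ⟨π, hπ, rfl⟩, h⟩ := exists_lt_of_csInf_lt ((plans_nonempty μ ν).image
    fun π : Measure (X × X) => ∫ z, dist z.1 z.2 ∂π) (lt_add_of_pos_right (sInf _) hη)
  exact ⟨π, hπ, h⟩

theorem d1_le_of_plan {μ ν : P1 X} {π : Measure (X × X)} (hπ : π ∈ Plans μ.1 ν.1) :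
    d1 μ ν ≤ ∫ z, dist z.1 z.2 ∂π :=
  csInf_le ⟨0, by rintro _ ⟨π, -, rfl⟩; exact integral_nonneg fun _ => dist_nonneg⟩ ⟨π, hπ, rfl⟩

/-- The triangle inequality and the finite first moments of the marginals. It ensures that the
transport cost of a plan is never the default value `0` of a divergent integral. -/
theorem integrable_dist_plan [BorelSpace X] [SecondCountableTopology X] {μ ν : P1 X}
    {π : Measure (X × X)} (hπ : π ∈ Plans μ.1 ν.1) : Integrable (fun z => dist z.1 z.2) π := by
  have := μ.2.1
  have : IsProbabilityMeasure π := by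
    refine ⟨?_⟩
    have := congrArg (fun μ => μ univ) hπ.1
    simpa [Measure.map_apply measurable_fst MeasurableSet.univ] using this
  obtain ⟨z₀⟩ : Nonempty X := μ.1.nonempty_of_neZero
  have h1 : Integrable (fun z : X × X => dist z.1 z₀) π := by
    have := μ.2.2 z₀
    rw [← hπ.1] at this
    exact (integrable_map_measure this.1 measurable_fst.aemeasurable).1 this
  have h2 : Integrable (fun z : X × X => dist z.2 z₀) π := by
    have := ν.2.2 z₀
    rw [← hπ.2] at this
    exact (integrable_map_measure this.1 measurable_snd.aemeasurable).1 this
  refine (h1.add h2).mono' (measurable_fst.dist measurable_snd).aestronglyMeasurable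
    (Eventually.of_forall fun z => ?_)
  rw [Real.norm_of_nonneg dist_nonneg]
  exact dist_triangle_right _ _ _

/-- Kantorovich-Rubinstein: bounded Lipschitz test functions. -/
theorem abs_integral_sub_le_d1 [BorelSpace X] [SecondCountableTopology X] (μ ν : P1 X)
    (f : BoundedContinuousFunction X ℝ) {K : ℝ}
    (hf : ∀ x y, |f x - f y| ≤ K * dist x y) (hK : 0 ≤ K) :
    |∫ x, f x ∂μ.1 - ∫ x, f x ∂ν.1| ≤ K * d1 μ ν := by
  have := μ.2.1
  have := ν.2.1
  refine le_of_forall_pos_le_add fun η hη => ?_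
  obtain ⟨π, hπ, hlt⟩ := exists_plan_lt μ ν (by positivity : 0 < η / (K + 1))
  have i1 : Integrable (fun z : X × X => f z.1) π := by
    have := f.integrable μ.1
    rw [← hπ.1] at this
    exact (integrable_map_measure this.1 measurable_fst.aemeasurable).1 this
  have i2 : Integrable (fun z : X × X => f z.2) π := by
    have := f.integrable ν.1
    rw [← hπ.2] at this
    exact (integrable_map_measure this.1 measurable_snd.aemeasurable).1 this
  have e1 : ∫ x, f x ∂μ.1 = ∫ z, f z.1 ∂π := by
    rw [← hπ.1, integral_map measurable_fst.aemeasurable f.continuous.aestronglyMeasurable]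
  have e2 : ∫ x, f x ∂ν.1 = ∫ z, f z.2 ∂π := by
    rw [← hπ.2, integral_map measurable_snd.aemeasurable f.continuous.aestronglyMeasurable]
  rw [e1, e2, ← integral_sub i1 i2]
  have h1 : |∫ z, (f z.1 - f z.2) ∂π| ≤ ∫ z, K * dist z.1 z.2 ∂π := by
    rw [← Real.norm_eq_abs]
    exact norm_integral_le_of_norm_le (f := fun z : X × X => f z.1 - f z.2)
      ((integrable_dist_plan hπ).const_mul K) (Eventually.of_forall fun z => hf z.1 z.2)
  rw [integral_const_mul] at h1
  refine h1.trans ?_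
  have h2 : K * ∫ z, dist z.1 z.2 ∂π ≤ K * (d1 μ ν + η / (K + 1)) := by gcongr
  have h3 : K * (η / (K + 1)) ≤ η := by
    calc K * (η / (K + 1)) ≤ (K + 1) * (η / (K + 1)) := by gcongr; linarith
      _ = η := by field_simp
  linarith

/-- A plan is projected to the positions; the projection is `1`-Lipschitz for the maximum distance
of the product. -/
theorem d1_fst_le (μ ν : P1 (Eu d × Eu d)) : d1 μ.fst ν.fst ≤ d1 μ ν := by
  refine le_of_forall_pos_le_add fun η hη => ?_
  obtain ⟨π, hπ, hlt⟩ := exists_plan_lt μ ν hη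
  have hm : Measurable (Prod.map Prod.fst Prod.fst :
      (Eu d × Eu d) × (Eu d × Eu d) → Eu d × Eu d) := measurable_fst.prodMap measurable_fst
  have hπ' : π.map (Prod.map Prod.fst Prod.fst) ∈ Plans μ.fst.1 ν.fst.1 := by
    constructor
    · rw [Measure.map_map measurable_fst hm]
      change π.map (Prod.fst ∘ Prod.fst) = μ.1.map Prod.fst
      rw [← hπ.1, Measure.map_map measurable_fst measurable_fst]
    · rw [Measure.map_map measurable_snd hm]
      change π.map (Prod.fst ∘ Prod.snd) = ν.1.map Prod.fst
      rw [← hπ.2, Measure.map_map measurable_fst measurable_snd]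
  refine (d1_le_of_plan hπ').trans (le_trans ?_ hlt.le)
  rw [integral_map hm.aemeasurable
    (measurable_fst.dist measurable_snd).aestronglyMeasurable]
  refine integral_mono_of_nonneg (Eventually.of_forall fun _ => dist_nonneg)
    (integrable_dist_plan hπ) (Eventually.of_forall fun z => ?_)
  exact le_max_left _ _

theorem IsContinuousFlow.fst {μ : ℝ → P1 (Eu d × Eu d)} (hμ : IsContinuousFlow T μ) :
    IsContinuousFlow T fun s => (μ s).fst := fun t ht =>
  squeeze_zero (fun _ => d1_nonneg _ _) (fun _ => d1_fst_le _ _) (hμ t ht)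

end Wasserstein
end MFG

/-! ### Curves of the statement and actions of velocities. -/

namespace MFG
variable {d : ℕ} {T M₀ C t ε : ℝ} {L : Eu d → Eu d → P1 (Eu d) → ℝ} {g : Eu d → P1 (Eu d) → ℝ}
  {m : ℝ → P1 (Eu d)} {x v : Eu d} {γ σ w a : ℝ → Eu d}

/-- A bound for the data along a flow of measures. -/
structure IsBoundAlong (L : Eu d → Eu d → P1 (Eu d) → ℝ) (g : Eu d → P1 (Eu d) → ℝ) (T : ℝ)
    (m : ℝ → P1 (Eu d)) (C : ℝ) : Prop where
  lag : ∀ s ∈ Icc 0 T, |L 0 0 (m s)| ≤ C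
  term : |g 0 (m T)| ≤ C

theorem uIcc_subset_of_mem {a b : ℝ} (ha : a ∈ Icc 0 T) (hb : b ∈ Icc 0 T) :
    uIcc a b ⊆ Icc 0 T :=
  uIcc_subset_Icc ha hb

theorem limitCost_eq_action (ht : t ∈ Icc 0 T) (hv : ∀ s ∈ Icc 0 T, vel T γ s = w s)
    (hγ : ∀ s ∈ Icc 0 T, γ s = σ s) :
    limitCost L g T m t γ = action (lagAlong L T m) (fun y => g y (m T)) t T σ w := by
  have hT : T ∈ Icc 0 T := ⟨ht.1.trans ht.2, le_rfl⟩
  rw [limitCost, action, hγ T hT]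
  congr 1
  refine intervalIntegral.integral_congr fun s hs => ?_
  have hs' := uIcc_subset_of_mem ht hT hs
  simp only [lagAlong, extendFlow_eq hs', hv s hs', hγ s hs']

theorem limitCost_path (hT : 0 < T) (ht : t ∈ Icc 0 T) (hw : Continuous w) :
    limitCost L g T m t (path t x w) =
      action (lagAlong L T m) (fun y => g y (m T)) t T (path t x w) w :=
  limitCost_eq_action ht (fun _ hs => vel_path hT hw hs) fun _ _ => rfl

theorem limitValue_eq_value (hT : 0 < T) (ht : t ∈ Icc 0 T) :
    limitValue L g T m t = value (lagAlong L T m) (fun y => g y (m T)) t T := by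
  funext x
  rw [limitValue, value]
  congr 1
  ext r
  constructor
  · rintro ⟨γ, hγ, rfl⟩
    obtain ⟨w, hw, hv, he⟩ := exists_velocity hT ht hγ
    exact ⟨w, hw, limitCost_eq_action ht hv he⟩
  · rintro ⟨w, hw, rfl⟩
    exact ⟨_, path_mem_Curves hw, limitCost_path hT ht hw⟩

theorem isMinimizer_path (h : IsLag (lagAlong L T m) (gradXAlong L T m) (gradVAlong L T m) M₀ C)
    {Gx : Eu d → Eu d} (hG : IsTerm (fun y => g y (m T)) Gx M₀ C) (hT : 0 < T)
    (ht : t ∈ Icc 0 T) (hw : Continuous w)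
    (hmin : action (lagAlong L T m) (fun y => g y (m T)) t T (path t x w) w =
      value (lagAlong L T m) (fun y => g y (m T)) t T x) :
    IsMinimizer L g T m t x (path t x w) := by
  refine ⟨path_mem_Curves hw, fun σ hσ => ?_⟩
  obtain ⟨w', hw', hv, he⟩ := exists_velocity hT ht hσ
  change limitCost L g T m t (path t x w) ≤ limitCost L g T m t σ
  rw [limitCost_path hT ht hw, limitCost_eq_action ht hv he, hmin]
  exact value_le_of_continuous h hG ht x hw'

theorem IsMinimizer.exists_velocity (hT : 0 < T) (ht : t ∈ Icc 0 T)
    (h : IsMinimizer L g T m t x σ) :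
    ∃ w, Continuous w ∧ (∀ s ∈ Icc 0 T, σ s = path t x w s) ∧
      action (lagAlong L T m) (fun y => g y (m T)) t T (path t x w) w =
        value (lagAlong L T m) (fun y => g y (m T)) t T x := by
  obtain ⟨w, hw, hv, he⟩ := MFG.exists_velocity hT ht h.1
  refine ⟨w, hw, he, ?_⟩
  have hl : IsLeast {r | ∃ w, Continuous w ∧ r = action (lagAlong L T m) (fun y => g y (m T)) t T
      (path t x w) w} (action (lagAlong L T m) (fun y => g y (m T)) t T (path t x w) w) := by
    refine ⟨⟨w, hw, rfl⟩, ?_⟩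
    rintro r ⟨w', hw', rfl⟩
    rw [← limitCost_path hT ht hw', ← limitCost_eq_action ht hv he]
    exact h.2 (path_mem_Curves hw')
  exact hl.csInf_eq.symm

theorem L2loc.of_memLp (ha : MemLp a 2 volume) : L2loc a :=
  ⟨ha.1, ((memLp_two_iff_integrable_sq_norm ha.1).1 ha).locallyIntegrable⟩

/-- An `H²` curve is recovered from its position and velocity at time `t` by integrating its second
derivative twice. That derivative is extended by zero outside `[0,T]`; conversely each control
generates an admissible curve on all of `[0,T]`. -/
theorem epsCosts_eq (h : IsLag (lagAlong L T m) (gradXAlong L T m) (gradVAlong L T m) M₀ C)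
    (hT : 0 < T) (ht : t ∈ Icc 0 T) :
    epsCosts L g T ε m t x v =
      {r | ∃ a, L2loc a ∧ r = epsAction (lagAlong L T m) (fun y => g y (m T)) ε t T x v a} := by
  have h0 : (0 : ℝ) ∈ Icc 0 T := ⟨le_rfl, hT.le⟩
  have hTT : T ∈ Icc 0 T := ⟨hT.le, le_rfl⟩
  have split : ∀ a, L2loc a → (∫ s in t..T, (ε / 2 * ‖a s‖ ^ 2 +
      lagAlong L T m s (path t x (path t v a) s) (path t v a s))) +
      g (path t x (path t v a) T) (m T) =
      epsAction (lagAlong L T m) (fun y => g y (m T)) ε t T x v a := by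
    intro a ha
    have hc := ha.continuous_path t v
    rw [intervalIntegral.integral_add ((ha.intervalIntegrable_sq t T).const_mul _)
      (h.intervalIntegrable ((L2loc.of_continuous hc).continuous_path t x) (.of_continuous hc) t T),
      intervalIntegral.integral_const_mul, epsAction, action]
    ring
  ext r
  constructor
  · rintro ⟨γ, hγ, a, hv, ha, rfl⟩
    obtain ⟨w, hw, hvw, he⟩ := exists_velocity hT ht hγ
    have ha' : L2loc ((Icc 0 T).indicator a) :=
      .of_memLp ((memLp_indicator_iff_restrict measurableSet_Icc).2 ha.1)
    have hI : ∀ s ∈ Icc 0 T, ∫ r in (0 : ℝ)..s, a r = ∫ r in (0 : ℝ)..s, (Icc 0 T).indicator a r :=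
      fun s hs => intervalIntegral.integral_congr fun r hr =>
        (indicator_of_mem (uIcc_subset_of_mem h0 hs hr) a).symm
    have hww : ∀ s ∈ Icc 0 T, w s = path t v ((Icc 0 T).indicator a) s := by
      intro s hs
      have e := ha'.path_sub 0 (vel T γ 0) t s
      simp only [path] at e ⊢
      rw [← hI s hs, ← hI t ht, ← ha.2 s hs, ← ha.2 t ht, hv, hvw s hs] at e
      rw [← e]
      abel
    have hγγ : ∀ s ∈ Icc 0 T, γ s = path t x (path t v ((Icc 0 T).indicator a)) s := by
      intro s hs
      rw [he s hs]
      simp only [path]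
      congr 1
      refine intervalIntegral.integral_congr fun r hr => ?_
      exact hww r (uIcc_subset_of_mem ht hs hr)
    refine ⟨(Icc 0 T).indicator a, ha', ?_⟩
    rw [← split _ ha', hγγ T hTT]
    congr 1
    refine intervalIntegral.integral_congr fun s hs => ?_
    have hs' := uIcc_subset_of_mem ht hTT hs
    simp only [lagAlong, extendFlow_eq hs', indicator_of_mem hs', ← hww s hs', ← hγγ s hs',
      hvw s hs']
  · rintro ⟨a, ha, rfl⟩
    have hc := ha.continuous_path t v
    have hvel : ∀ s ∈ Icc 0 T, vel T (path t x (path t v a)) s = path t v a s :=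
      fun s hs => vel_path hT hc hs
    refine ⟨path t x (path t v a), path_mem_Curves hc, a, ?_, ⟨?_, fun s hs => ?_⟩, ?_⟩
    · rw [hvel t ht, path_self]
    · rw [memLp_two_iff_integrable_sq_norm ha.1.restrict]
      exact ha.2.integrableOn_isCompact isCompact_Icc
    · rw [hvel s hs, hvel 0 h0, ← ha.path_sub t v 0 s]
      abel
    · rw [← split a ha]
      congr 1
      refine intervalIntegral.integral_congr fun s hs => ?_
      have hs' := uIcc_subset_of_mem ht hTT hs
      simp only [lagAlong, extendFlow_eq hs', hvel s hs']

/-- Along the characteristics of a solution the cost without acceleration is bounded by the value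
function. -/
theorem exists_velocity_le_epsValue
    (h : IsLag (lagAlong L T m) (gradXAlong L T m) (gradVAlong L T m) M₀ C)
    {Gx : Eu d → Eu d} (hG : IsTerm (fun y => g y (m T)) Gx M₀ C) (hT : 0 < T) (hε : 0 < ε)
    {u : ℝ → Eu d → Eu d → ℝ}
    (hu : ∀ t ∈ Icc 0 T, ∀ x v, u t x v = sInf (epsCosts L g T ε m t x v))
    {X V : ℝ → Eu d} (hX : ContinuousOn X (Icc 0 T)) (hV : ContinuousOn V (Icc 0 T))
    (hflow : ∀ t ∈ Ioo 0 T, HasDerivAt X (V t) t ∧ DifferentiableAt ℝ (u t (X t)) (V t) ∧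
      HasDerivAt V (-(1 / ε) • gradient (u t (X t)) (V t)) t) :
    ∃ w, Continuous w ∧ (∀ s ∈ Icc 0 T, X s = path 0 (X 0) w s) ∧
      action (lagAlong L T m) (fun y => g y (m T)) 0 T (path 0 (X 0) w) w ≤
        epsValue (lagAlong L T m) (fun y => g y (m T)) ε 0 T (X 0) (V 0) := by
  have hu' : ∀ t ∈ Icc 0 T, ∀ x, u t x =
      epsValue (lagAlong L T m) (fun y => g y (m T)) ε t T x := by
    intro t ht x
    funext v
    rw [hu t ht, epsCosts_eq h hT ht, epsValue]
  have key := cost_le_epsValue h hG hε hT hX hV fun t ht => by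
    obtain ⟨h1, h2, h3⟩ := hflow t ht
    refine ⟨h1, _, h3, ?_⟩
    rw [← hu' t (Ioo_subset_Icc_self ht) (X t)]
    refine h2.hasFDerivAt.congr_fderiv ?_
    ext z
    rw [smul_smul, innerSL_apply_apply, ← inner_gradient_eq, ← neg_smul]
    field_simp
    simp
  have hwc : Continuous (IccExtend hT.le ((Icc 0 T).domRestrict V)) :=
    (continuousOn_iff_continuous_domRestrict.1 hV).Icc_extend'
  have hwV : ∀ s ∈ Icc 0 T, IccExtend hT.le ((Icc 0 T).domRestrict V) s = V s := fun s hs => by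
    rw [IccExtend_of_mem _ _ hs]; rfl
  have hXp : ∀ s ∈ Icc 0 T, X s = path 0 (X 0) (IccExtend hT.le ((Icc 0 T).domRestrict V)) s := by
    intro s hs
    have := intervalIntegral.integral_eq_sub_of_hasDerivAt_of_le hs.1
      (hX.mono (Icc_subset_Icc_right hs.2))
      (f' := IccExtend hT.le ((Icc 0 T).domRestrict V)) (fun r hr => by
        have hr' : r ∈ Ioo 0 T := ⟨hr.1, hr.2.trans_le hs.2⟩
        rw [hwV r (Ioo_subset_Icc_self hr')]
        exact (hflow r hr').1) (hwc.intervalIntegrable _ _)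
    rw [path, this]
    abel
  refine ⟨_, hwc, hXp, le_trans (le_of_eq ?_) key⟩
  rw [action, ← hXp T ⟨hT.le, le_rfl⟩]
  congr 1
  refine intervalIntegral.integral_congr fun s hs => ?_
  have hs' := uIcc_subset_of_mem ⟨le_rfl, hT.le⟩ ⟨hT.le, le_rfl⟩ hs
  simp only [hwV s hs', ← hXp s hs']

end MFG

/-! ### Passage to the limit of vanishing acceleration cost. -/

namespace MFG
variable {d : ℕ} {T M₀ C R η t : ℝ} {L : Eu d → Eu d → P1 (Eu d) → ℝ} {g : Eu d → P1 (Eu d) → ℝ}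
  {m : ℝ → P1 (Eu d)} {mk : ℕ → ℝ → P1 (Eu d)} {x v : Eu d} {γ σ w a : ℝ → Eu d}

theorem exists_isBoundAlong (hL : LagrangianAssumptions L M₀) (g : Eu d → P1 (Eu d) → ℝ)
    (hT : 0 ≤ T) (hm : IsContinuousFlow T m) : ∃ C, IsBoundAlong L g T m C := by
  have hc : Continuous fun s : ℝ => lagAlong L T m s 0 0 :=
    (hL.continuous_lagAlong hT hm).comp (f := fun s : ℝ => (s, (0 : Eu d), (0 : Eu d)))
      (continuous_id.prodMk continuous_const)
  obtain ⟨C, hC⟩ := isCompact_Icc.exists_bound_of_continuousOn (hc.continuousOn (s := Icc 0 T))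
  refine ⟨max C |g 0 (m T)|, fun s hs => ?_, le_max_right _ _⟩
  have := hC s hs
  rw [lagAlong, extendFlow_eq hs] at this
  exact this.trans (le_max_left _ _)

theorem IsBoundAlong.isLag (h : IsBoundAlong L g T m C) (hL : LagrangianAssumptions L M₀)
    (hT : 0 ≤ T) (hm : IsContinuousFlow T m) :
    IsLag (lagAlong L T m) (gradXAlong L T m) (gradVAlong L T m) M₀ C :=
  hL.isLag hT hm h.lag

theorem IsBoundAlong.isTerm (h : IsBoundAlong L g T m C) (hg : TerminalAssumptions g M₀) :
    IsTerm (fun y => g y (m T)) (fun y => gradient (fun z => g z (m T)) y) M₀ C :=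
  hg.isTerm (m T) h.term

/-- The modulus in the measure involves only `‖x‖`. Uniformity in the velocity is essential, since
the velocities of the characteristics have no uniform pointwise bound. -/
theorem eventually_lag_close (hL : LagrangianAssumptions L M₀) (hlim : FlowTendsto T mk m)
    (hR : 0 ≤ R) (hη : 0 < η) :
    ∀ᶠ k in atTop, ∀ s ∈ Icc 0 T, ∀ x v, ‖x‖ ≤ R → |L x v (mk k s) - L x v (m s)| ≤ η := by
  obtain ⟨θ, ϖ, hθ, hθm, hϖ, -, hϖ0, hmod⟩ := hL.modulus
  have hθR := hθ R hR
  have h1 : ∀ᶠ r in 𝓝[≥] (0 : ℝ), ϖ r < η / (θ R + 1) :=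
    hϖ0.eventually (gt_mem_nhds (by positivity))
  obtain ⟨δ, hδ, hδ'⟩ := mem_nhdsGE_iff_exists_Ico_subset.1 h1
  filter_upwards [hlim δ hδ] with k hk s hs x v hx
  have h2 : ϖ (d1 (mk k s) (m s)) < η / (θ R + 1) := hδ' ⟨d1_nonneg _ _, hk s hs⟩
  refine (hmod x v _ _).trans ?_
  have h3 : θ ‖x‖ ≤ θ R := hθm (norm_nonneg x) hR hx
  calc θ ‖x‖ * ϖ (d1 (mk k s) (m s)) ≤ θ R * (η / (θ R + 1)) :=
        mul_le_mul h3 h2.le (hϖ _ (d1_nonneg _ _)) hθR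
    _ ≤ (θ R + 1) * (η / (θ R + 1)) := by gcongr; linarith
    _ = η := by field_simp

theorem TerminalAssumptions.lipschitz (hg : TerminalAssumptions g M₀) (ν : P1 (Eu d))
    (x y : Eu d) : |g y ν - g x ν| ≤ 2 * M₀ * ‖y - x‖ :=
  (hg.isTerm ν le_rfl).lipschitz x y

/-- Continuity of `g x` in the measure is not assumed uniform in `x`. It is used at the points of a
finite net, and the common Lipschitz constant `2 * M₀` in `x` covers the rest of the ball. -/
theorem eventually_term_close (hg : TerminalAssumptions g M₀) (hT : 0 ≤ T)
    (hlim : FlowTendsto T mk m) (R : ℝ) (hη : 0 < η) :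
    ∀ᶠ k in atTop, ∀ x, ‖x‖ ≤ R → |g x (mk k T) - g x (m T)| ≤ η := by
  have hM : 0 < M₀ := lt_of_lt_of_le (by norm_num) hg.half_le
  obtain ⟨S, hS, hcov⟩ := Metric.totallyBounded_iff.1
    (isCompact_closedBall (0 : Eu d) R).totallyBounded (η / (8 * M₀)) (by positivity)
  have h1 : ∀ᶠ k in atTop, ∀ y ∈ S, |g y (mk k T) - g y (m T)| ≤ η / 2 := by
    refine (eventually_all_finite hS).2 fun y _ => ?_
    obtain ⟨δ, hδ, h⟩ := hg.uc_measure y (η / 2) (by positivity)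
    filter_upwards [hlim δ hδ] with k hk
    exact (h _ _ (hk T ⟨hT, le_rfl⟩)).le
  filter_upwards [h1] with k hk x hx
  obtain ⟨y, hy, hxy⟩ := mem_iUnion₂.1 (hcov (mem_closedBall_zero_iff.2 hx))
  have hxy' : ‖x - y‖ < η / (8 * M₀) := by rwa [← dist_eq_norm]
  have h2 := abs_le.1 (hg.lipschitz (mk k T) y x)
  have h3 := abs_le.1 (hg.lipschitz (m T) y x)
  have h4 := abs_le.1 (hk y hy)
  have h5 : 2 * M₀ * ‖x - y‖ ≤ η / 4 := by
    calc 2 * M₀ * ‖x - y‖ ≤ 2 * M₀ * (η / (8 * M₀)) := by gcongr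
      _ = η / 4 := by field_simp; norm_num
  rw [abs_le]
  constructor <;> linarith [h2.1, h2.2, h3.1, h3.2, h4.1, h4.2]

theorem eventually_isBoundAlong (hL : LagrangianAssumptions L M₀) (hg : TerminalAssumptions g M₀)
    (hT : 0 ≤ T) (hlim : FlowTendsto T mk m) (hC : IsBoundAlong L g T m C) :
    ∀ᶠ k in atTop, IsBoundAlong L g T (mk k) (C + 1) := by
  filter_upwards [eventually_lag_close hL hlim le_rfl one_pos,
    eventually_term_close hg hT hlim 0 one_pos] with k h1 h2
  have key : ∀ {a b : ℝ}, |a - b| ≤ 1 → |b| ≤ C → |a| ≤ C + 1 := fun {a b} h h' => by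
    have := abs_sub_abs_le_abs_sub a b
    linarith
  exact ⟨fun s hs => key (h1 s hs 0 0 (by simp)) (hC.lag s hs), key (h2 0 (by simp)) hC.term⟩

theorem eventually_action_close (hL : LagrangianAssumptions L M₀) (hg : TerminalAssumptions g M₀)
    (hT : 0 ≤ T) (hm : IsContinuousFlow T m) (hmk : ∀ k, IsContinuousFlow T (mk k))
    (hlim : FlowTendsto T mk m) (hR : 0 ≤ R) (hη : 0 < η) :
    ∀ᶠ k in atTop, ∀ γ w, Continuous γ → L2loc w → (∀ s ∈ Icc 0 T, ‖γ s‖ ≤ R) →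
      |action (lagAlong L T (mk k)) (fun y => g y (mk k T)) 0 T γ w -
        action (lagAlong L T m) (fun y => g y (m T)) 0 T γ w| ≤ η := by
  obtain ⟨C, hC⟩ := exists_isBoundAlong hL g hT hm
  filter_upwards [eventually_isBoundAlong hL hg hT hlim hC,
    eventually_lag_close hL hlim hR (by positivity : 0 < η / (2 * (T + 1))),
    eventually_term_close hg hT hlim R (half_pos hη)] with k hk h1 h2 γ w hγ hw hb
  have e : action (lagAlong L T (mk k)) (fun y => g y (mk k T)) 0 T γ w -
      action (lagAlong L T m) (fun y => g y (m T)) 0 T γ w =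
      (∫ s in (0 : ℝ)..T, (lagAlong L T (mk k) s (γ s) (w s) - lagAlong L T m s (γ s) (w s))) +
        (g (γ T) (mk k T) - g (γ T) (m T)) := by
    rw [action, action, intervalIntegral.integral_sub
      ((hk.isLag hL hT (hmk k)).intervalIntegrable hγ hw 0 T)
      ((hC.isLag hL hT hm).intervalIntegrable hγ hw 0 T)]
    ring
  have h3 : ‖∫ s in (0 : ℝ)..T, (lagAlong L T (mk k) s (γ s) (w s) -
      lagAlong L T m s (γ s) (w s))‖ ≤ η / (2 * (T + 1)) * |T - 0| := by
    refine intervalIntegral.norm_integral_le_of_norm_le_const fun s hs => ?_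
    rw [uIoc_of_le hT] at hs
    have hs' : s ∈ Icc 0 T := ⟨hs.1.le, hs.2⟩
    simp only [lagAlong, extendFlow_eq hs', Real.norm_eq_abs]
    exact h1 s hs' _ _ (hb s hs')
  have h4 : η / (2 * (T + 1)) * |T - 0| ≤ η / 2 := by
    rw [sub_zero, abs_of_nonneg hT]
    calc η / (2 * (T + 1)) * T ≤ η / (2 * (T + 1)) * (T + 1) := by gcongr; linarith
      _ = η / 2 := by field_simp
  rw [e]
  refine (abs_add_le _ _).trans ?_
  have h5 := h2 (γ T) (hb T ⟨hT, le_rfl⟩)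
  rw [Real.norm_eq_abs] at h3
  linarith

theorem hasDerivAt_exp_neg_mul (n s : ℝ) :
    HasDerivAt (fun s => Real.exp (-(n * s))) (-n * Real.exp (-(n * s))) s := by
  have h1 : HasDerivAt (fun s : ℝ => -(n * s)) (-n) s := by
    simpa using ((hasDerivAt_id s).const_mul n).fun_neg
  exact h1.exp.congr_deriv (mul_comm _ _)

theorem integral_exp_neg_le {n : ℝ} (hn : 0 < n) (T : ℝ) :
    ∫ s in (0 : ℝ)..T, Real.exp (-(n * s)) ≤ 1 / n := by
  have h1 : ∀ s ∈ uIcc 0 T, HasDerivAt (fun s => -(1 / n) * Real.exp (-(n * s)))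
      (Real.exp (-(n * s))) s := fun s _ => by
    refine ((hasDerivAt_exp_neg_mul n s).const_mul (-(1 / n))).congr_deriv ?_
    field_simp
  rw [intervalIntegral.integral_eq_sub_of_hasDerivAt h1
    (Continuous.intervalIntegrable (by fun_prop) _ _)]
  have := Real.exp_pos (-(n * T))
  have h2 : 0 < 1 / n := by positivity
  simp
  positivity

/-- Velocities with a prescribed initial value and a continuous derivative are dense. -/
theorem exists_smooth_velocity (hw : Continuous w) (hT : 0 ≤ T) (v : Eu d) {δ : ℝ} (hδ : 0 < δ) :
    ∃ a, Continuous a ∧ ∫ s in (0 : ℝ)..T, ‖path 0 v a s - w s‖ ^ 2 ≤ δ := by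
  set ρ := √(δ / (4 * (T + 1))) with hρ
  have hρ0 : 0 < ρ := Real.sqrt_pos.2 (by positivity)
  have hρ2 : ρ ^ 2 = δ / (4 * (T + 1)) := Real.sq_sqrt (by positivity)
  obtain ⟨w₁, hw₁, hclose, -⟩ := hw.exists_contDiff_approx 1 (ε := fun _ => ρ) continuous_const
    fun _ => hρ0
  -- A smooth approximation `w₁` has the wrong initial value, which the boundary layer `exp (-(n *
  -- s)) • c` corrects. The layer has squared `L²` norm at most `‖c‖ ^ 2 / n`, so `n` makes its
  -- contribution at most `δ / 2`; `ρ` does the same for the approximation.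
  set c := v - w₁ 0 with hc
  set n := 4 * ‖c‖ ^ 2 / δ + 1 with hn
  have hn0 : 0 < n := by positivity
  have hd : Continuous (deriv w₁) := hw₁.continuous_deriv (by norm_num)
  set a : ℝ → Eu d := fun s => deriv w₁ s + (-n * Real.exp (-(n * s))) • c with ha
  have hac : Continuous a := by fun_prop
  have hder : ∀ s, HasDerivAt (fun s => w₁ s + Real.exp (-(n * s)) • c) (a s) s := fun s => by
    have h1 : HasDerivAt w₁ (deriv w₁ s) s :=
      (hw₁.differentiable (by norm_num) s).hasDerivAt
    exact h1.add ((hasDerivAt_exp_neg_mul n s).smul_const c)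
  have hpath : ∀ s, path 0 v a s = w₁ s + Real.exp (-(n * s)) • c := fun s => by
    rw [path, intervalIntegral.integral_eq_sub_of_hasDerivAt (fun r _ => hder r)
      (hac.intervalIntegrable _ _)]
    simp [hc]
  refine ⟨a, hac, ?_⟩
  have hle : ∀ s ∈ Icc 0 T, ‖path 0 v a s - w s‖ ^ 2 ≤
      2 * ρ ^ 2 + 2 * ‖c‖ ^ 2 * Real.exp (-(n * s)) := by
    intro s hs
    have h1 : ‖w₁ s - w s‖ ≤ ρ := by rw [← dist_eq_norm]; exact (hclose s).le
    have h2 : path 0 v a s - w s = (w₁ s - w s) + Real.exp (-(n * s)) • c := by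
      rw [hpath]; abel
    have h3 : Real.exp (-(n * s)) ≤ 1 :=
      Real.exp_le_one_iff.2 (neg_nonpos.2 (mul_nonneg hn0.le hs.1))
    have h4 := Real.exp_pos (-(n * s))
    have h5 : ‖path 0 v a s - w s‖ ≤ ρ + Real.exp (-(n * s)) * ‖c‖ := by
      rw [h2]
      refine (norm_add_le _ _).trans (add_le_add h1 (le_of_eq ?_))
      rw [norm_smul, Real.norm_of_nonneg h4.le]
    calc ‖path 0 v a s - w s‖ ^ 2 ≤ (ρ + Real.exp (-(n * s)) * ‖c‖) ^ 2 := by gcongr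
      _ ≤ 2 * ρ ^ 2 + 2 * (Real.exp (-(n * s)) ^ 2 * ‖c‖ ^ 2) := by
        nlinarith [sq_nonneg (ρ - Real.exp (-(n * s)) * ‖c‖)]
      _ ≤ 2 * ρ ^ 2 + 2 * (Real.exp (-(n * s)) * ‖c‖ ^ 2) := by
        gcongr
        nlinarith
      _ = _ := by ring
  have hpc : Continuous (path 0 v a) := (L2loc.of_continuous hac).continuous_path 0 v
  have hexp : Continuous fun s : ℝ => Real.exp (-(n * s)) := by fun_prop
  have hb : Continuous fun s : ℝ => 2 * ‖c‖ ^ 2 * Real.exp (-(n * s)) := continuous_const.mul hexp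
  have hab : Continuous fun s : ℝ => 2 * ρ ^ 2 + 2 * ‖c‖ ^ 2 * Real.exp (-(n * s)) :=
    continuous_const.add hb
  refine (intervalIntegral.integral_mono_on hT
    (((hpc.sub hw).norm.pow 2).intervalIntegrable _ _)
    (hab.intervalIntegrable _ _) hle).trans ?_
  rw [intervalIntegral.integral_add intervalIntegrable_const
    (hb.intervalIntegrable _ _), intervalIntegral.integral_const,
    intervalIntegral.integral_const_mul, smul_eq_mul, sub_zero, hρ2]
  have h1 : T * (2 * (δ / (4 * (T + 1)))) ≤ δ / 2 := by
    calc T * (2 * (δ / (4 * (T + 1)))) ≤ (T + 1) * (2 * (δ / (4 * (T + 1)))) := by gcongr; linarith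
      _ = δ / 2 := by field_simp; norm_num
  have h2 : 2 * ‖c‖ ^ 2 * ∫ s in (0 : ℝ)..T, Real.exp (-(n * s)) ≤ δ / 2 := by
    calc _ ≤ 2 * ‖c‖ ^ 2 * (1 / n) := by gcongr; exact integral_exp_neg_le hn0 T
      _ = 2 * ‖c‖ ^ 2 / n := by ring
      _ ≤ δ / 2 := by
        rw [div_le_iff₀ hn0, hn]
        have : δ / 2 * (4 * ‖c‖ ^ 2 / δ + 1) = 2 * ‖c‖ ^ 2 + δ / 2 := by field_simp; norm_num
        rw [this]
        linarith
  linarith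

/-- One fixed continuous control, whose velocity starts from `v` and is nearly optimal for the limit
problem, is used for all `k`. Its acceleration cost tends to zero with `ε k`, and its action
converges with the flows of measures. The initial velocity thus leaves no trace in the limit. -/
theorem eventually_epsValue_le_value_add (hL : LagrangianAssumptions L M₀) (hg : TerminalAssumptions g M₀)
    (hT : 0 ≤ T) (hm : IsContinuousFlow T m) (hmk : ∀ k, IsContinuousFlow T (mk k))
    (hlim : FlowTendsto T mk m) {ε : ℕ → ℝ} (hε0 : ∀ k, 0 < ε k) (hε : Tendsto ε atTop (𝓝 0))
    (x v : Eu d) (hη : 0 < η) :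
    ∀ᶠ k in atTop, epsValue (lagAlong L T (mk k)) (fun y => g y (mk k T)) (ε k) 0 T x v ≤
      value (lagAlong L T m) (fun y => g y (m T)) 0 T x + η := by
  obtain ⟨C, hC⟩ := exists_isBoundAlong hL g hT hm
  have h := hC.isLag hL hT hm
  have hG := hC.isTerm hg
  obtain ⟨w, hw, hwlt⟩ := exists_action_lt (lagAlong L T m) (fun y => g y (m T)) 0 T x
    (by positivity : 0 < η / 4)
  choose a ha hal using fun n : ℕ => exists_smooth_velocity hw hT v
    (by positivity : (0 : ℝ) < 1 / (n + 1))
  have hpl : ∀ n, L2loc (path 0 v (a n)) := fun n => (L2loc.of_continuous (ha n)).path_path 0 v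
  have ht := h.tendsto_action hG hT (.of_continuous hw) hpl
    (squeeze_zero (fun n => intervalIntegral.integral_nonneg hT fun _ _ => sq_nonneg _) hal
      tendsto_one_div_add_atTop_nhds_zero_nat) x
  obtain ⟨n, hn⟩ := (ht.eventually (gt_mem_nhds (by linarith : _ <
    action (lagAlong L T m) (fun y => g y (m T)) 0 T (path 0 x w) w + η / 4))).exists
  have hpc := (hpl n).continuous_path 0 x
  obtain ⟨R, hR⟩ := isCompact_Icc.exists_bound_of_continuousOn (hpc.continuousOn (s := Icc 0 T))
  have hR0 : 0 ≤ R := (norm_nonneg _).trans (hR 0 ⟨le_rfl, hT⟩)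
  have hlim2 : Tendsto (fun k => ε k / 2 * ∫ s in (0 : ℝ)..T, ‖a n s‖ ^ 2) atTop (𝓝 0) := by
    simpa using (hε.div_const 2).mul_const (∫ s in (0 : ℝ)..T, ‖a n s‖ ^ 2)
  filter_upwards [eventually_isBoundAlong hL hg hT hlim hC,
    eventually_action_close hL hg hT hm hmk hlim hR0 (by positivity : 0 < η / 4),
    hlim2.eventually (gt_mem_nhds (by positivity : 0 < η / 4))] with k hk h1 h2
  refine (epsValue_le (hk.isLag hL hT (hmk k)) (hk.isTerm hg) (hε0 k).le ⟨le_rfl, hT⟩ x v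
    (.of_continuous (ha n))).trans ?_
  have h3 := (abs_le.1 (h1 _ _ hpc (hpl n) hR)).2
  rw [epsAction]
  linarith

/-- Curves with nearly optimal costs for the approximating flows form a minimizing sequence. -/
theorem tendsto_action_of_le (hL : LagrangianAssumptions L M₀) (hg : TerminalAssumptions g M₀)
    (hT : 0 ≤ T) (hm : IsContinuousFlow T m) (hmk : ∀ k, IsContinuousFlow T (mk k))
    (hlim : FlowTendsto T mk m) {wk : ℕ → ℝ → Eu d} (hwk : ∀ k, Continuous (wk k))
    (hle : ∀ η > 0, ∀ᶠ k in atTop,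
      action (lagAlong L T (mk k)) (fun y => g y (mk k T)) 0 T (path 0 x (wk k)) (wk k) ≤
        value (lagAlong L T m) (fun y => g y (m T)) 0 T x + η) :
    Tendsto (fun k => action (lagAlong L T m) (fun y => g y (m T)) 0 T (path 0 x (wk k)) (wk k))
      atTop (𝓝 (value (lagAlong L T m) (fun y => g y (m T)) 0 T x)) := by
  obtain ⟨C, hC⟩ := exists_isBoundAlong hL g hT hm
  have hC0 := (hC.isLag hL hT hm).C_nonneg
  have hM := hL.M₀_pos
  obtain ⟨K, hK0, hK⟩ := exists_coercive hM (by linarith : 0 ≤ C + 1) hT d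
  set V := value (lagAlong L T m) (fun y => g y (m T)) 0 T x with hV
  set A := max 0 (8 * M₀ * (V + 1 + K * (1 + ‖x‖))) with hA
  set R := ‖x‖ + (1 * A + (T - 0) / (4 * 1)) with hRdef
  have hA0 : 0 ≤ A := le_max_left _ _
  have hR0 : 0 ≤ R := by rw [hRdef, sub_zero]; positivity
  have hbound : ∀ᶠ k in atTop, ∀ s ∈ Icc 0 T, ‖path 0 x (wk k) s‖ ≤ R := by
    filter_upwards [eventually_isBoundAlong hL hg hT hlim hC, hle 1 one_pos] with k hk h1 s hs
    have hl : L2loc (wk k) := .of_continuous (hwk k)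
    have h2 := hK (hk.isLag hL hT (hmk k)) (hk.isTerm hg) 0 ⟨le_rfl, hT⟩ x (wk k) hl
    have h3 : (∫ s in (0 : ℝ)..T, ‖wk k s‖ ^ 2) ≤ A := by
      refine le_trans ?_ (le_max_right _ _)
      have h4 : 1 / (8 * M₀) * (∫ s in (0 : ℝ)..T, ‖wk k s‖ ^ 2) ≤ V + 1 + K * (1 + ‖x‖) := by
        linarith
      rwa [one_div, inv_mul_le_iff₀ (by positivity)] at h4
    refine (hl.norm_path_le x hs).trans (add_le_add_right ((hl.integral_norm_le hT one_pos).trans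
      (by linarith)) _)
  rw [Metric.tendsto_nhds]
  intro η hη
  filter_upwards [hbound, hle (η / 4) (by positivity),
    eventually_action_close hL hg hT hm hmk hlim hR0 (by positivity : 0 < η / 4)] with k h1 h2 h3
  have hl : L2loc (wk k) := .of_continuous (hwk k)
  have h4 := (abs_le.1 (h3 _ _ (hl.continuous_path 0 x) hl h1)).1
  have h5 := value_le_of_continuous (hC.isLag hL hT hm) (hC.isTerm hg) ⟨le_rfl, hT⟩ x (hwk k)
  rw [Real.dist_eq, abs_lt]
  constructor <;> linarith

section Lag
variable {ℓ : ℝ → Eu d → Eu d → ℝ} {Lx Lv : ℝ → Eu d → Eu d → Eu d} {M : ℝ} {G : Eu d → ℝ}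
  {Gx : Eu d → Eu d}

theorem exists_minimizer (h : IsLag ℓ Lx Lv M C) (hG : IsTerm G Gx M C) (hT : 0 ≤ T) (x : Eu d) :
    ∃ w, Continuous w ∧ action ℓ G 0 T (path 0 x w) w = value ℓ G 0 T x := by
  choose v hv hlt using fun n : ℕ => exists_action_lt ℓ G 0 T x
    (by positivity : (0 : ℝ) < 1 / (n + 1))
  have hlim : Tendsto (fun n => action ℓ G 0 T (path 0 x (v n)) (v n)) atTop
      (𝓝 (value ℓ G 0 T x)) := by
    refine tendsto_of_tendsto_of_tendsto_of_le_of_le tendsto_const_nhds ?_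
      (fun n => value_le_of_continuous h hG ⟨le_rfl, hT⟩ x (hv n)) fun n => (hlt n).le
    simpa using tendsto_const_nhds.add (tendsto_one_div_add_atTop_nhds_zero_nat (𝕜 := ℝ))
  obtain ⟨φ, -, w, hw, hmin, -⟩ := exists_l2_minimizer h hG hT x
    (fun n => .of_continuous (hv n)) hlim
  obtain ⟨w', hw', hmin', -⟩ := exists_continuous_minimizer h hG hT hw hmin
  exact ⟨w', hw', hmin'⟩

/-- Where the value function is differentiable, minimizing sequences converge. -/
theorem tendsto_path_of_minimizing (h : IsLag ℓ Lx Lv M C) (hG : IsTerm G Gx M C) (hT : 0 < T)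
    (hd : DifferentiableAt ℝ (value ℓ G 0 T) x) (hw : Continuous w)
    (hmin : action ℓ G 0 T (path 0 x w) w = value ℓ G 0 T x) {v : ℕ → ℝ → Eu d}
    (hv : ∀ n, L2loc (v n)) (hlim : Tendsto (fun n => action ℓ G 0 T (path 0 x (v n)) (v n)) atTop
      (𝓝 (value ℓ G 0 T x))) {s : ℝ} (hs : s ∈ Icc 0 T) :
    Tendsto (fun n => path 0 x (v n) s) atTop (𝓝 (path 0 x w s)) := by
  refine tendsto_of_subseq_tendsto fun φ hφ => ?_
  obtain ⟨ψ, -, w', hw', hmin', hconv⟩ := exists_l2_minimizer h hG hT.le x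
    (fun n => hv (φ n)) (hlim.comp hφ)
  obtain ⟨w'', hw'', hmin'', heq⟩ := exists_continuous_minimizer h hG hT.le hw' hmin'
  refine ⟨ψ, ?_⟩
  have e : path 0 x w s = path 0 x w' s := by
    rw [minimizer_unique h hG hT hd hw hw'' hmin hmin'' hs]
    exact heq s hs
  rw [e]
  exact hconv s hs

end Lag
end MFG

namespace MFG

/-! ### Limits of push-forwards and measurability of the limit map. -/

section Pushforward
variable {d : ℕ} {Ω : Type*} [MeasurableSpace Ω]

/-- Images of a measure under almost everywhere converging maps which converge in the Wasserstein
distance converge to the image under the limit map. -/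
theorem eq_map_of_tendsto {P : Measure Ω} [IsProbabilityMeasure P] {Y : ℕ → Ω → Eu d}
    {Z : Ω → Eu d} (hY : ∀ k, AEMeasurable (Y k) P)
    (hconv : ∀ᵐ z ∂P, Tendsto (fun k => Y k z) atTop (𝓝 (Z z))) {νk : ℕ → P1 (Eu d)} {ν : P1 (Eu d)}
    (hνk : ∀ k, (νk k).1 = P.map (Y k)) (hν : Tendsto (fun k => d1 (νk k) ν) atTop (𝓝 0)) :
    AEMeasurable Z P ∧ ν.1 = P.map Z := by
  have hZ : AEMeasurable Z P := aemeasurable_of_tendsto_metrizable_ae atTop hY hconv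
  refine ⟨hZ, ?_⟩
  have hP := Measure.isProbabilityMeasure_map hZ
  have hpk := fun k => (νk k).2.1
  have hp := ν.2.1
  set pk : ℕ → ProbabilityMeasure (Eu d) := fun k => ⟨(νk k).1, hpk k⟩
  set p : ProbabilityMeasure (Eu d) := ⟨ν.1, hp⟩
  set p' : ProbabilityMeasure (Eu d) := ⟨P.map Z, hP⟩
  -- The sequence has two weak limits, which must coincide: `ν` by the Kantorovich-Rubinstein bound
  -- on Lipschitz test functions, and the image under `Z` by dominated convergence.
  have h1 : Tendsto pk atTop (𝓝 p) := by
    refine tendsto_iff_forall_lipschitz_integral_tendsto.2 fun f hb hl => ?_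
    obtain ⟨K, hK⟩ := hl
    set F : BoundedContinuousFunction (Eu d) ℝ := ⟨⟨f, hK.continuous⟩, hb⟩ with hF
    rw [tendsto_iff_dist_tendsto_zero]
    refine squeeze_zero (fun _ => dist_nonneg) (fun k => ?_)
      (by simpa using hν.const_mul (K : ℝ))
    exact abs_integral_sub_le_d1 (νk k) ν F (fun x y => hK.dist_le_mul x y) K.2
  have h2 : Tendsto pk atTop (𝓝 p') := by
    refine ProbabilityMeasure.tendsto_iff_forall_integral_tendsto.2 fun f => ?_
    have e1 : ∀ k, ∫ x, f x ∂(νk k).1 = ∫ z, f (Y k z) ∂P := fun k => by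
      rw [hνk k, integral_map (hY k) f.continuous.aestronglyMeasurable]
    have e2 : ∫ x, f x ∂(P.map Z) = ∫ z, f (Z z) ∂P :=
      integral_map hZ f.continuous.aestronglyMeasurable
    change Tendsto (fun k => ∫ x, f x ∂(νk k).1) atTop (𝓝 (∫ x, f x ∂(P.map Z)))
    simp_rw [e1, e2]
    refine tendsto_integral_of_dominated_convergence (fun _ => ‖f‖)
      (fun k => (f.continuous.measurable.comp_aemeasurable (hY k)).aestronglyMeasurable)
      (integrable_const _) (fun k => Eventually.of_forall fun z => f.norm_coe_le_norm _) ?_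
    filter_upwards [hconv] with z hz
    exact (f.continuous.tendsto _).comp hz
  have h3 : p = p' := tendsto_nhds_unique h1 h2
  exact congrArg Subtype.val h3

open scoped ProbabilityTheory in
/-- A function of the first variable which is measurable for a measure on a product is measurable
for the first marginal. -/
theorem aemeasurable_of_comp_fst {d d' : ℕ} {P : Measure (Eu d × Eu d')} [IsProbabilityMeasure P]
    {f : Eu d → Eu d} (hf : AEMeasurable (fun z => f z.1) P) : AEMeasurable f (P.map Prod.fst) := by
  obtain ⟨F, hF, hFf⟩ := hf
  have h1 : ∀ᵐ z ∂(P.fst ⊗ₘ P.condKernel), f z.1 = F z := by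
    rw [P.disintegrate P.condKernel]
    exact hFf
  have h2 := Measure.ae_ae_of_ae_compProd h1
  -- Averaging the measurable representative over the conditional law of the second variable gives a
  -- measurable function of `x` alone, which equals `f x` because `F (x, ·)` is almost surely
  -- constant.
  have h3 : AEStronglyMeasurable (fun x => ∫ y, F (x, y) ∂P.condKernel x) P.fst :=
    hF.aestronglyMeasurable.integral_condKernel
  refine h3.aemeasurable.congr ?_
  filter_upwards [h2] with x hx
  rw [integral_congr_ae (g := fun _ => f x) (by filter_upwards [hx] with y hy; exact hy.symm)]
  simp

end Pushforward

/-! ### Legendre duality. -/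

section Hamiltonian
variable {d : ℕ} {M₀ : ℝ} {L : Eu d → Eu d → P1 (Eu d) → ℝ}

/-- The gradient of the Hamiltonian in the momentum is minus the optimal velocity. -/
theorem gradient_hamiltonian (hL : LagrangianAssumptions L M₀) (x v : Eu d) (ν : P1 (Eu d)) :
    gradient (fun p => hamiltonian L x p ν) (-gradient (fun w => L x w ν) v) = -v := by
  have hM := hL.M₀_pos
  set q := gradient (fun w => L x w ν) v with hq
  -- Uniform convexity and Young's inequality place the Hamiltonian between an affine function with
  -- slope `-v` and the same function plus `M₀ / 2 * ‖p + q‖ ^ 2`. This gives differentiability at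
  -- `-q` with no other regularity of the supremum.
  have hle : ∀ p w : Eu d, -inner ℝ p w - L x w ν ≤
      -inner ℝ p v - L x v ν + M₀ / 2 * ‖p + q‖ ^ 2 := by
    intro p w
    have h1 := hL.convex_ineq x v w ν
    have h2 : -(‖p + q‖ * ‖w - v‖) ≤ inner ℝ (p + q) (w - v) :=
      (abs_le.1 (abs_real_inner_le_norm (p + q) (w - v))).1
    have h3 : ‖p + q‖ * ‖w - v‖ ≤ 1 / (2 * M₀) * ‖w - v‖ ^ 2 + M₀ / 2 * ‖p + q‖ ^ 2 := by
      have : 1 / (2 * M₀) * ‖w - v‖ ^ 2 + M₀ / 2 * ‖p + q‖ ^ 2 - ‖p + q‖ * ‖w - v‖ =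
          1 / (2 * M₀) * (‖w - v‖ - M₀ * ‖p + q‖) ^ 2 := by
        field_simp
        ring
      have h4 : 0 ≤ 1 / (2 * M₀) * (‖w - v‖ - M₀ * ‖p + q‖) ^ 2 := by positivity
      linarith
    rw [← hq] at h1
    rw [inner_add_left, inner_sub_right] at h2
    linarith
  have hbdd : ∀ p, BddAbove (range fun w => -inner ℝ p w - L x w ν) := fun p =>
    ⟨_, by rintro _ ⟨w, rfl⟩; exact hle p w⟩
  have hlow : ∀ p, -inner ℝ p v - L x v ν ≤ hamiltonian L x p ν := fun p => le_ciSup (hbdd p) v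
  have hup : ∀ p, hamiltonian L x p ν ≤ -inner ℝ p v - L x v ν + M₀ / 2 * ‖p + q‖ ^ 2 := fun p =>
    ciSup_le (hle p)
  have heq : hamiltonian L x (-q) ν = -inner ℝ (-q) v - L x v ν :=
    le_antisymm (by simpa using hup (-q)) (hlow (-q))
  refine HasGradientAt.gradient ?_
  rw [hasGradientAt_iff_isLittleO]
  refine (Asymptotics.IsBigO.of_bound (M₀ / 2) (g := fun p : Eu d => ‖p - -q‖ ^ 2)
    (Eventually.of_forall fun p => ?_)).trans_isLittleO ?_
  · have e : inner ℝ (-v) (p - -q) = -inner ℝ p v + inner ℝ (-q) v := by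
      rw [inner_neg_left, inner_sub_right, real_inner_comm p, real_inner_comm (-q)]
      ring
    have h1 := hlow p
    have h2 := hup p
    rw [e, heq, sub_neg_eq_add, Real.norm_eq_abs, abs_of_nonneg (by linarith),
      Real.norm_of_nonneg (by positivity)]
    linarith
  · exact Asymptotics.isLittleO_pow_sub_sub (-q) one_lt_two

end Hamiltonian

/-! ### Test functions along a flow. -/

section Transport
variable {d : ℕ} {T B : ℝ} {P : Measure (Eu d)} {γ w : ℝ → Eu d → Eu d}

theorem intervalIntegrable_of_continuousOn_Ioo {f : ℝ → ℝ} {K : ℝ} (hT : 0 ≤ T)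
    (hf : ContinuousOn f (Ioo 0 T)) (hb : ∀ s ∈ Ioo 0 T, |f s| ≤ K) :
    IntervalIntegrable f volume 0 T := by
  rw [intervalIntegrable_iff_integrableOn_Ioo_of_le hT]
  exact Integrable.of_bound (hf.aestronglyMeasurable measurableSet_Ioo) K
    ((ae_restrict_iff' measurableSet_Ioo).2 (Eventually.of_forall hb))

/-- Continuity of the averages in time supplies the integrability in time, so joint measurability of
the flow in `(t, x)` is never needed. -/
theorem continuousOn_integral_Ioo [IsFiniteMeasure P] {F : ℝ → Eu d → ℝ} {K : ℝ} {S : Set ℝ}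
    (hm : ∀ s ∈ S, AEStronglyMeasurable (F s) P) (hc : ∀ x, Continuous fun s => F s x)
    (hb : ∀ᵐ x ∂P, ∀ s ∈ S, |F s x| ≤ K) : ContinuousOn (fun s => ∫ x, F s x ∂P) S := by
  refine continuousOn_of_dominated (bound := fun _ => K) hm (fun s hs => ?_) (integrable_const K)
    (Eventually.of_forall fun x => (hc x).continuousOn)
  filter_upwards [hb] with x hx
  exact hx s hs

/-- Test functions along a flow. -/
theorem integral_deriv_along_flow [IsFiniteMeasure P] (hT : 0 ≤ T)
    (hγ : ∀ x s, HasDerivAt (fun s => γ s x) (w s x) s) (hw : ∀ x, Continuous fun s => w s x)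
    (hγm : ∀ s ∈ Icc 0 T, AEMeasurable (γ s) P) (hwm : ∀ s ∈ Ioo 0 T, AEMeasurable (w s) P)
    (hB : ∀ᵐ x ∂P, ∀ s ∈ Icc 0 T, ‖w s x‖ ≤ B) {ψ : ℝ × Eu d → ℝ} (hψ : ContDiff ℝ ∞ ψ)
    (hψc : HasCompactSupport ψ) :
    IntervalIntegrable (fun s => ∫ x, fderiv ℝ ψ (s, γ s x) (1, w s x) ∂P) volume 0 T ∧
    ∫ s in (0 : ℝ)..T, ∫ x, fderiv ℝ ψ (s, γ s x) (1, w s x) ∂P =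
      (∫ x, ψ (T, γ T x) ∂P) - ∫ x, ψ (0, γ 0 x) ∂P := by
  have hγc : ∀ x, Continuous fun s => γ s x := fun x =>
    continuous_iff_continuousAt.2 fun s => (hγ x s).continuousAt
  have hd : Continuous (fderiv ℝ ψ) := hψ.continuous_fderiv (by simp)
  obtain ⟨K, hK⟩ := hψc.exists_bound_of_continuous hψ.continuous
  obtain ⟨K', hK'⟩ := (hψc.fderiv ℝ).exists_bound_of_continuous hd
  have hK'0 : 0 ≤ K' := (norm_nonneg _).trans (hK' 0)
  have hder : ∀ x s, HasDerivAt (fun s => ψ (s, γ s x)) (fderiv ℝ ψ (s, γ s x) (1, w s x)) s :=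
    fun x s => HasFDerivAt.comp_hasDerivAt s
      ((hψ.differentiable (by simp)) (s, γ s x)).hasFDerivAt ((hasDerivAt_id s).prodMk (hγ x s))
  have hcd : ∀ x, Continuous fun s => fderiv ℝ ψ (s, γ s x) (1, w s x) := fun x =>
    (hd.comp (continuous_id.prodMk (hγc x))).clm_apply (continuous_const.prodMk (hw x))
  have hm0 : ∀ s ∈ Icc 0 T, AEStronglyMeasurable (fun x => ψ (s, γ s x)) P := fun s hs =>
    (hψ.continuous.measurable.comp_aemeasurable
      (aemeasurable_const.prodMk (hγm s hs))).aestronglyMeasurable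
  have hm1 : ∀ s ∈ Ioo 0 T, AEStronglyMeasurable
      (fun x => fderiv ℝ ψ (s, γ s x) (1, w s x)) P := fun s hs => by
    have hcont : Continuous fun p : Eu d × Eu d => fderiv ℝ ψ (s, p.1) (1, p.2) :=
      (hd.comp (continuous_const.prodMk continuous_fst)).clm_apply
        (continuous_const.prodMk continuous_snd)
    exact (hcont.measurable.comp_aemeasurable
      ((hγm s (Ioo_subset_Icc_self hs)).prodMk (hwm s hs))).aestronglyMeasurable
  have hb1 : ∀ᵐ x ∂P, ∀ s ∈ Icc 0 T,
      |fderiv ℝ ψ (s, γ s x) (1, w s x)| ≤ K' * max 1 B := by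
    filter_upwards [hB] with x hx s hs
    refine ((fderiv ℝ ψ (s, γ s x)).le_opNorm _).trans ?_
    refine mul_le_mul (hK' _) ?_ (norm_nonneg _) hK'0
    rw [Prod.norm_mk, norm_one]
    exact max_le_max le_rfl (hx s hs)
  have hb1' : ∀ᵐ x ∂P, ∀ s ∈ Ioo 0 T,
      |fderiv ℝ ψ (s, γ s x) (1, w s x)| ≤ K' * max 1 B := by
    filter_upwards [hb1] with x hx s hs
    exact hx s (Ioo_subset_Icc_self hs)
  have hint : IntervalIntegrable (fun s => ∫ x, fderiv ℝ ψ (s, γ s x) (1, w s x) ∂P)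
      volume 0 T := by
    refine intervalIntegrable_of_continuousOn_Ioo (K := K' * max 1 B * P.real univ) hT
      (continuousOn_integral_Ioo hm1 hcd hb1') fun s hs => ?_
    refine norm_integral_le_of_norm_le_const (μ := P)
      (f := fun x => fderiv ℝ ψ (s, γ s x) (1, w s x)) ?_
    filter_upwards [hb1'] with x hx
    exact hx s hs
  refine ⟨hint, ?_⟩
  refine intervalIntegral.integral_eq_sub_of_hasDerivAt_of_le
    (f := fun s => ∫ x, ψ (s, γ s x) ∂P) hT ?_ (fun s hs => ?_) hint
  · exact continuousOn_integral_Ioo hm0 (fun x => hψ.continuous.comp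
      (continuous_id.prodMk (hγc x))) (Eventually.of_forall fun x s _ => hK _)
  · refine (hasDerivAt_integral_of_dominated_loc_of_deriv_le (Ioo_mem_nhds hs.1 hs.2)
      (F := fun s x => ψ (s, γ s x)) (F' := fun s x => fderiv ℝ ψ (s, γ s x) (1, w s x))
      (bound := fun _ => K' * max 1 B) ?_ ?_ (hm1 s hs) hb1' (integrable_const _)
      (Eventually.of_forall fun x r _ => hder x r)).2
    · filter_upwards [Ioo_mem_nhds hs.1 hs.2] with r hr
      exact hm0 r (Ioo_subset_Icc_self hr)
    · exact (integrable_const K).mono' (hm0 s (Ioo_subset_Icc_self hs))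
        (Eventually.of_forall fun x => hK _)

end Transport
end MFG

/-! ### Convergence of the characteristics, the limit vector field, and conclusion. -/

namespace MFG
variable {d : ℕ} {T M₀ C t : ℝ} {L : Eu d → Eu d → P1 (Eu d) → ℝ} {g : Eu d → P1 (Eu d) → ℝ}
  {m : ℝ → P1 (Eu d)} {x : Eu d} {w : ℝ → Eu d}

theorem InitialAssumptions.map_fst_absolutelyContinuous {μ₀ : Measure (Eu d × Eu d)}
    (hμ₀ : InitialAssumptions μ₀) : μ₀.map Prod.fst ≪ volume := by
  have h : Measure.QuasiMeasurePreserving (Prod.fst : Eu d × Eu d → Eu d)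
      (volume : Measure (Eu d × Eu d)) volume := Measure.quasiMeasurePreserving_fst
  exact (h.mono_left hμ₀.abs_cont).absolutelyContinuous

theorem InitialAssumptions.exists_bound_fst {μ₀ : Measure (Eu d × Eu d)}
    (hμ₀ : InitialAssumptions μ₀) : ∃ R, ∀ᵐ x ∂(μ₀.map Prod.fst), ‖x‖ ≤ R := by
  obtain ⟨K, hK, h0⟩ := hμ₀.compact_supp
  obtain ⟨R, hR⟩ := hK.isBounded.exists_norm_le
  refine ⟨R, (ae_map_iff measurable_fst.aemeasurable
    (measurableSet_le measurable_norm measurable_const)).2 ?_⟩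
  have h1 : ∀ᵐ z ∂μ₀, z ∈ K := h0
  filter_upwards [h1] with z hz
  exact (le_max_left _ _).trans (hR z hz)

/-- The characteristics of the systems with control of acceleration converge to the minimizers of
the limit problem. -/
theorem ae_tendsto_characteristics (hT : 0 < T) (hL : LagrangianAssumptions L M₀)
    (hg : TerminalAssumptions g M₀) {μ₀ : Measure (Eu d × Eu d)} (hμ₀ : InitialAssumptions μ₀)
    {u : ℕ → ℝ → Eu d → Eu d → ℝ} {μ : ℕ → ℝ → P1 (Eu d × Eu d)} {ε : ℕ → ℝ}
    (hsol : ∀ k, IsEpsSolution L g T μ₀ (ε k) (u k) (μ k))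
    (hε_pos : ∀ k, 0 < ε k) (hε : Tendsto ε atTop (𝓝 0)) (hm : IsContinuousFlow T m)
    (hlim : FlowTendsto T (fun k t => (μ k t).fst) m) {w : Eu d → ℝ → Eu d}
    (hw : ∀ x, Continuous (w x))
    (hmin : ∀ x, action (lagAlong L T m) (fun y => g y (m T)) 0 T (path 0 x (w x)) (w x) =
      value (lagAlong L T m) (fun y => g y (m T)) 0 T x) :
    ∃ X : ℕ → ℝ → Eu d × Eu d → Eu d,
      (∀ k, ∀ t ∈ Icc 0 T, AEMeasurable (X k t) μ₀ ∧ ((μ k t).fst).1 = μ₀.map (X k t)) ∧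
      ∀ᵐ z ∂μ₀, ∀ t ∈ Icc 0 T,
        Tendsto (fun k => X k t z) atTop (𝓝 (path 0 z.1 (w z.1) t)) := by
  choose X V hflow hmap using fun k => (hsol k).flow
  refine ⟨X, fun k t ht => ?_, ?_⟩
  · obtain ⟨h1, h2⟩ := hmap k t ht
    refine ⟨h1.fst, ?_⟩
    change (μ k t).1.map Prod.fst = _
    rw [h2, AEMeasurable.map_map_of_aemeasurable measurable_fst.aemeasurable h1]
    rfl
  have hmk : ∀ k, IsContinuousFlow T fun t => (μ k t).fst := fun k => (hsol k).cont.fst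
  obtain ⟨C, hC⟩ := exists_isBoundAlong hL g hT.le hm
  have h := hC.isLag hL hT.le hm
  have hG := hC.isTerm hg
  -- Absolute continuity of the initial law enters here: it turns the Lebesgue-null set of
  -- Rademacher's theorem into a null set of starting points.
  have hdiff : ∀ᵐ z ∂μ₀,
      DifferentiableAt ℝ (value (lagAlong L T m) (fun y => g y (m T)) 0 T) z.1 :=
    ae_of_ae_map measurable_fst.aemeasurable
      (hμ₀.map_fst_absolutelyContinuous.ae_le (ae_differentiableAt_value h hG hT.le))
  filter_upwards [hdiff, ae_all_iff.2 hflow] with z hd hz t ht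
  have key : ∀ k, ∃ v, Continuous v ∧ (∀ s ∈ Icc 0 T, X k s z = path 0 z.1 v s) ∧
      action (lagAlong L T fun t => (μ k t).fst) (fun y => g y (μ k T).fst) 0 T
        (path 0 z.1 v) v ≤
      epsValue (lagAlong L T fun t => (μ k t).fst) (fun y => g y (μ k T).fst) (ε k) 0 T
        z.1 z.2 := by
    intro k
    obtain ⟨h1, h2, h3, h4, h5⟩ := hz k
    obtain ⟨Ck, hCk⟩ := exists_isBoundAlong hL g hT.le (hmk k)
    obtain ⟨v, hv, hXv, hle⟩ := exists_velocity_le_epsValue (hCk.isLag hL hT.le (hmk k))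
      (hCk.isTerm hg) hT (hε_pos k) (hsol k).value h3 h4 h5
    simp only [h1, h2] at hXv hle
    exact ⟨v, hv, hXv, hle⟩
  choose v hv hXv hle using key
  simp_rw [hXv _ t ht]
  refine tendsto_path_of_minimizing h hG hT hd (hw _) (hmin _) (fun k => .of_continuous (hv k))
    (tendsto_action_of_le hL hg hT.le hm hmk hlim hv fun η hη => ?_) ht
  filter_upwards [eventually_epsValue_le_value_add hL hg hT.le hm hmk hlim hε_pos hε z.1 z.2 hη]
    with k hk
  exact (hle k).trans hk

/-- The momentum coincides with the costate, a primitive of the position gradient. Hence it is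
differentiable in time although the Lagrangian is merely continuous in time through the measure. -/
theorem solvesEulerLagrange_path (h : IsLag (lagAlong L T m) (gradXAlong L T m) (gradVAlong L T m)
    M₀ C) {Gx : Eu d → Eu d} (hG : IsTerm (fun y => g y (m T)) Gx M₀ C) (hT : 0 < T)
    (hw : Continuous w)
    (hmin : action (lagAlong L T m) (fun y => g y (m T)) 0 T (path 0 x w) w =
      value (lagAlong L T m) (fun y => g y (m T)) 0 T x) :
    SolvesEulerLagrange L T m (path 0 x w) := by
  refine ⟨(path_mem_Curves hw).1, fun s hs => ?_⟩
  have hc := (h.hasDerivAt_costate ((L2loc.of_continuous hw).continuous_path 0 x) hw Gx T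
    s).hasDerivWithinAt (s := Icc 0 T)
  have e : ∀ r ∈ Icc 0 T, gradient (fun w' => L (path 0 x w r) w' (m r)) (vel T (path 0 x w) r) =
      costate (gradXAlong L T m) Gx T (path 0 x w) w r := fun r hr => by
    rw [← eq_costate h hG hT hw hmin r hr, vel_path hT hw hr, gradVAlong, extendFlow_eq hr]
  refine (hc.congr e (e s hs)).congr_deriv ?_
  rw [gradXAlong, extendFlow_eq hs, vel_path hT hw hs]

/-- The optimal velocity field in terms of the Legendre transform. -/
theorem gradient_hamiltonian_eq_legendreInv (hL : LagrangianAssumptions L M₀)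
    (h : IsLag (lagAlong L T m) (gradXAlong L T m) (gradVAlong L T m) M₀ C) (ht : t ∈ Icc 0 T)
    (x p : Eu d) : gradient (fun p => hamiltonian L x p (m t)) p =
      -legendreInv (gradVAlong L T m) t x (-p) := by
  have h1 := h.apply_legendreInv t x (-p)
  rw [gradVAlong, extendFlow_eq ht] at h1
  have h2 := gradient_hamiltonian hL x (legendreInv (gradVAlong L T m) t x (-p)) (m t)
  rwa [h1, neg_neg] at h2

theorem gradient_value (h : IsLag (lagAlong L T m) (gradXAlong L T m) (gradVAlong L T m) M₀ C)
    {Gx : Eu d → Eu d} (hG : IsTerm (fun y => g y (m T)) Gx M₀ C) (ht : t ∈ Ioo 0 T)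
    (hw : Continuous w)
    (hmin : action (lagAlong L T m) (fun y => g y (m T)) 0 T (path 0 x w) w =
      value (lagAlong L T m) (fun y => g y (m T)) 0 T x) :
    gradient (value (lagAlong L T m) (fun y => g y (m T)) t T) (path 0 x w t) =
      -gradVAlong L T m t (path 0 x w t) (w t) := by
  have h1 := hasFDerivAt_value h hG ht hw hmin
  refine HasGradientAt.gradient (hasGradientAt_iff_hasFDerivAt.2 (h1.congr_fderiv ?_))
  ext z
  simp

theorem measurable_gradient (f : Eu d → ℝ) : Measurable (gradient f) :=
  (InnerProductSpace.toDual ℝ (Eu d)).symm.continuous.measurable.comp (measurable_fderiv ℝ f)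

/-- The Hamiltonian vector field along the minimizers. -/
theorem vectorField_path (hL : LagrangianAssumptions L M₀)
    (h : IsLag (lagAlong L T m) (gradXAlong L T m) (gradVAlong L T m) M₀ C)
    {Gx : Eu d → Eu d} (hG : IsTerm (fun y => g y (m T)) Gx M₀ C) (ht : t ∈ Ioo 0 T)
    (hw : Continuous w)
    (hmin : action (lagAlong L T m) (fun y => g y (m T)) 0 T (path 0 x w) w =
      value (lagAlong L T m) (fun y => g y (m T)) 0 T x) :
    gradient (fun p => hamiltonian L (path 0 x w t) p (m t))
      (gradient (limitValue L g T m t) (path 0 x w t)) = -w t := by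
  have ht' := Ioo_subset_Icc_self ht
  rw [limitValue_eq_value (ht.1.trans ht.2) ht', gradient_value h hG ht hw hmin,
    gradient_hamiltonian_eq_legendreInv hL h ht', neg_neg, h.legendreInv_apply]

/-- The gradient of an arbitrary function is measurable, and the Hamiltonian field is a continuous
function of it through the inverse Legendre transform. -/
theorem measurable_vectorField (hL : LagrangianAssumptions L M₀)
    (h : IsLag (lagAlong L T m) (gradXAlong L T m) (gradVAlong L T m) M₀ C) (ht : t ∈ Icc 0 T) :
    Measurable fun x => gradient (fun p => hamiltonian L x p (m t))
      (gradient (limitValue L g T m t) x) := by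
  simp_rw [gradient_hamiltonian_eq_legendreInv hL h ht]
  exact (h.continuous_legendreInv.measurable.comp (measurable_const.prodMk
    (measurable_id.prodMk (measurable_gradient _).neg))).neg

/-- The image of a measure under a flow solves the continuity equation. -/
theorem solvesContinuityEquation_of_flow {P : Measure (Eu d)} [IsProbabilityMeasure P]
    {γ w b : ℝ → Eu d → Eu d} {B : ℝ} (hT : 0 ≤ T)
    (hγ : ∀ x s, HasDerivAt (fun s => γ s x) (w s x) s) (hw : ∀ x, Continuous fun s => w s x)
    (hγ0 : ∀ x, γ 0 x = x)
    (hγm : ∀ s ∈ Icc 0 T, AEMeasurable (γ s) P ∧ (m s).1 = P.map (γ s))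
    (hB : ∀ᵐ x ∂P, ∀ s ∈ Icc 0 T, ‖w s x‖ ≤ B) (hbm : ∀ s ∈ Ioo 0 T, Measurable (b s))
    (hb : ∀ s ∈ Ioo 0 T, ∀ x, b s (γ s x) = -w s x) :
    SolvesContinuityEquation T b m P := by
  have hγm1 := fun s hs => (hγm s hs).1
  -- No measurability of the velocities is assumed; it comes from writing them as `-b s ∘ γ s`.
  have hwm : ∀ s ∈ Ioo 0 T, AEMeasurable (w s) P := fun s hs => by
    have h1 := ((hbm s hs).comp_aemeasurable (hγm1 s (Ioo_subset_Icc_self hs))).neg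
    refine h1.congr (Eventually.of_forall fun x => ?_)
    simp [hb s hs x]
  have hB' : ∀ᵐ x ∂P, ∀ s ∈ Ioo 0 T, ‖w s x‖ ≤ B := by
    filter_upwards [hB] with x hx s hs
    exact hx s (Ioo_subset_Icc_self hs)
  have hmap : ∀ s ∈ Ioo 0 T, ∀ f : Eu d → ℝ, Measurable f →
      ∫ x, f x ∂(m s).1 = ∫ x, f (γ s x) ∂P := fun s hs f hf => by
    rw [(hγm s (Ioo_subset_Icc_self hs)).2,
      integral_map (hγm1 s (Ioo_subset_Icc_self hs)) hf.aestronglyMeasurable]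
  have hIoo : ∀ {f f' : ℝ → ℝ}, (∀ s ∈ Ioo 0 T, f s = f' s) →
      f =ᵐ[volume.restrict (Ioc 0 T)] f' := fun {f f'} hff => by
    rw [← Measure.restrict_congr_set Ioo_ae_eq_Ioc]
    exact (ae_restrict_iff' measurableSet_Ioo).2 (Eventually.of_forall hff)
  refine ⟨(ae_restrict_iff' measurableSet_Ioo).2 (Eventually.of_forall fun s hs => ?_), ?_,
    fun ψ hψ hψc hsupp => ?_⟩
  · have := (m s).2.1
    refine Integrable.of_bound (hbm s hs).aestronglyMeasurable B ?_
    rw [(hγm s (Ioo_subset_Icc_self hs)).2]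
    refine (ae_map_iff (hγm1 s (Ioo_subset_Icc_self hs))
      (measurableSet_le (hbm s hs).norm measurable_const)).2 ?_
    filter_upwards [hB'] with x hx
    rw [hb s hs x, norm_neg]
    exact hx s hs
  · have e : ∀ s ∈ Ioo 0 T, ∫ x, ‖b s x‖ ∂(m s).1 = ∫ x, ‖w s x‖ ∂P := fun s hs => by
      rw [hmap s hs _ (hbm s hs).norm]
      simp only [hb s hs, norm_neg]
    refine intervalIntegrable_of_continuousOn_Ioo (K := B * P.real univ) hT
      ((continuousOn_integral_Ioo (fun s hs => (hwm s hs).norm.aestronglyMeasurable)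
        (fun x => (hw x).norm) (K := B) ?_).congr e) fun s hs => ?_
    · filter_upwards [hB'] with x hx s hs
      rw [abs_of_nonneg (norm_nonneg _)]
      exact hx s hs
    · rw [e s hs]
      refine norm_integral_le_of_norm_le_const (μ := P) (f := fun x => ‖w s x‖) ?_
      filter_upwards [hB'] with x hx
      rw [norm_norm]
      exact hx s hs
  · have hdψ : Differentiable ℝ ψ := hψ.differentiable (by simp)
    have hcd : Continuous (fderiv ℝ ψ) := hψ.continuous_fderiv (by simp)
    have hint : ∀ s (x v : Eu d), deriv (fun r => ψ (r, x)) s -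
        inner ℝ (gradient (fun y => ψ (s, y)) x) v = fderiv ℝ ψ (s, x) (1, -v) := by
      intro s x v
      have h1 : HasDerivAt (fun r => ψ (r, x)) (fderiv ℝ ψ (s, x) (1, 0)) s :=
        HasFDerivAt.comp_hasDerivAt s (hdψ (s, x)).hasFDerivAt
          ((hasDerivAt_id s).prodMk (hasDerivAt_const s x))
      have h2 : HasFDerivAt (fun y => ψ (s, y))
          ((fderiv ℝ ψ (s, x)).comp (ContinuousLinearMap.inr ℝ ℝ (Eu d))) x :=
        HasFDerivAt.comp (g := ψ) (f := fun y => (s, y)) x (hdψ (s, x)).hasFDerivAt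
          (hasFDerivAt_prodMk_right s x)
      rw [h1.deriv, inner_gradient_eq, h2.fderiv, ContinuousLinearMap.comp_apply,
        ContinuousLinearMap.inr_apply, ← map_sub]
      simp
    have e : ∀ s ∈ Ioo 0 T, ∫ x, (deriv (fun r => ψ (r, x)) s -
        inner ℝ (gradient (fun y => ψ (s, y)) x) (b s x)) ∂(m s).1 =
        ∫ x, fderiv ℝ ψ (s, γ s x) (1, w s x) ∂P := fun s hs => by
      simp only [hint]
      have hc : Continuous fun p : Eu d × Eu d => fderiv ℝ ψ (s, p.1) (1, p.2) :=
        (hcd.comp (continuous_const.prodMk continuous_fst)).clm_apply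
          (continuous_const.prodMk continuous_snd)
      rw [hmap s hs (fun x => fderiv ℝ ψ (s, x) (1, -b s x))
        (hc.measurable.comp (measurable_id.prodMk (hbm s hs).neg))]
      simp only [hb s hs, neg_neg]
    obtain ⟨h1, h2⟩ := integral_deriv_along_flow hT hγ hw hγm1 hwm hB hψ hψc
    have hae := hIoo e
    rw [← uIoc_of_le hT] at hae
    refine ⟨h1.congr_ae hae.symm, ?_⟩
    rw [intervalIntegral.integral_congr_ae_restrict hae, h2]
    -- The support of the test function stays in `t < T`, which removes the terminal term and leaves
    -- the initial one.
    have hzero : ∀ x, ψ (T, x) = 0 := fun x => by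
      refine image_eq_zero_of_notMem_tsupport fun hx => ?_
      exact lt_irrefl T (hsupp hx).1
    simp [hzero, hγ0]

end MFG


theorem corollary4p11 {d : ℕ} {T M₀ : ℝ} (hT : 0 < T)
    (L : Eu d → Eu d → P1 (Eu d) → ℝ) (hL : LagrangianAssumptions L M₀)
    (g : Eu d → P1 (Eu d) → ℝ) (hg : TerminalAssumptions g M₀)
    (μ₀ : Measure (Eu d × Eu d)) (hμ₀ : InitialAssumptions μ₀)
    -- for every `ε > 0`, a solution of the system with control of acceleration
    (u : ℝ → ℝ → Eu d → Eu d → ℝ) (μ : ℝ → ℝ → P1 (Eu d × Eu d))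
    (hsol : ∀ ε > 0, IsEpsSolution L g T μ₀ ε (u ε) (μ ε))
    -- the limit flow `m⁰` of the space marginals along a sequence `ε_k → 0`
    (ε : ℕ → ℝ) (hε_pos : ∀ k, 0 < ε k) (hε : Tendsto ε atTop (𝓝 0))
    (m : ℝ → P1 (Eu d)) (hm : IsContinuousFlow T m)
    (hlim : FlowTendsto T (fun k t => (μ (ε k) t).fst) m) :
    -- `m⁰_t` is the image of `m₀` under the optimal Euler-Lagrange flow `γ⁰`
    (∃ γ : ℝ → Eu d → Eu d,
      (∀ᵐ x ∂(μ₀.map Prod.fst),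
        IsMinimizer L g T m 0 x (fun t => γ t x) ∧
        SolvesEulerLagrange L T m (fun t => γ t x) ∧
        ∀ σ, IsMinimizer L g T m 0 x σ → EqOn σ (fun t => γ t x) (Icc 0 T)) ∧
      ∀ t ∈ Icc 0 T, AEMeasurable (γ t) (μ₀.map Prod.fst) ∧
        (m t).1 = (μ₀.map Prod.fst).map (γ t)) ∧
    -- `m⁰` solves the continuity equation, whose vector field is defined `m⁰_t`-almost everywhere
    (∀ t ∈ Ioo 0 T, ∀ᵐ x ∂(m t).1, DifferentiableAt ℝ (limitValue L g T m t) x) ∧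
    SolvesContinuityEquation T
      (fun t x => gradient
        (fun p => hamiltonian L x p (m t)) (gradient (limitValue L g T m t) x))
      m (μ₀.map Prod.fst) ∧
    (m 0).1 = μ₀.map Prod.fst := by
  obtain ⟨C, hC⟩ := exists_isBoundAlong hL g hT.le hm
  have h := hC.isLag hL hT.le hm
  have hG := hC.isTerm hg
  have hprob := hμ₀.prob
  have hP : IsProbabilityMeasure (μ₀.map Prod.fst) :=
    Measure.isProbabilityMeasure_map measurable_fst.aemeasurable
  -- A minimizer is selected for every `x` with no measurability in `x`. Measurability is recovered
  -- below, because for almost every `x` the selected curve is a limit of the measurable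
  -- characteristics.
  choose w hw hmin using exists_minimizer h hG hT.le
  obtain ⟨X, hX, hconv⟩ := ae_tendsto_characteristics hT hL hg hμ₀
    (fun k => hsol (ε k) (hε_pos k)) hε_pos hε hm hlim hw hmin
  have hpush : ∀ t ∈ Icc 0 T, AEMeasurable (fun x => path 0 x (w x) t) (μ₀.map Prod.fst) ∧
      (m t).1 = (μ₀.map Prod.fst).map fun x => path 0 x (w x) t := by
    intro t ht
    obtain ⟨h1, h2⟩ := eq_map_of_tendsto (P := μ₀) (Z := fun z => path 0 z.1 (w z.1) t)
      (fun k => (hX k t ht).1) (by filter_upwards [hconv] with z hz using hz t ht)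
      (fun k => (hX k t ht).2) (ν := m t) (by
        rw [Metric.tendsto_nhds]
        intro η hη
        filter_upwards [hlim η hη] with k hk
        rw [Real.dist_eq, sub_zero, abs_of_nonneg (d1_nonneg _ _)]
        exact hk t ht)
    -- The limit is so far measurable as a function of position and velocity, while it depends on
    -- the position alone.
    have h3 := aemeasurable_of_comp_fst (f := fun x => path 0 x (w x) t) h1
    refine ⟨h3, ?_⟩
    rw [AEMeasurable.map_map_of_aemeasurable h3 measurable_fst.aemeasurable]
    exact h2
  have h0 : (0 : ℝ) ∈ Icc 0 T := ⟨le_rfl, hT.le⟩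
  obtain ⟨R, hR⟩ := hμ₀.exists_bound_fst
  obtain ⟨B, hB⟩ := exists_velocity_bound h hG hT R
  refine ⟨⟨fun t x => path 0 x (w x) t, ?_, hpush⟩, fun t ht => ?_, ?_, ?_⟩
  · filter_upwards [hμ₀.map_fst_absolutelyContinuous.ae_le (ae_differentiableAt_value h hG hT.le)]
      with x hx
    refine ⟨isMinimizer_path h hG hT h0 (hw x) (hmin x),
      solvesEulerLagrange_path h hG hT (hw x) (hmin x), fun σ hσ s hs => ?_⟩
    obtain ⟨v, hv, heq, hvmin⟩ := hσ.exists_velocity hT h0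
    rw [heq s hs]
    exact minimizer_unique h hG hT hx hv (hw x) hvmin (hmin x) hs
  · obtain ⟨h1, h2⟩ := hpush t (Ioo_subset_Icc_self ht)
    rw [h2]
    -- The measure at time `t` is carried by the points that the selected minimizers occupy at this
    -- interior time, and the value function is differentiable at each of them.
    refine (ae_map_iff h1 (measurableSet_of_differentiableAt ℝ _)).2
      (Eventually.of_forall fun x => ?_)
    rw [limitValue_eq_value hT (Ioo_subset_Icc_self ht)]
    exact (hasFDerivAt_value h hG ht (hw x) (hmin x)).differentiableAt
  · refine solvesContinuityEquation_of_flow (γ := fun t x => path 0 x (w x) t)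
      (w := fun t x => w x t) (B := B) hT.le (fun x s => hasDerivAt_path (hw x) 0 x s) hw
      (fun x => path_self) hpush ?_ (fun s hs => ?_) fun s hs x => ?_
    · filter_upwards [hR] with x hx
      exact hB x (w x) hx (hw x) (hmin x)
    · exact measurable_vectorField hL h (Ioo_subset_Icc_self hs)
    · exact vectorField_path hL h hG hs (hw x) (hmin x)
  · rw [(hpush 0 h0).2]
    simp
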